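/- **Setting.** Let $n\ge 1$, let $f:\mathbb R^n\to\mathbb R$ be twice continuously differentiable, and let $x^0\in\mathbb R^n$ be such that the level set $\mathscr L=\{x: f(x)\le f(x^0)\}$ is compact. Suppose that for some $\nu\in[0,1]$ and $H_\nu>0$, $$\|\nabla^2 f(x)-\nabla^2 f(y)\|\le H_\nu\|x-y\|^\nu\qquad\text{for all }x,y\in\Omega,$$ where $\Omega$ is a bounded convex open set containing $\mathscr L$ (Euclidean and spectral norms, $0^0=1$). Let $f_{\rm low}\in\mathbb R$ and $U_H>0$ satisfy $f\ge f_{\rm low}$ and $\|\nabla^2 f\|\le U_H$ on $\mathscr L$. Let $\epsilon_g\in(0,1)$ and let the algorithm parameters satisfy $\zeta,\theta,\eta\in(0,1)$, $\gamma_{-1}>0$, $r>1$. Write $\operatorname{sgn}(s)=1$ for $s\ge0$ and $-1$ for $s<0$. **Capped CG method** (input: symmetric $H$, $g\ne0$, $\varepsilon>0$, $\zeta$). Put $\bar H=H+2\varepsilon I$, $U=0$ and, for the current value of $U$ at any time, $\kappa=(U+2\varepsilon)/\varepsilon$, $\hat\zeta=\zeta/(3\kappa)$, $\tau=\sqrt\kappa/(\sqrt\kappa+1)$,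 $M=4\kappa^4/(1-\sqrt\tau)^2$. "Update $U$ with $v$" means: if $\|Hv\|>U\|v\|$, set $U=\|Hv\|/\|v\|$. Let $y^0=0$, $r^0=g$, $p^0=-g$. If $(p^0)^T\bar Hp^0<\varepsilon\|p^0\|^2$, return $(p^0,\mathrm{NC})$; otherwise update $U$ with $p^0$. For $j=1,2,\dots$: with $\alpha_{j-1}=\|r^{j-1}\|^2/((p^{j-1})^T\bar Hp^{j-1})$ set $y^j=y^{j-1}+\alpha_{j-1}p^{j-1}$, $r^j=r^{j-1}+\alpha_{j-1}\bar Hp^{j-1}$, $p^j=-r^j+(\|r^j\|^2/\|r^{j-1}\|^2)p^{j-1}$; update $U$ with $p^j$, $y^j$, $r^j$; then apply the first applicable rule: (1) if $(y^j)^T\bar Hy^j<\varepsilon\|y^j\|^2$, return $(y^j,\mathrm{NC})$; (2) if $\|r^j\|\le\hat\zeta\|r^0\|$, return $(y^j,\mathrm{SOL})$; (3) if $(p^j)^T\bar Hp^j<\varepsilon\|p^j\|^2$, return $(p^j,\mathrm{NC})$; (4) if $\|r^j\|>\sqrt M\,\tau^{j/2}\|r^0\|$, compute $y^{j+1}$ as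 above, find any $i\in\{0,\dots,j-1\}$ such that $v=y^{j+1}-y^i$ satisfies $v^T\bar Hv<\varepsilon\|v\|^2$, and return $(v,\mathrm{NC})$. **Parameter-free Newton-CG method.** For $k=0,1,2,\dots$: if $\|\nabla f(x^k)\|\le\epsilon_g$, output $x^k$ and stop. Otherwise let $\sigma_0=\max\{\gamma_{-1},\gamma_{k-1}/r\}$ and for $t=0,1,2,\dots$ let $\sigma_t=r^t\sigma_0$ and call the capped CG method with $H=\nabla^2f(x^k)$, $g=\nabla f(x^k)$, $\varepsilon=(\sigma_t\epsilon_g)^{1/2}$, accuracy $\zeta$, to get $(d,\text{type})$. - If type is SOL, put $\hat d=d$. If $f(x^k+\hat d)\le f(x^k)$ and $\|\nabla f(x^k+\hat d)\|\le\epsilon_g$, put $j_t=0$ and leave the $t$-loop. Otherwise, if $6\|\hat d\|\ge(\epsilon_g/\sigma_t)^{1/2}$ and some integer $j\ge0$ satisfies both $\theta^j\ge\min\{1,2(1-\eta)\theta(\epsilon_g/\sigma_t)^{1/4}/(3\|\hat d\|^{1/2})\}$ and $$f(x^k+\theta^j\hat d)\le f(x^k)-\eta(\sigma_t\epsilon_g)^{1/2}\theta^{2j}\|\hat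 d\|^2,\qquad(*)$$ let $j_t$ be the smallest $j\ge0$ satisfying $(*)$ and leave the $t$-loop. - If type is NC, put $\hat d=-\operatorname{sgn}(d^Tg)\max\{1,1/\sigma_t\}\,|d^THd|\,\|d\|^{-3}d$. If some integer $j\ge0$ satisfies both $\theta^{j-1}\ge\min\{1,1/\sigma_t\}$ and $$f(x^k+\theta^j\hat d)\le f(x^k)-\eta\min\{1,\sigma_t\}\theta^{2j}\|\hat d\|^3/4,\qquad(**)$$ let $j_t$ be the smallest $j\ge0$ satisfying $(**)$ and leave the $t$-loop. After leaving the $t$-loop set $\gamma_k=\sigma_t$ and $x^{k+1}=x^k+\theta^{j_t}\hat d$. An *outer iteration* is an update of $x^k$ to $x^{k+1}$; an *inner iteration* is a call of the capped CG method. **Quantities.** Let $\gamma_\nu(\epsilon_g)=4H_\nu^{2/(1+\nu)}\epsilon_g^{-(1-\nu)/(1+\nu)}$, $\sigma(\epsilon_g)=\max\{\gamma_{-1},r\gamma_\nu(\epsilon_g)\}$, $T=\lceil\log(\sigma(\epsilon_g)/\gamma_{-1})/\log r\rceil_++2$, $\hat c_{\rm sol}=\frac\eta6\min\{\frac16,(\frac{2(1-\eta)\theta}3)^2\}$,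 $c_{\rm nc}=\frac{\eta\theta^2}4$, $$\overline K_1=\left\lceil\frac{f(x^0)-f_{\rm low}}{\min\{\hat c_{\rm sol},c_{\rm nc}\}}\,\sigma(\epsilon_g)^{1/2}\epsilon_g^{-3/2}\right\rceil+1.$$ **Theorem.** (i) The method is well defined (no step of any execution fails), every execution is finite, it performs at most $\overline K_1$ outer iterations and at most $T+2\overline K_1$ inner iterations, and its output $x^k$, for some $0\le k\le\overline K_1$, satisfies $\|\nabla f(x^k)\|\le\epsilon_g$. Moreover $\overline K_1$ and $T+2\overline K_1$ are $O\big(H_\nu^{1/(1+\nu)}\epsilon_g^{-(2+\nu)/(1+\nu)}\big)$: for all $h>0$ and $\Delta\in\mathbb R$ there is a constant $C$, depending only on $h,\Delta$ and the algorithm parameters, such that $$\overline K_1\le C\,H_\nu^{1/(1+\nu)}\epsilon_g^{-(2+\nu)/(1+\nu)},\qquad T+2\overline K_1\le C\,H_\nu^{1/(1+\nu)}\epsilon_g^{-(2+\nu)/(1+\nu)}$$ whenever $\nu\in[0,1]$, $H_\nu\ge h$, $\epsilon_g\in(0,1)$ and $0\le f(x^0)-f_{\rm low}\le\Delta$. (ii)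 The total number of gradient evaluations and Hessian-vector products is $\widetilde O\big(\min\{n,U_H^{1/2}/(H_\nu\epsilon_g^\nu)^{1/(2+2\nu)}\}H_\nu^{1/(1+\nu)}\epsilon_g^{-(2+\nu)/(1+\nu)}\big)$: for all $h,u>0$ and $\Delta\in\mathbb R$ there is a constant $C$, depending only on $h,u,\Delta$ and the algorithm parameters, such that for all $n\ge1$ and all $f,x^0,\Omega,\nu,H_\nu,f_{\rm low},U_H,\epsilon_g$ as above with $H_\nu\ge h$, $U_H\ge u$ and $f(x^0)-f_{\rm low}\le\Delta$, this number is at most $$C\,\min\left\{n,\frac{U_H^{1/2}}{(H_\nu\epsilon_g^\nu)^{1/(2+2\nu)}}\right\}H_\nu^{1/(1+\nu)}\epsilon_g^{-(2+\nu)/(1+\nu)}\,\Big(1+\log(1+U_H)+\log(1+H_\nu)+\log\tfrac1{\epsilon_g}\Big)^2.$$ Here one gradient evaluation is counted at $x^0$, at every new iterate and at every trial point $x^k+d$ with $d$ of type SOL. Per call of the capped CG method ending in pass $j$, $1+3j$ Hessian-vector products are counted ($j=0$ if it stops at $p^0$), plus $j$ more if it ends by rule (4), plus one more if the type is NC (for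 $d^THd$). -/

import Mathlib

namespace ParamFreeNCG

noncomputable section

/-- The `n`-dimensional Euclidean space. -/
abbrev Vec (n : ℕ) : Type := EuclideanSpace ℝ (Fin n)

/-- `sgn s` is `1` if `s ≥ 0` and `-1` otherwise. -/
def sgn (s : ℝ) : ℝ := if 0 ≤ s then 1 else -1

/-- The Hessian of `f` at `x`, as a linear operator; its operator norm is the spectral norm. -/
def hess {n : ℕ} (f : Vec n → ℝ) (x : Vec n) : Vec n →L[ℝ] Vec n :=
  fderiv ℝ (gradient f) x

/-! ### The capped conjugate gradient method (started with `U = 0`) -/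

/-- Type of the direction returned by the capped CG method: approximate solution or negative
curvature. -/
inductive DirType : Type
  | sol : DirType
  | nc : DirType

/-- `κ = (U + 2ε)/ε`. -/
def cgKappa (ε U : ℝ) : ℝ := (U + 2 * ε) / ε

/-- `ζ̂ = ζ/(3κ)`. -/
def cgZetaHat (ζ ε U : ℝ) : ℝ := ζ / (3 * cgKappa ε U)

/-- `τ = √κ/(√κ + 1)`. -/
def cgTau (ε U : ℝ) : ℝ := √(cgKappa ε U) / (√(cgKappa ε U) + 1)

/-- `T = 4κ⁴/(1 - √τ)²`. -/
def cgCap (ε U : ℝ) : ℝ := 4 * cgKappa ε U ^ 4 / (1 - √(cgTau ε U)) ^ 2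

/-- The product `(H + 2εI) v`. -/
def damped {n : ℕ} (H : Vec n →L[ℝ] Vec n) (ε : ℝ) (v : Vec n) : Vec n := H v + (2 * ε) • v

/-- `vᵀ (H + 2εI) v < ε ‖v‖²`. -/
def NegCurv {n : ℕ} (H : Vec n →L[ℝ] Vec n) (ε : ℝ) (v : Vec n) : Prop :=
  inner ℝ v (damped H ε v) < ε * ‖v‖ ^ 2

/-- If `‖H v‖ > U ‖v‖` replace `U` by `‖H v‖/‖v‖`, otherwise keep it. -/
def raiseU {n : ℕ} (H : Vec n →L[ℝ] Vec n) (U : ℝ) (v : Vec n) : ℝ :=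
  if U * ‖v‖ < ‖H v‖ then ‖H v‖ / ‖v‖ else U

/-- The data `y^j, r^j, p^j` of the CG recursion, with the value of `U` after the updates made
for the index `j`. The quantities `κ, ζ̂, τ, T` are functions of `U`. -/
structure CGState (n : ℕ) where
  y : Vec n
  r : Vec n
  p : Vec n
  U : ℝ

/-- `y⁰ = 0, r⁰ = g, p⁰ = -g`. -/
def cgInit {n : ℕ} (H : Vec n →L[ℝ] Vec n) (g : Vec n) : CGState n where
  y := 0
  r := g
  p := -g
  U := raiseU H 0 (-g)

/-- `α_j = (r^j)ᵀ r^j / (p^j)ᵀ (H + 2εI) p^j`. -/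
def cgAlpha {n : ℕ} (H : Vec n →L[ℝ] Vec n) (ε : ℝ) (s : CGState n) : ℝ :=
  inner ℝ s.r s.r / inner ℝ s.p (damped H ε s.p)

def cgNextY {n : ℕ} (H : Vec n →L[ℝ] Vec n) (ε : ℝ) (s : CGState n) : Vec n :=
  s.y + cgAlpha H ε s • s.p

def cgNextR {n : ℕ} (H : Vec n →L[ℝ] Vec n) (ε : ℝ) (s : CGState n) : Vec n :=
  s.r + cgAlpha H ε s • damped H ε s.p

/-- `p^{j+1} = -r^{j+1} + β_{j+1} p^j` with `β_{j+1} = ‖r^{j+1}‖²/‖r^j‖²`. -/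
def cgNextP {n : ℕ} (H : Vec n →L[ℝ] Vec n) (ε : ℝ) (s : CGState n) : Vec n :=
  -cgNextR H ε s + (‖cgNextR H ε s‖ ^ 2 / ‖s.r‖ ^ 2) • s.p

/-- One pass through the CG operations and the three updates of `U`. -/
def cgStep {n : ℕ} (H : Vec n →L[ℝ] Vec n) (ε : ℝ) (s : CGState n) : CGState n where
  y := cgNextY H ε s
  r := cgNextR H ε s
  p := cgNextP H ε s
  U := raiseU H (raiseU H (raiseU H s.U (cgNextP H ε s)) (cgNextY H ε s)) (cgNextR H ε s)

/-- The sequence of CG data. -/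
def cgIter {n : ℕ} (H : Vec n →L[ℝ] Vec n) (ε : ℝ) (g : Vec n) : ℕ → CGState n
  | 0 => cgInit H g
  | j + 1 => cgStep H ε (cgIter H ε g j)

/-- `‖r^j‖ ≤ ζ̂ ‖r⁰‖`. -/
def CGSolved {n : ℕ} (H : Vec n →L[ℝ] Vec n) (ε ζ : ℝ) (g : Vec n) (j : ℕ) : Prop :=
  ‖(cgIter H ε g j).r‖ ≤ cgZetaHat ζ ε (cgIter H ε g j).U * ‖g‖

/-- `‖r^j‖ > √T τ^{j/2} ‖r⁰‖`. -/
def CGSlow {n : ℕ} (H : Vec n →L[ℝ] Vec n) (ε : ℝ) (g : Vec n) (j : ℕ) : Prop :=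
  √(cgCap ε (cgIter H ε g j).U) * cgTau ε (cgIter H ε g j).U ^ ((j : ℝ) / 2) * ‖g‖
    < ‖(cgIter H ε g j).r‖

/-- None of the four termination tests at the end of pass `j` of the loop fires. -/
def CGContinues {n : ℕ} (H : Vec n →L[ℝ] Vec n) (ε ζ : ℝ) (g : Vec n) (j : ℕ) : Prop :=
  ¬ NegCurv H ε (cgIter H ε g j).y ∧ ¬ CGSolved H ε ζ g j ∧
    ¬ NegCurv H ε (cgIter H ε g j).p ∧ ¬ CGSlow H ε g j

/-- The method executes pass `j ≥ 1` of its loop. -/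
def CGReaches {n : ℕ} (H : Vec n →L[ℝ] Vec n) (ε ζ : ℝ) (g : Vec n) (j : ℕ) : Prop :=
  1 ≤ j ∧ ¬ NegCurv H ε (-g) ∧ ∀ i, 1 ≤ i → i < j → CGContinues H ε ζ g i

/-- `CappedCG H ε ζ g ty d m`: the capped CG method for `(H + 2εI) d = -g`, with accuracy `ζ`
and started with `U = 0`, can return the direction `d` of type `ty` after `m` products of `H`
with a vector. (The index `i` in `nc_slow` may be any admissible one.)

Products are counted one by one, without exploiting linearity: `H p⁰` at the beginning,
`H p^j`, `H y^j`, `H r^j` in pass `j`, and at most one product for each of the `j` candidates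
`y^{j+1} - y^i`. -/
inductive CappedCG {n : ℕ} (H : Vec n →L[ℝ] Vec n) (ε ζ : ℝ) (g : Vec n) :
    DirType → Vec n → ℕ → Prop
  | nc_init : NegCurv H ε (-g) → CappedCG H ε ζ g DirType.nc (-g) 1
  | nc_y (j : ℕ) : CGReaches H ε ζ g j → NegCurv H ε (cgIter H ε g j).y →
      CappedCG H ε ζ g DirType.nc (cgIter H ε g j).y (1 + 3 * j)
  | sol (j : ℕ) : CGReaches H ε ζ g j → ¬ NegCurv H ε (cgIter H ε g j).y →
      CGSolved H ε ζ g j →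
      CappedCG H ε ζ g DirType.sol (cgIter H ε g j).y (1 + 3 * j)
  | nc_p (j : ℕ) : CGReaches H ε ζ g j → ¬ NegCurv H ε (cgIter H ε g j).y →
      ¬ CGSolved H ε ζ g j → NegCurv H ε (cgIter H ε g j).p →
      CappedCG H ε ζ g DirType.nc (cgIter H ε g j).p (1 + 3 * j)
  | nc_slow (j i : ℕ) : CGReaches H ε ζ g j → ¬ NegCurv H ε (cgIter H ε g j).y →
      ¬ CGSolved H ε ζ g j → ¬ NegCurv H ε (cgIter H ε g j).p → CGSlow H ε g j → i < j →
      NegCurv H ε ((cgIter H ε g (j + 1)).y - (cgIter H ε g i).y) →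
      CappedCG H ε ζ g DirType.nc ((cgIter H ε g (j + 1)).y - (cgIter H ε g i).y)
        (1 + 3 * j + j)

/-! ### The parameter-free Newton-CG method (without second-order tolerance) -/

/-- The inputs of the method other than the tolerance `ε_g` and the starting point:
CG accuracy `ζ`, trial regularization `γ_{-1}`, ratios `r` and `θ`, line-search parameter `η`. -/
structure Params where
  ζ : ℝ
  γinit : ℝ
  r : ℝ
  θ : ℝ
  η : ℝ

/-- The ranges prescribed for the inputs. -/
structure Params.Valid (P : Params) : Prop where
  ζ_mem : P.ζ ∈ Set.Ioo (0 : ℝ) 1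
  γinit_pos : 0 < P.γinit
  one_lt_r : 1 < P.r
  θ_mem : P.θ ∈ Set.Ioo (0 : ℝ) 1
  η_mem : P.η ∈ Set.Ioo (0 : ℝ) 1

/-- A state of the method: the current iterate `x^k`, the value `γ_{k-1}`, the index `t` of the
current inner iteration, and counters for the completed outer iterations (updates of `x`), the
completed inner iterations (calls of the capped CG method), the gradient evaluations and the
Hessian-vector products. -/
structure NCGState (n : ℕ) where
  x : Vec n
  γ : ℝ
  t : ℕ
  outer : ℕ
  inner : ℕ
  grads : ℕ
  hvps : ℕ

/-- Initial state; the gradient at `x⁰` has been evaluated. -/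
def ncgInit {n : ℕ} (P : Params) (x0 : Vec n) : NCGState n where
  x := x0
  γ := P.γinit
  t := 0
  outer := 0
  inner := 0
  grads := 1
  hvps := 0

/-- `σ_t = r^t max{γ_{-1}, γ_{k-1}/r}`. -/
def trialSigma {n : ℕ} (P : Params) (s : NCGState n) : ℝ :=
  P.r ^ s.t * max P.γinit (s.γ / P.r)

/-- The rescaled direction
`-sgn(dᵀg) max{1, 1/σ} (|dᵀ H d| / ‖d‖³) d`. -/
def ncDir {n : ℕ} (H : Vec n →L[ℝ] Vec n) (g : Vec n) (σ : ℝ) (d : Vec n) : Vec n :=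
  (-(sgn (inner ℝ d g)) * max 1 (1 / σ) * (|inner ℝ d (H d)| / ‖d‖ ^ 3)) • d

/-- `f(x + θ^j d) ≤ f(x) - η (σ ε_g)^{1/2} θ^{2j} ‖d‖²`. -/
def SolDecrease {n : ℕ} (f : Vec n → ℝ) (ε : ℝ) (P : Params) (x : Vec n) (σ : ℝ) (d : Vec n)
    (j : ℕ) : Prop :=
  f (x + P.θ ^ j • d) ≤ f x - P.η * √(σ * ε) * P.θ ^ (2 * j) * ‖d‖ ^ 2

/-- `f(x + θ^j d) ≤ f(x) - η min{1, σ} θ^{2j} ‖d‖³ / 4`. -/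
def NcDecrease {n : ℕ} (f : Vec n → ℝ) (P : Params) (x : Vec n) (σ : ℝ) (d : Vec n)
    (j : ℕ) : Prop :=
  f (x + P.θ ^ j • d) ≤ f x - P.η * min 1 σ * P.θ ^ (2 * j) * ‖d‖ ^ 3 / 4

/-- The trial direction `d` of type SOL is accepted with step size `θ^j`. -/
inductive SolAccept {n : ℕ} (f : Vec n → ℝ) (ε : ℝ) (P : Params) (x : Vec n) (σ : ℝ)
    (d : Vec n) : ℕ → Prop
  | full : f (x + d) ≤ f x → ‖gradient f (x + d)‖ ≤ ε → SolAccept f ε P x σ d 0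
  | search (j : ℕ) : ¬ (f (x + d) ≤ f x ∧ ‖gradient f (x + d)‖ ≤ ε) →
      √(ε / σ) ≤ 6 * ‖d‖ →
      (∃ i : ℕ,
        min 1 (2 * (1 - P.η) * P.θ * (ε / σ) ^ (1 / 4 : ℝ) / (3 * √‖d‖)) ≤ P.θ ^ i ∧
        SolDecrease f ε P x σ d i) →
      IsLeast {i : ℕ | SolDecrease f ε P x σ d i} j →
      SolAccept f ε P x σ d j

/-- The trial direction `d` of type NC is accepted with step size `θ^j`. -/
def NcAccept {n : ℕ} (f : Vec n → ℝ) (P : Params) (x : Vec n) (σ : ℝ) (d : Vec n)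
    (j : ℕ) : Prop :=
  (∃ i : ℕ, min 1 (1 / σ) ≤ P.θ ^ ((i : ℤ) - 1) ∧ NcDecrease f P x σ d i) ∧
    IsLeast {i : ℕ | NcDecrease f P x σ d i} j

/-- One inner iteration of the method, possible only while `‖∇f(x^k)‖ > ε_g`. Each trial
direction of type SOL costs one gradient evaluation (at `x^k + d`), each new iterate one more
(at `x^{k+1}`), and forming an NC direction one Hessian-vector product (for `dᵀ H d`). -/
inductive NCGStep {n : ℕ} (f : Vec n → ℝ) (ε : ℝ) (P : Params) :
    NCGState n → NCGState n → Prop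
  | sol_accept (s : NCGState n) (d : Vec n) (m j : ℕ) :
      ε < ‖gradient f s.x‖ →
      CappedCG (hess f s.x) (√(trialSigma P s * ε)) P.ζ (gradient f s.x) DirType.sol d m →
      SolAccept f ε P s.x (trialSigma P s) d j →
      NCGStep f ε P s
        { x := s.x + P.θ ^ j • d
          γ := trialSigma P s
          t := 0
          outer := s.outer + 1
          inner := s.inner + 1
          grads := s.grads + 2
          hvps := s.hvps + m }
  | sol_reject (s : NCGState n) (d : Vec n) (m : ℕ) :
      ε < ‖gradient f s.x‖ →
      CappedCG (hess f s.x) (√(trialSigma P s * ε)) P.ζ (gradient f s.x) DirType.sol d m →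
      (∀ j, ¬ SolAccept f ε P s.x (trialSigma P s) d j) →
      NCGStep f ε P s
        { x := s.x
          γ := s.γ
          t := s.t + 1
          outer := s.outer
          inner := s.inner + 1
          grads := s.grads + 1
          hvps := s.hvps + m }
  | nc_accept (s : NCGState n) (d : Vec n) (m j : ℕ) :
      ε < ‖gradient f s.x‖ →
      CappedCG (hess f s.x) (√(trialSigma P s * ε)) P.ζ (gradient f s.x) DirType.nc d m →
      NcAccept f P s.x (trialSigma P s)
        (ncDir (hess f s.x) (gradient f s.x) (trialSigma P s) d) j →
      NCGStep f ε P s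
        { x := s.x + P.θ ^ j • ncDir (hess f s.x) (gradient f s.x) (trialSigma P s) d
          γ := trialSigma P s
          t := 0
          outer := s.outer + 1
          inner := s.inner + 1
          grads := s.grads + 1
          hvps := s.hvps + (m + 1) }
  | nc_reject (s : NCGState n) (d : Vec n) (m : ℕ) :
      ε < ‖gradient f s.x‖ →
      CappedCG (hess f s.x) (√(trialSigma P s * ε)) P.ζ (gradient f s.x) DirType.nc d m →
      (∀ j, ¬ NcAccept f P s.x (trialSigma P s)
        (ncDir (hess f s.x) (gradient f s.x) (trialSigma P s) d) j) →
      NCGStep f ε P s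
        { x := s.x
          γ := s.γ
          t := s.t + 1
          outer := s.outer
          inner := s.inner + 1
          grads := s.grads
          hvps := s.hvps + (m + 1) }

/-- The state `s` occurs in some execution of the method started at `x0`. -/
def Reachable {n : ℕ} (f : Vec n → ℝ) (ε : ℝ) (P : Params) (x0 : Vec n) (s : NCGState n) :
    Prop :=
  Relation.ReflTransGen (NCGStep f ε P) (ncgInit P x0) s

/-! ### Assumptions and complexity quantities -/

/-- The level set `{x : f(x) ≤ f(x⁰)}`. -/
def levelSet {n : ℕ} (f : Vec n → ℝ) (x0 : Vec n) : Set (Vec n) := {x | f x ≤ f x0}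

/-- The standing assumption: compact level set, `f` twice continuously differentiable, and the
Hessian Hölder continuous with modulus `H` and exponent `ν` on the bounded convex open
neighborhood `Ω` of the level set. -/
structure HolderHessian {n : ℕ} (f : Vec n → ℝ) (x0 : Vec n) (Ω : Set (Vec n)) (ν H : ℝ) :
    Prop where
  compact_levelSet : IsCompact (levelSet f x0)
  contDiff : ContDiff ℝ 2 f
  bounded : Bornology.IsBounded Ω
  convex : Convex ℝ Ω
  isOpen : IsOpen Ω
  levelSet_subset : levelSet f x0 ⊆ Ω
  ν_mem : ν ∈ Set.Icc (0 : ℝ) 1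
  H_pos : 0 < H
  holder : ∀ x ∈ Ω, ∀ y ∈ Ω, ‖hess f x - hess f y‖ ≤ H * ‖x - y‖ ^ ν

/-- `γ_ν(ε) = 4 H^{2/(1+ν)} ε^{-(1-ν)/(1+ν)}`. -/
def gammaNu (ν H ε : ℝ) : ℝ := 4 * H ^ (2 / (1 + ν)) * ε ^ (-(1 - ν) / (1 + ν))

/-- `σ(ε) = max{γ_{-1}, r γ_ν(ε)}`. -/
def sigmaMax (P : Params) (ν H ε : ℝ) : ℝ := max P.γinit (P.r * gammaNu ν H ε)

/-- `T = ⌈log(σ(ε)/γ_{-1}) / log r⌉₊ + 2`. -/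
def innerT (P : Params) (ν H ε : ℝ) : ℕ :=
  ⌈Real.log (sigmaMax P ν H ε / P.γinit) / Real.log P.r⌉₊ + 2

/-- `ĉ_sol = (η/6) min{1/6, (2(1-η)θ/3)²}`. -/
def cSolHat (P : Params) : ℝ := P.η / 6 * min (1 / 6) ((2 * (1 - P.η) * P.θ / 3) ^ 2)

/-- `c_nc = ηθ²/4`. -/
def cNc (P : Params) : ℝ := P.η * P.θ ^ 2 / 4

/-- `K̄₁ = ⌈(gap / min{ĉ_sol, c_nc}) σ(ε)^{1/2} ε^{-3/2}⌉ + 1`, where `gap = f(x⁰) - f_low ≥ 0`. -/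
def K1bar (P : Params) (ν H ε gap : ℝ) : ℕ :=
  ⌈gap / min (cSolHat P) (cNc P) * √(sigmaMax P ν H ε) * ε ^ (-(3 / 2) : ℝ)⌉₊ + 1

/-- `H^{1/(1+ν)} ε^{-(2+ν)/(1+ν)}`. -/
def iterRate (ν H ε : ℝ) : ℝ := H ^ (1 / (1 + ν)) * ε ^ (-(2 + ν) / (1 + ν))

/-- `min{n, U^{1/2} / (H ε^ν)^{1/(2+2ν)}}`. -/
def cgRate (n : ℕ) (U ν H ε : ℝ) : ℝ :=
  min (n : ℝ) (√U / (H * ε ^ ν) ^ (1 / (2 + 2 * ν)))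

/-- The logarithmic quantity hidden in `Õ`. -/
def logTerm (U H ε : ℝ) : ℝ := 1 + Real.log (1 + U) + Real.log (1 + H) + Real.log (1 / ε)

end

end ParamFreeNCG

open ParamFreeNCG

/-! Put e = √(σε) and δ = √(ε/σ), so σδ = e and eδ = ε. Hölder continuity enters the acceptance
analysis through one inequality: if σ ≥ γ_ν(ε), then H s^ν ≤ max(e/2, σs/4) for all s ≥ 0
(`holder_le_max`). So along segments in the level set the Hessian varies by at most max(e/2, σs/4),
an amount which the damping 2eI, or the detected negative curvature, dominates on the relevant
steps. For such σ every trial direction is accepted (`exists_solAccept`, `exists_ncAccept`),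
although neither ν nor H is known to the method. Rejections thus happen only while σ < γ_ν(ε), and
trial values stay below σ(ε). An accepted step lowers f by a constant times εδ = ε^{3/2}σ^{-1/2},
except possibly one that lands at a small gradient and ends the run; summing bounds the outer
iterations. A rejection multiplies σ by r and an acceptance costs at most one factor r, so counting
powers of r bounds the inner ones (`NCGInv`).

Capped CG stops within n passes because its residuals are orthogonal. Its slow-convergence exit
never fails: if no candidate difference had curvature below ε, the model would be strongly convex
between y^{j+1} and all earlier iterates, and an estimate-sequence argument would force the residual
to decay at rate τ^{j/2} (`exists_negCurv_of_cgSlow`). Hence there are also only O(√κ log κ) passes.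

For the total cost, a call needs O(n) products, and up to logarithms also at most 1 + √U
(σε)^{-1/4}. The weights (σε)^{-1/4} form geometric sums over rejections and are paid for by the
decrease of f at acceptances (`cost_step`). The summand 1 counts inner iterations. These are bounded
twice, with (ν, H) and with (0, 2U), the latter because the Hessian is bounded on the level set; the
geometric mean of the two bounds is exactly the required rate (`operation_complexity`). -/

namespace ParamFreeNCG

section

variable {n : ℕ} {H : Vec n →L[ℝ] Vec n} {ε ζ : ℝ} {g : Vec n}

/-! ### Algebra of the conjugate gradient recursion -/

lemma damped_add (u v : Vec n) : damped H ε (u + v) = damped H ε u + damped H ε v := by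
  simp only [damped, map_add, smul_add]; abel

lemma damped_smul (c : ℝ) (v : Vec n) : damped H ε (c • v) = c • damped H ε v := by
  simp only [damped, map_smul, smul_add, smul_comm c (2 * ε)]

lemma damped_neg (v : Vec n) : damped H ε (-v) = -damped H ε v := by
  simp only [damped, map_neg, smul_neg, neg_add]

lemma damped_sub (u v : Vec n) : damped H ε (u - v) = damped H ε u - damped H ε v := by
  rw [sub_eq_add_neg, damped_add, damped_neg, ← sub_eq_add_neg]

lemma damped_zero : damped H ε 0 = 0 := by simp [damped]

lemma inner_damped_comm (hH : ∀ u v, inner ℝ (H u) v = inner ℝ u (H v)) (u v : Vec n) :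
    inner ℝ u (damped H ε v) = inner ℝ v (damped H ε u) := by
  simp only [damped, inner_add_right, real_inner_smul_right]
  rw [← hH, real_inner_comm, real_inner_comm u v]

lemma inner_damped_self (v : Vec n) :
    inner ℝ v (damped H ε v) = inner ℝ v (H v) + 2 * ε * ‖v‖ ^ 2 := by
  simp [damped, inner_add_right, real_inner_smul_right]

lemma norm_damped_le {U : ℝ} (hε : 0 ≤ ε) {v : Vec n} (hv : ‖H v‖ ≤ U * ‖v‖) :
    ‖damped H ε v‖ ≤ (U + 2 * ε) * ‖v‖ := by
  calc ‖damped H ε v‖ ≤ ‖H v‖ + ‖(2 * ε) • v‖ := norm_add_le _ _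
    _ ≤ U * ‖v‖ + 2 * ε * ‖v‖ := by
        rw [norm_smul, Real.norm_of_nonneg (by positivity)]; linarith
    _ = _ := by ring

lemma cgIter_residual (j : ℕ) :
    (cgIter H ε g j).r = damped H ε (cgIter H ε g j).y + g := by
  induction j with
  | zero => simp [cgIter, cgInit, damped_zero]
  | succ j ih =>
    simp only [cgIter, cgStep, cgNextR, cgNextY, damped_add, damped_smul]
    rw [ih]; abel

lemma cgIter_y_succ (j : ℕ) : (cgIter H ε g (j + 1)).y =
    (cgIter H ε g j).y + cgAlpha H ε (cgIter H ε g j) • (cgIter H ε g j).p := rfl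

lemma cgIter_r_succ (j : ℕ) : (cgIter H ε g (j + 1)).r =
    (cgIter H ε g j).r + cgAlpha H ε (cgIter H ε g j) • damped H ε (cgIter H ε g j).p := rfl

lemma cgIter_p_succ (j : ℕ) : (cgIter H ε g (j + 1)).p =
    -(cgIter H ε g (j + 1)).r +
      (‖(cgIter H ε g (j + 1)).r‖ ^ 2 / ‖(cgIter H ε g j).r‖ ^ 2) • (cgIter H ε g j).p := rfl

/-- The recursion does not break down before step `k`. -/
def CGRegular (H : Vec n →L[ℝ] Vec n) (ε : ℝ) (g : Vec n) (k : ℕ) : Prop :=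
  ∀ i < k, (cgIter H ε g i).r ≠ 0 ∧
    0 < inner ℝ (cgIter H ε g i).p (damped H ε (cgIter H ε g i).p)

/-- Orthogonality and conjugacy relations between step `i` and the earlier ones. -/
structure CGOrth (H : Vec n →L[ℝ] Vec n) (ε : ℝ) (g : Vec n) (i : ℕ) : Prop where
  rr : ∀ m < i, inner ℝ (cgIter H ε g i).r (cgIter H ε g m).r = 0
  rp : ∀ m < i, inner ℝ (cgIter H ε g i).r (cgIter H ε g m).p = 0
  pp : ∀ m < i, inner ℝ (cgIter H ε g i).p (damped H ε (cgIter H ε g m).p) = 0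
  rp_self : inner ℝ (cgIter H ε g i).r (cgIter H ε g i).p = -‖(cgIter H ε g i).r‖ ^ 2

lemma cgAlpha_mul {s : CGState n} (h : inner ℝ s.p (damped H ε s.p) ≠ 0) :
    cgAlpha H ε s * inner ℝ s.p (damped H ε s.p) = ‖s.r‖ ^ 2 := by
  rw [cgAlpha, div_mul_cancel₀ _ h, real_inner_self_eq_norm_sq]

lemma cgAlpha_pos {s : CGState n} (h0 : s.r ≠ 0) (h : 0 < inner ℝ s.p (damped H ε s.p)) :
    0 < cgAlpha H ε s := by
  rw [cgAlpha, real_inner_self_eq_norm_sq]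
  have := norm_pos_iff.2 h0
  positivity

/-- All four relations must be carried through one induction. Conjugacy yields orthogonality of
residuals because each residual is a combination of two consecutive directions; orthogonality yields
conjugacy because the damped image of p^m is a multiple of r^{m+1} - r^m. -/
lemma cgOrth_of_regular (hH : ∀ u v, inner ℝ (H u) v = inner ℝ u (H v)) (k : ℕ)
    (hk : CGRegular H ε g k) : ∀ i ≤ k, CGOrth H ε g i := by
  induction k with
  | zero =>
    intro i hi
    obtain rfl : i = 0 := by omega
    refine ⟨by simp, by simp, by simp, ?_⟩
    simp [cgIter, cgInit]
  | succ k ih =>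
    have ih := ih fun i hi => hk i (by omega)
    intro i hi
    rcases Nat.lt_or_ge i (k + 1) with h | h
    · exact ih i (by omega)
    obtain rfl : i = k + 1 := by omega
    obtain ⟨hr0, hpos⟩ := hk k (by omega)
    have hα := cgAlpha_mul hpos.ne'
    have hk' := ih k le_rfl
    -- With r^m = -p^m + β p^{m-1}, conjugacy kills every pairing except the one with p^k itself.
    have hAr : ∀ m ≤ k, inner ℝ (damped H ε (cgIter H ε g k).p) (cgIter H ε g m).r =
        if m = k then -inner ℝ (cgIter H ε g k).p (damped H ε (cgIter H ε g k).p) else 0 := by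
      intro m hm
      have key : ∀ l < k, inner ℝ (damped H ε (cgIter H ε g k).p) (cgIter H ε g l).p = 0 := by
        intro l hl
        rw [real_inner_comm, inner_damped_comm hH]
        exact hk'.pp l hl
      have keyk : inner ℝ (damped H ε (cgIter H ε g k).p) (cgIter H ε g m).p =
        if m = k then inner ℝ (cgIter H ε g k).p (damped H ε (cgIter H ε g k).p) else 0 := by
        split_ifs with h
        · rw [h, real_inner_comm]
        · exact key m (by omega)
      rcases m with _ | m
      · have : (cgIter H ε g 0).r = -(cgIter H ε g 0).p := by simp [cgIter, cgInit]
        rw [this, inner_neg_right, keyk]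
        split_ifs <;> simp
      · have : (cgIter H ε g (m + 1)).r = -(cgIter H ε g (m + 1)).p +
            (‖(cgIter H ε g (m + 1)).r‖ ^ 2 / ‖(cgIter H ε g m).r‖ ^ 2) • (cgIter H ε g m).p := by
          rw [cgIter_p_succ]; abel
        rw [this, inner_add_right, inner_neg_right, keyk, real_inner_smul_right, key m (by omega)]
        split_ifs <;> simp
    have hrr : ∀ m < k + 1, inner ℝ (cgIter H ε g (k + 1)).r (cgIter H ε g m).r = 0 := by
      intro m hm
      rw [cgIter_r_succ, inner_add_left, real_inner_smul_left, hAr m (by omega)]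
      split_ifs with h
      · subst h
        rw [real_inner_self_eq_norm_sq]; linarith
      · rw [hk'.rr m (by omega)]; simp
    have hrp : ∀ m < k + 1, inner ℝ (cgIter H ε g (k + 1)).r (cgIter H ε g m).p = 0 := by
      intro m hm
      rw [cgIter_r_succ, inner_add_left, real_inner_smul_left,
        real_inner_comm (cgIter H ε g m).p (damped H ε _), inner_damped_comm hH]
      rcases Nat.lt_or_ge m k with h | h
      · rw [hk'.rp m h, hk'.pp m h]; simp
      · obtain rfl : m = k := by omega
        rw [hk'.rp_self]; linarith
    refine ⟨hrr, hrp, ?_, ?_⟩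
    · intro m hm
      obtain ⟨hrm, hpm⟩ := hk m hm
      have hαm := cgAlpha_pos hrm hpm
      have hA : damped H ε (cgIter H ε g m).p = (cgAlpha H ε (cgIter H ε g m))⁻¹ •
          ((cgIter H ε g (m + 1)).r - (cgIter H ε g m).r) := by
        rw [cgIter_r_succ, add_sub_cancel_left, smul_smul, inv_mul_cancel₀ hαm.ne', one_smul]
      have h1 : inner ℝ (cgIter H ε g (k + 1)).r (damped H ε (cgIter H ε g m).p) =
          (cgAlpha H ε (cgIter H ε g m))⁻¹ *
            inner ℝ (cgIter H ε g (k + 1)).r (cgIter H ε g (m + 1)).r := by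
        rw [hA, real_inner_smul_right, inner_sub_right, hrr m hm, sub_zero]
      rw [cgIter_p_succ, inner_add_left, inner_neg_left, real_inner_smul_left, h1]
      rcases Nat.lt_or_ge m k with h | h
      · rw [hrr (m + 1) (by omega), hk'.pp m h]; simp
      · obtain rfl : m = k := by omega
        rw [real_inner_self_eq_norm_sq]
        have hr := norm_pos_iff.2 hr0
        have : inner ℝ (cgIter H ε g m).p (damped H ε (cgIter H ε g m).p) =
            ‖(cgIter H ε g m).r‖ ^ 2 * (cgAlpha H ε (cgIter H ε g m))⁻¹ := by
          rw [← hα]; field_simp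
        rw [this]; field_simp; ring
    · rw [cgIter_p_succ, inner_add_right, inner_neg_right, real_inner_smul_right,
        hrp k (by omega), real_inner_self_eq_norm_sq]
      simp

lemma CGOrth.r_y {i : ℕ} (h : CGOrth H ε g i) (m : ℕ) (hm : m ≤ i) :
    inner ℝ (cgIter H ε g i).r (cgIter H ε g m).y = 0 := by
  induction m with
  | zero => simp [cgIter, cgInit]
  | succ m ih =>
    rw [cgIter_y_succ, inner_add_right, real_inner_smul_right, ih (by omega), h.rp m (by omega)]
    simp

/-- Nonzero pairwise orthogonal residuals are linearly independent. -/
lemma CGRegular.le_dim (hH : ∀ u v, inner ℝ (H u) v = inner ℝ u (H v)) {k : ℕ}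
    (hk : CGRegular H ε g k) : k ≤ n := by
  have hO := cgOrth_of_regular hH k hk
  have hli : LinearIndependent ℝ (fun i : Fin k => (cgIter H ε g i).r) := by
    apply linearIndependent_of_ne_zero_of_inner_eq_zero
    · exact fun i => (hk i i.2).1
    · intro i j hij
      rcases lt_or_gt_of_ne hij with h | h
      · rw [real_inner_comm]
        exact (hO j j.2.le).rr i h
      · exact (hO i i.2.le).rr j h
  simpa using hli.fintype_card_le_finrank

/-! ### The estimate `U` of the norm of the Hessian -/

lemma le_raiseU (U : ℝ) (v : Vec n) : U ≤ raiseU H U v := by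
  unfold raiseU
  split_ifs with h
  · rcases (norm_nonneg v).eq_or_lt with h0 | h0
    · rw [norm_eq_zero.1 h0.symm] at h; simp at h
    · rw [le_div_iff₀ h0]; exact h.le
  · exact le_rfl

lemma norm_le_raiseU (U : ℝ) (v : Vec n) : ‖H v‖ ≤ raiseU H U v * ‖v‖ := by
  unfold raiseU
  split_ifs with h
  · rcases (norm_nonneg v).eq_or_lt with h0 | h0
    · rw [norm_eq_zero.1 h0.symm] at h; simp at h
    · rw [div_mul_cancel₀ _ h0.ne']
  · exact not_lt.1 h

lemma raiseU_le {U B : ℝ} (hU : U ≤ B) (hB : ‖H‖ ≤ B) (v : Vec n) : raiseU H U v ≤ B := by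
  unfold raiseU
  split_ifs
  · exact (H.ratio_le_opNorm v).trans hB
  · exact hU

lemma cgIter_U_le {B : ℝ} (hB : ‖H‖ ≤ B) (j : ℕ) : (cgIter H ε g j).U ≤ B := by
  induction j with
  | zero => exact raiseU_le ((norm_nonneg H).trans hB) hB _
  | succ j ih => exact raiseU_le (raiseU_le (raiseU_le ih hB _) hB _) hB _

lemma cgIter_U_mono : Monotone fun j => (cgIter H ε g j).U :=
  monotone_nat_of_le_succ fun _ =>
    (le_raiseU _ _).trans ((le_raiseU _ _).trans (le_raiseU _ _))

lemma cgIter_U_nonneg (j : ℕ) : 0 ≤ (cgIter H ε g j).U :=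
  (le_raiseU 0 (-g)).trans (cgIter_U_mono (Nat.zero_le j))

lemma norm_mul_le_of_le {U U' : ℝ} {v : Vec n} (h : ‖H v‖ ≤ U * ‖v‖) (hU : U ≤ U') :
    ‖H v‖ ≤ U' * ‖v‖ :=
  h.trans (mul_le_mul_of_nonneg_right hU (norm_nonneg v))

lemma norm_y_le_cgIter_U (j : ℕ) :
    ‖H (cgIter H ε g j).y‖ ≤ (cgIter H ε g j).U * ‖(cgIter H ε g j).y‖ := by
  cases j with
  | zero => simp [cgIter, cgInit]
  | succ j => exact norm_mul_le_of_le (norm_le_raiseU _ _) (le_raiseU _ _)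

lemma norm_r_le_cgIter_U {i j : ℕ} (hij : i ≤ j) :
    ‖H (cgIter H ε g i).r‖ ≤ (cgIter H ε g j).U * ‖(cgIter H ε g i).r‖ := by
  refine norm_mul_le_of_le ?_ (cgIter_U_mono hij)
  cases i with
  | zero => simpa [cgIter, cgInit] using norm_le_raiseU (H := H) 0 (-g)
  | succ i => exact norm_le_raiseU _ _

/-- By conjugacy, rᵀH̄r = pᵀH̄p + β² p'ᵀH̄p' with p' the previous direction, so a bound on H r
suffices. The running estimate U appears instead of ‖H‖, as it must: the thresholds of the method
are computed from U. -/
lemma inner_p_damped_le (hH : ∀ u v, inner ℝ (H u) v = inner ℝ u (H v)) (hε : 0 ≤ ε) {k i j : ℕ}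
    (hk : CGRegular H ε g k) (hi : i ≤ k) (hij : i ≤ j) :
    inner ℝ (cgIter H ε g i).p (damped H ε (cgIter H ε g i).p) ≤
      ((cgIter H ε g j).U + 2 * ε) * ‖(cgIter H ε g i).r‖ ^ 2 := by
  have hrr : inner ℝ (cgIter H ε g i).r (damped H ε (cgIter H ε g i).r) ≤
      ((cgIter H ε g j).U + 2 * ε) * ‖(cgIter H ε g i).r‖ ^ 2 := by
    refine (real_inner_le_norm _ _).trans ?_
    have := mul_le_mul_of_nonneg_left
      (norm_damped_le hε (norm_r_le_cgIter_U (H := H) (g := g) (ε := ε) hij))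
      (norm_nonneg (cgIter H ε g i).r)
    linarith
  refine le_trans ?_ hrr
  cases i with
  | zero => simp [cgIter, cgInit, damped_neg]
  | succ i =>
    have hO := (cgOrth_of_regular hH k hk (i + 1) hi).pp i (by omega)
    have hpos := (hk i (by omega)).2
    set β := ‖(cgIter H ε g (i + 1)).r‖ ^ 2 / ‖(cgIter H ε g i).r‖ ^ 2 with hβ
    have hr : (cgIter H ε g (i + 1)).r = -(cgIter H ε g (i + 1)).p + β • (cgIter H ε g i).p := by
      rw [cgIter_p_succ]; abel
    rw [hr]
    simp only [damped_add, damped_neg, damped_smul, inner_add_left, inner_add_right,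
      inner_neg_left, inner_neg_right, real_inner_smul_left, real_inner_smul_right, hO]
    rw [inner_damped_comm hH (cgIter H ε g i).p, hO]
    nlinarith [mul_nonneg (mul_self_nonneg β) hpos.le]

end

section

variable {n : ℕ} {H : Vec n →L[ℝ] Vec n} {ε ζ : ℝ} {g : Vec n}

/-! ### Slow convergence of CG reveals negative curvature -/

/-- The quadratic model minimized by CG. -/
noncomputable def cgModel (H : Vec n →L[ℝ] Vec n) (ε : ℝ) (g y : Vec n) : ℝ :=
  inner ℝ y (damped H ε y) / 2 + inner ℝ g y

lemma cgModel_eq (hH : ∀ u v, inner ℝ (H u) v = inner ℝ u (H v)) (y w : Vec n) :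
    cgModel H ε g w = cgModel H ε g y + inner ℝ (damped H ε y + g) (w - y) +
      inner ℝ (w - y) (damped H ε (w - y)) / 2 := by
  simp only [cgModel, damped_sub, inner_sub_left, inner_sub_right, inner_add_left]
  rw [inner_damped_comm hH w y, real_inner_comm w (damped H ε y), real_inner_comm y (damped H ε y),
    inner_damped_comm hH w y]
  ring

/-- The centers of the estimate sequence for CG. -/
noncomputable def cgCenter (H : Vec n →L[ℝ] Vec n) (ε : ℝ) (g : Vec n) (τ : ℝ) : ℕ → Vec n
  | 0 => 0
  | i + 1 => τ • cgCenter H ε g τ i +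
      (1 - τ) • ((cgIter H ε g i).y - ε⁻¹ • (cgIter H ε g i).r)

/-- The center is built from earlier y's and r's, all orthogonal to r^i. This orthogonality replaces
the coupling step of accelerated gradient methods. -/
lemma CGOrth.r_center {i : ℕ} (h : CGOrth H ε g i) (τ : ℝ) (m : ℕ) (hm : m ≤ i) :
    inner ℝ (cgIter H ε g i).r (cgCenter H ε g τ m) = 0 := by
  induction m with
  | zero => simp [cgCenter]
  | succ m ih =>
    rw [cgCenter, inner_add_right, real_inner_smul_right, real_inner_smul_right, inner_sub_right,
      real_inner_smul_right, ih (by omega), h.r_y m (by omega), h.rr m (by omega)]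
    simp

/-- The exact line search gains α‖r‖²/2, and α ≥ 1/(U + 2ε) by `inner_p_damped_le`. -/
lemma cgModel_succ_le (hH : ∀ u v, inner ℝ (H u) v = inner ℝ u (H v)) (hε : 0 < ε) {k i j : ℕ}
    (hk : CGRegular H ε g k) (hi : i < k) (hij : i ≤ j) :
    cgModel H ε g (cgIter H ε g (i + 1)).y ≤ cgModel H ε g (cgIter H ε g i).y -
      ‖(cgIter H ε g i).r‖ ^ 2 / (2 * ((cgIter H ε g j).U + 2 * ε)) := by
  obtain ⟨hr, hp⟩ := hk i hi
  have hα := cgAlpha_pos hr hp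
  have hαa := cgAlpha_mul hp.ne'
  have hO := cgOrth_of_regular hH k hk i hi.le
  have hU := cgIter_U_nonneg (H := H) (ε := ε) (g := g) j
  have hle := inner_p_damped_le hH hε.le hk hi.le hij
  rw [cgModel_eq hH (cgIter H ε g i).y, ← cgIter_residual, cgIter_y_succ, add_sub_cancel_left,
    real_inner_smul_right, hO.rp_self, damped_smul, real_inner_smul_left, real_inner_smul_right,
    hαa]
  have : ‖(cgIter H ε g i).r‖ ^ 2 / (2 * ((cgIter H ε g j).U + 2 * ε)) ≤
      cgAlpha H ε (cgIter H ε g i) * ‖(cgIter H ε g i).r‖ ^ 2 / 2 := by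
    rw [div_le_iff₀ (by positivity)]
    have := mul_le_mul_of_nonneg_left hle hα.le
    rw [hαa] at this
    linarith
  linarith

/-- One contraction of the potential Φ(y) - Φ(w) + (ε/2)‖w - c‖². Convexity of the square separates
b from c, the terms in rᵀb combine into the lower model at w, and the leftover (1-τ)²‖r‖²/(2ε) is
paid by the descent ‖r‖²/(2L). Strong convexity is needed only between y and the target w. -/
lemma cg_estimate_step {τ Φi Φs Φw ρ L : ℝ} (hε : 0 < ε) (hτ0 : 0 ≤ τ) (hτ1 : τ ≤ 1)
    {b c r : Vec n} (hL : 0 < L) (hτL : (1 - τ) ^ 2 * L ≤ ε) (hρ : ρ = ‖r‖ ^ 2)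
    (hrc : inner ℝ r c = inner ℝ r b) (hs : Φs ≤ Φi - ρ / (2 * L))
    (hw : Φi + inner ℝ r b + ε / 2 * ‖b‖ ^ 2 ≤ Φw) :
    Φs - Φw + ε / 2 * ‖τ • c + (1 - τ) • (b + ε⁻¹ • r)‖ ^ 2 ≤
      τ * (Φi - Φw + ε / 2 * ‖c‖ ^ 2) := by
  have hexp : ‖τ • c + (1 - τ) • (b + ε⁻¹ • r)‖ ^ 2 =
      τ ^ 2 * ‖c‖ ^ 2 + 2 * τ * (1 - τ) * inner ℝ c b + 2 * τ * (1 - τ) * ε⁻¹ * inner ℝ r b +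
      (1 - τ) ^ 2 * (‖b‖ ^ 2 + 2 * ε⁻¹ * inner ℝ r b + ε⁻¹ ^ 2 * ρ) := by
    rw [← real_inner_self_eq_norm_sq, hρ, ← real_inner_self_eq_norm_sq c,
      ← real_inner_self_eq_norm_sq b, ← real_inner_self_eq_norm_sq r]
    simp only [inner_add_left, inner_add_right, real_inner_smul_left, real_inner_smul_right]
    rw [real_inner_comm r c, real_inner_comm r b, hrc, real_inner_comm c b]
    ring
  have hcb : 2 * inner ℝ c b ≤ ‖c‖ ^ 2 + ‖b‖ ^ 2 := by
    have := real_inner_le_norm c b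
    nlinarith [sq_nonneg (‖c‖ - ‖b‖)]
  have h1 : ‖τ • c + (1 - τ) • (b + ε⁻¹ • r)‖ ^ 2 ≤ τ * ‖c‖ ^ 2 + (1 - τ) * ‖b‖ ^ 2 +
      2 * (1 - τ) * ε⁻¹ * inner ℝ r b + (1 - τ) ^ 2 * ε⁻¹ ^ 2 * ρ := by
    rw [hexp]
    have := mul_le_mul_of_nonneg_left hcb (mul_nonneg hτ0 (sub_nonneg.2 hτ1))
    linarith
  have h2 : ε / 2 * ‖τ • c + (1 - τ) • (b + ε⁻¹ • r)‖ ^ 2 ≤ τ * (ε / 2) * ‖c‖ ^ 2 +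
      (1 - τ) * (ε / 2 * ‖b‖ ^ 2 + inner ℝ r b) + (1 - τ) ^ 2 * ε⁻¹ * ρ / 2 := by
    calc _ ≤ ε / 2 * _ := mul_le_mul_of_nonneg_left h1 (by positivity)
      _ = _ := by field_simp; ring
  have h3 : (1 - τ) * (ε / 2 * ‖b‖ ^ 2 + inner ℝ r b) ≤ (1 - τ) * (Φw - Φi) :=
    mul_le_mul_of_nonneg_left (by linarith) (sub_nonneg.2 hτ1)
  have h4 : (1 - τ) ^ 2 * ε⁻¹ * ρ / 2 ≤ ρ / (2 * L) := by
    rw [le_div_iff₀ (by positivity)]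
    have : (1 - τ) ^ 2 * L * ε⁻¹ ≤ 1 := by
      rw [← div_eq_mul_inv, div_le_one hε]; exact hτL
    have := mul_le_mul_of_nonneg_right this (by rw [hρ]; positivity : 0 ≤ ρ)
    linarith
  linarith

lemma cgKappa_ge_two (hε : 0 < ε) {U : ℝ} (hU : 0 ≤ U) : 2 ≤ cgKappa ε U := by
  rw [cgKappa, le_div_iff₀ hε]; linarith

lemma one_sub_cgTau {U : ℝ} : 1 - cgTau ε U = 1 / (√(cgKappa ε U) + 1) := by
  have : 0 < √(cgKappa ε U) + 1 := by positivity
  rw [cgTau]; field_simp; ring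

lemma cgTau_pos (hε : 0 < ε) {U : ℝ} (hU : 0 ≤ U) : 0 < cgTau ε U := by
  have := cgKappa_ge_two hε hU
  have : 0 < √(cgKappa ε U) := Real.sqrt_pos.2 (by linarith)
  rw [cgTau]; positivity

lemma cgTau_lt_one {U : ℝ} : cgTau ε U < 1 := by
  have h := one_sub_cgTau (ε := ε) (U := U)
  have : 0 < 1 / (√(cgKappa ε U) + 1) := by positivity
  linarith

/-- The estimate sequence yields decay with the factor 2κ, so the cap tested by the method leaves
room to spare. -/
lemma two_mul_cgKappa_le_cgCap (hε : 0 < ε) {U : ℝ} (hU : 0 ≤ U) :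
    2 * cgKappa ε U ≤ cgCap ε U := by
  have hκ := cgKappa_ge_two hε hU
  have h1 : √(cgTau ε U) < 1 := by
    rw [Real.sqrt_lt' one_pos]; simpa using cgTau_lt_one
  have h0 := Real.sqrt_nonneg (cgTau ε U)
  rw [cgCap, le_div_iff₀ (by have := sub_pos.2 h1; positivity)]
  have h2 : (1 - √(cgTau ε U)) ^ 2 ≤ 1 := by nlinarith
  have h3 : cgKappa ε U ^ 4 ≥ cgKappa ε U * 8 := by
    have : (2 : ℝ) ^ 3 ≤ cgKappa ε U ^ 3 := pow_le_pow_left₀ (by norm_num) hκ 3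
    nlinarith
  nlinarith

/-- If CG is slow, one of the differences `y^{j+1} - y^i` has curvature below `ε`. -/
lemma exists_negCurv_of_cgSlow (hH : ∀ u v, inner ℝ (H u) v = inner ℝ u (H v)) (hε : 0 < ε)
    {j : ℕ} (hk : CGRegular H ε g (j + 1)) (hp : ¬ NegCurv H ε (cgIter H ε g j).p)
    (hslow : CGSlow H ε g j) :
    ∃ i < j, NegCurv H ε ((cgIter H ε g (j + 1)).y - (cgIter H ε g i).y) := by
  -- If no candidate works, the model has curvature at least ε from each earlier iterate towards w =
  -- y^{j+1}. That suffices to run the estimate sequence with target w, even though w need not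
  -- minimize the model.
  by_contra! hcon
  set U := (cgIter H ε g j).U with hUdef
  have hU : 0 ≤ U := cgIter_U_nonneg j
  set w := (cgIter H ε g (j + 1)).y with hw
  set L := U + 2 * ε with hLdef
  have hL : 0 < L := by positivity
  set τ := cgTau ε U with hτ
  have hτ0 : 0 < τ := cgTau_pos hε hU
  have hτ1 : τ < 1 := cgTau_lt_one
  have hκ := cgKappa_ge_two hε hU
  have hκL : cgKappa ε U * ε = L := by rw [cgKappa, div_mul_cancel₀ _ hε.ne']
  have hτL : (1 - τ) ^ 2 * L ≤ ε := by
    rw [one_sub_cgTau (ε := ε), ← hκL, div_pow, one_pow, ← mul_assoc]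
    have h1 : cgKappa ε U ≤ (√(cgKappa ε U) + 1) ^ 2 := by
      nlinarith [Real.sq_sqrt (by linarith : 0 ≤ cgKappa ε U), Real.sqrt_nonneg (cgKappa ε U)]
    have : 1 / (√(cgKappa ε U) + 1) ^ 2 * cgKappa ε U ≤ 1 := by
      rw [div_mul_eq_mul_div, one_mul, div_le_one (by positivity)]; exact h1
    nlinarith
  have hcurv : ∀ i ≤ j, ε * ‖w - (cgIter H ε g i).y‖ ^ 2 ≤
      inner ℝ (w - (cgIter H ε g i).y) (damped H ε (w - (cgIter H ε g i).y)) := by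
    intro i hi
    rcases hi.lt_or_eq with h | rfl
    · exact not_lt.1 (hcon i h)
    -- The index j is not a candidate, but y^{j+1} - y^j is a multiple of p^j, which passed its own
    -- test.
    · rw [hw, cgIter_y_succ, add_sub_cancel_left, damped_smul, norm_smul, mul_pow,
        real_inner_smul_left, real_inner_smul_right, Real.norm_eq_abs, sq_abs]
      have := mul_le_mul_of_nonneg_left (not_lt.1 hp) (sq_nonneg (cgAlpha H ε (cgIter H ε g i)))
      linarith
  have hlow : ∀ i ≤ j, cgModel H ε g (cgIter H ε g i).y +
      inner ℝ (cgIter H ε g i).r (w - (cgIter H ε g i).y) +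
      ε / 2 * ‖w - (cgIter H ε g i).y‖ ^ 2 ≤ cgModel H ε g w := by
    intro i hi
    rw [cgModel_eq hH (cgIter H ε g i).y w, ← cgIter_residual]
    linarith [hcurv i hi]
  have hE : ∀ i ≤ j, cgModel H ε g (cgIter H ε g i).y - cgModel H ε g w +
      ε / 2 * ‖w - cgCenter H ε g τ i‖ ^ 2 ≤ τ ^ i * (ε / 2 * ‖w‖ ^ 2 - cgModel H ε g w) := by
    intro i
    induction i with
    | zero => simp [cgCenter, cgIter, cgInit, cgModel]; linarith
    | succ i ih =>
      intro hi
      have hO := cgOrth_of_regular hH _ hk i (by omega)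
      have hstep := cg_estimate_step (b := w - (cgIter H ε g i).y) (c := w - cgCenter H ε g τ i)
        (r := (cgIter H ε g i).r) hε hτ0.le hτ1.le hL hτL rfl
        (by rw [inner_sub_right, inner_sub_right, hO.r_center τ i le_rfl, hO.r_y i le_rfl])
        (cgModel_succ_le hH hε hk (by omega : i < j + 1) (by omega : i ≤ j)) (hlow i (by omega))
      have hc : w - cgCenter H ε g τ (i + 1) = τ • (w - cgCenter H ε g τ i) +
          (1 - τ) • (w - (cgIter H ε g i).y + ε⁻¹ • (cgIter H ε g i).r) := by
        rw [cgCenter]; module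
      rw [hc]
      refine hstep.trans ?_
      rw [pow_succ' τ i, mul_assoc]
      exact mul_le_mul_of_nonneg_left (ih (by omega)) hτ0.le
  -- Orthogonality of r^{j+1} and y^{j+1} = w gives wᵀH̄w = -gᵀw, hence the model value at w is
  -- gᵀw/2.
  have hgw : ε * ‖w‖ ^ 2 ≤ -inner ℝ g w ∧ ε / 2 * ‖w‖ ^ 2 - cgModel H ε g w ≤ -inner ℝ g w := by
    have h0 := hcurv 0 (Nat.zero_le _)
    have hO := cgOrth_of_regular hH _ hk (j + 1) le_rfl
    have hr := hO.r_y (j + 1) le_rfl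
    rw [cgIter_residual, inner_add_left, real_inner_comm] at hr
    simp only [cgIter, cgInit, sub_zero] at h0
    constructor
    · linarith
    · rw [cgModel]; linarith
  have hgw2 : -inner ℝ g w ≤ ‖g‖ ^ 2 / ε := by
    have h1 : -inner ℝ g w ≤ ‖g‖ * ‖w‖ := by
      have := abs_le.1 (abs_real_inner_le_norm g w); linarith
    have h2 : ε * ‖w‖ ≤ ‖g‖ := by
      rcases (norm_nonneg w).eq_or_lt with h | h
      · rw [← h]; simp
      · nlinarith
    rw [le_div_iff₀ hε]
    nlinarith [norm_nonneg g]
  -- The last descent, from y^j to w, turns the gap in the model into ‖r^j‖²/(2L), and 2L/ε = 2κ.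
  have hfin : ‖(cgIter H ε g j).r‖ ^ 2 ≤ 2 * cgKappa ε U * τ ^ j * ‖g‖ ^ 2 := by
    have h1 := cgModel_succ_le hH hε hk (by omega : j < j + 1) le_rfl
    have h2 := hE j le_rfl
    have h3 : τ ^ j * (ε / 2 * ‖w‖ ^ 2 - cgModel H ε g w) ≤ τ ^ j * (‖g‖ ^ 2 / ε) :=
      mul_le_mul_of_nonneg_left (hgw.2.trans hgw2) (by positivity)
    have h4 : 0 ≤ ε / 2 * ‖w - cgCenter H ε g τ j‖ ^ 2 := by positivity
    have h5 : ‖(cgIter H ε g j).r‖ ^ 2 / (2 * L) ≤ τ ^ j * (‖g‖ ^ 2 / ε) := by linarith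
    rw [div_le_iff₀ (by positivity)] at h5
    calc _ ≤ _ := h5
      _ = _ := by rw [← hκL]; field_simp
  have hsq : cgCap ε U * τ ^ j * ‖g‖ ^ 2 < ‖(cgIter H ε g j).r‖ ^ 2 := by
    have hM : 0 ≤ cgCap ε U := by linarith [two_mul_cgKappa_le_cgCap hε hU]
    have h1 : (√(cgCap ε U) * τ ^ ((j : ℝ) / 2) * ‖g‖) ^ 2 = cgCap ε U * τ ^ j * ‖g‖ ^ 2 := by
      rw [mul_pow, mul_pow, Real.sq_sqrt hM, ← Real.rpow_natCast (τ ^ ((j : ℝ) / 2)) 2,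
        ← Real.rpow_mul hτ0.le, ← Real.rpow_natCast τ j]
      norm_num
    rw [← h1]
    exact pow_lt_pow_left₀ hslow (by positivity) two_ne_zero
  have := mul_le_mul_of_nonneg_right (two_mul_cgKappa_le_cgCap hε hU)
    (by positivity : 0 ≤ τ ^ j * ‖g‖ ^ 2)
  linarith

end

section

variable {n : ℕ} {H : Vec n →L[ℝ] Vec n} {ε ζ : ℝ} {g : Vec n}

/-! ### The output of the capped CG method -/

/-- A nonzero residual makes p^k nonzero, since their inner product is -‖r^k‖²; the passed curvature
test then gives strict positivity. -/
lemma CGRegular.succ (hH : ∀ u v, inner ℝ (H u) v = inner ℝ u (H v)) (hε : 0 < ε) {k : ℕ}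
    (hk : CGRegular H ε g k) (hr : (cgIter H ε g k).r ≠ 0)
    (hp : ¬ NegCurv H ε (cgIter H ε g k).p) : CGRegular H ε g (k + 1) := by
  intro i hi
  rcases Nat.lt_or_ge i k with h | h
  · exact hk i h
  obtain rfl : i = k := by omega
  refine ⟨hr, lt_of_lt_of_le ?_ (not_lt.1 hp)⟩
  have hp0 : (cgIter H ε g i).p ≠ 0 := by
    intro h0
    have := (cgOrth_of_regular hH i hk i le_rfl).rp_self
    rw [h0, inner_zero_right] at this
    have := norm_pos_iff.2 hr
    nlinarith
  have := norm_pos_iff.2 hp0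
  positivity

lemma cgZetaHat_pos (hε : 0 < ε) (hζ : 0 < ζ) {U : ℝ} (hU : 0 ≤ U) : 0 < cgZetaHat ζ ε U := by
  have := cgKappa_ge_two hε hU
  rw [cgZetaHat]; positivity

lemma residual_ne_zero_of_not_cgSolved (hε : 0 < ε) (hζ : 0 < ζ) {j : ℕ}
    (h : ¬ CGSolved H ε ζ g j) : (cgIter H ε g j).r ≠ 0 := by
  intro h0
  apply h
  rw [CGSolved, h0, norm_zero]
  exact mul_nonneg (cgZetaHat_pos hε hζ (cgIter_U_nonneg j)).le (norm_nonneg _)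

lemma CGReaches.regular (hH : ∀ u v, inner ℝ (H u) v = inner ℝ u (H v)) (hε : 0 < ε) (hζ : 0 < ζ)
    (hg : g ≠ 0) {j : ℕ} (h : CGReaches H ε ζ g j) : CGRegular H ε g j := by
  obtain ⟨-, h0, hc⟩ := h
  induction j with
  | zero => intro i hi; omega
  | succ j ih =>
    refine (ih fun i h1 h2 => hc i h1 (by omega)).succ hH hε ?_ ?_
    · rcases j.eq_zero_or_pos with rfl | hj
      · simpa [cgIter, cgInit] using hg
      · exact residual_ne_zero_of_not_cgSolved hε hζ (hc j hj (by omega)).2.1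
    · rcases j.eq_zero_or_pos with rfl | hj
      · exact h0
      · exact (hc j hj (by omega)).2.2.1

lemma CGReaches.le_dim (hH : ∀ u v, inner ℝ (H u) v = inner ℝ u (H v)) (hε : 0 < ε) (hζ : 0 < ζ)
    (hg : g ≠ 0) {j : ℕ} (h : CGReaches H ε ζ g j) : j ≤ n :=
  (h.regular hH hε hζ hg).le_dim hH

/-- The capped CG method always returns a direction. -/
lemma exists_cappedCG (hH : ∀ u v, inner ℝ (H u) v = inner ℝ u (H v)) (hε : 0 < ε) (hζ : 0 < ζ)
    (hg : g ≠ 0) : ∃ ty d m, CappedCG H ε ζ g ty d m := by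
  by_cases h0 : NegCurv H ε (-g)
  · exact ⟨_, _, _, .nc_init h0⟩
  have hex : ∃ j, CGReaches H ε ζ g j ∧ ¬ CGContinues H ε ζ g j := by
    by_contra! hcon
    have hall : ∀ j, ∀ i, 1 ≤ i → i < j → CGContinues H ε ζ g i := by
      intro j
      induction j with
      | zero => intro i _ h; omega
      | succ j ih =>
        intro i hi hij
        rcases Nat.lt_or_ge i j with h | h
        · exact ih i hi h
        · obtain rfl : i = j := by omega
          exact hcon i ⟨hi, h0, ih⟩
    have := CGReaches.le_dim hH hε hζ hg (j := n + 1) ⟨by omega, h0, hall _⟩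
    omega
  obtain ⟨j, hj, hend⟩ := hex
  by_cases hy : NegCurv H ε (cgIter H ε g j).y
  · exact ⟨_, _, _, .nc_y j hj hy⟩
  by_cases hs : CGSolved H ε ζ g j
  · exact ⟨_, _, _, .sol j hj hy hs⟩
  by_cases hp : NegCurv H ε (cgIter H ε g j).p
  · exact ⟨_, _, _, .nc_p j hj hy hs hp⟩
  by_cases hslow : CGSlow H ε g j
  · obtain ⟨i, hi, hc⟩ := exists_negCurv_of_cgSlow hH hε
      ((hj.regular hH hε hζ hg).succ hH hε (residual_ne_zero_of_not_cgSolved hε hζ hs) hp) hp hslow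
    exact ⟨_, _, _, .nc_slow j i hj hy hs hp hslow hi hc⟩
  · exact absurd ⟨hy, hs, hp, hslow⟩ hend

/-- Directions of type NC have negative curvature. -/
lemma CappedCG.nc_spec {d : Vec n} {m : ℕ} (h : CappedCG H ε ζ g DirType.nc d m) :
    inner ℝ d (H d) < -(ε * ‖d‖ ^ 2) ∧ d ≠ 0 := by
  have hd : NegCurv H ε d := by
    cases h <;> assumption
  rw [NegCurv, inner_damped_self] at hd
  refine ⟨by linarith, ?_⟩
  rintro rfl
  simp at hd

/-- Directions of type SOL are approximate Newton directions. -/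
structure IsNewtonDir (H : Vec n →L[ℝ] Vec n) (ε : ℝ) (g d : Vec n) : Prop where
  ne_zero : d ≠ 0
  curv : -(ε * ‖d‖ ^ 2) ≤ inner ℝ d (H d)
  slope : inner ℝ g d = -(inner ℝ d (H d) + 2 * ε * ‖d‖ ^ 2)
  residual : ‖damped H ε d + g‖ ≤ ε / 2 * ‖d‖

/-- The slope identity is the orthogonality of r^j and y^j. For the residual, ‖g‖ ≤ ζ̂‖g‖ + κε‖y‖
with ζ̂ ≤ 1/6 gives ‖g‖ ≤ (6/5)κε‖y‖, and 3κζ̂ = ζ then bounds the residual by (2/5)ζε‖y‖. -/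
lemma CappedCG.sol_spec (hH : ∀ u v, inner ℝ (H u) v = inner ℝ u (H v)) (hε : 0 < ε)
    (hζ : 0 < ζ) (hζ1 : ζ < 1) (hg : g ≠ 0) {d : Vec n} {m : ℕ}
    (h : CappedCG H ε ζ g DirType.sol d m) : IsNewtonDir H ε g d := by
  cases h with
  | sol j hj hy hs =>
    have hU := cgIter_U_nonneg (H := H) (ε := ε) (g := g) j
    have hreg := hj.regular hH hε hζ hg
    have hO := cgOrth_of_regular hH j hreg j le_rfl
    have hr := hO.r_y j le_rfl
    have hHy := norm_damped_le hε.le (norm_y_le_cgIter_U (H := H) (ε := ε) (g := g) j)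
    rw [CGSolved, cgIter_residual] at hs
    rw [cgIter_residual] at hr
    set y := (cgIter H ε g j).y
    set U := (cgIter H ε g j).U
    have hκ := cgKappa_ge_two hε hU
    have hκL : cgKappa ε U * ε = U + 2 * ε := by rw [cgKappa, div_mul_cancel₀ _ hε.ne']
    have hζκ : cgZetaHat ζ ε U * (3 * cgKappa ε U) = ζ := by
      rw [cgZetaHat, div_mul_cancel₀ _ (by positivity)]
    have hζ0 := cgZetaHat_pos hε hζ hU
    rw [← hκL] at hHy
    set κ := cgKappa ε U
    set z := cgZetaHat ζ ε U
    have hz6 : z ≤ 1 / 6 := by nlinarith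
    have hgn : ‖g‖ ≤ z * ‖g‖ + κ * ε * ‖y‖ := by
      calc ‖g‖ = ‖(damped H ε y + g) - damped H ε y‖ := by rw [add_sub_cancel_left]
        _ ≤ _ := (norm_sub_le _ _).trans (add_le_add hs hHy)
    have hg0 := norm_pos_iff.2 hg
    have hg2 : 5 / 6 * ‖g‖ ≤ κ * ε * ‖y‖ := by nlinarith
    refine ⟨?_, ?_, ?_, hs.trans ?_⟩
    · intro h0
      rw [h0, norm_zero, mul_zero] at hg2
      linarith
    · have := not_lt.1 hy
      rw [inner_damped_self] at this
      linarith
    · rw [inner_add_left, real_inner_comm, inner_damped_self] at hr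
      linarith
    · have h1 : z * ‖g‖ ≤ z * (6 / 5 * (κ * ε * ‖y‖)) :=
        mul_le_mul_of_nonneg_left (by linarith) hζ0.le
      have h2 : z * (6 / 5 * (κ * ε * ‖y‖)) = 2 / 5 * ζ * (ε * ‖y‖) := by
        rw [← hζκ]; ring
      have h3 : 0 ≤ ε * ‖y‖ := by positivity
      nlinarith

lemma CappedCG.count_le {ty : DirType} {d : Vec n} {m : ℕ} (h : CappedCG H ε ζ g ty d m) :
    ∃ j, m ≤ 1 + 4 * j ∧ (j = 0 ∨ CGReaches H ε ζ g j) := by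
  cases h with
  | nc_init _ => exact ⟨0, by omega, .inl rfl⟩
  | nc_y j hj _ => exact ⟨j, by omega, .inr hj⟩
  | sol j hj _ _ => exact ⟨j, by omega, .inr hj⟩
  | nc_p j hj _ _ _ => exact ⟨j, by omega, .inr hj⟩
  | nc_slow j i hj _ _ _ _ _ _ => exact ⟨j, by omega, .inr hj⟩

lemma CappedCG.count_le_dim (hH : ∀ u v, inner ℝ (H u) v = inner ℝ u (H v)) (hε : 0 < ε)
    (hζ : 0 < ζ) (hg : g ≠ 0) {ty : DirType} {d : Vec n} {m : ℕ}
    (h : CappedCG H ε ζ g ty d m) : m ≤ 1 + 4 * n := by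
  obtain ⟨j, hm, rfl | hj⟩ := h.count_le
  · omega
  · have := hj.le_dim hH hε hζ hg
    omega

/-- The hypothesis holds whenever pass i is neither solved nor slow. It implies ζ/24 < κ⁴τ^{i/2};
take logarithms and use log τ ≤ τ - 1 = -1/(√κ + 1) ≤ -1/(2√κ). -/
lemma cg_pass_bound (hε : 0 < ε) (hζ : 0 < ζ) (hζ1 : ζ < 1) {U : ℝ} (hU : 0 ≤ U) {i : ℕ}
    (h : cgZetaHat ζ ε U < √(cgCap ε U) * cgTau ε U ^ ((i : ℝ) / 2)) :
    (i : ℝ) ≤ 4 * √(cgKappa ε U) * (Real.log (24 / ζ) + 4 * Real.log (cgKappa ε U)) := by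
  have hκ := cgKappa_ge_two hε hU
  have hτ0 := cgTau_pos hε hU
  have hτ1 := cgTau_lt_one (ε := ε) (U := U)
  have hτ := one_sub_cgTau (ε := ε) (U := U)
  set κ := cgKappa ε U with hκdef
  set τ := cgTau ε U with hτdef
  have hs0 : 0 ≤ √κ := Real.sqrt_nonneg κ
  have hs2 : √κ ^ 2 = κ := Real.sq_sqrt (by linarith)
  have hs1 : 1 ≤ √κ := by rw [Real.one_le_sqrt]; linarith
  have ht0 : 0 ≤ √τ := Real.sqrt_nonneg τ
  have ht2 : √τ ^ 2 = τ := Real.sq_sqrt hτ0.le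
  have ht1 : √τ < 1 := by rw [Real.sqrt_lt' one_pos]; simpa using hτ1
  have hcap : √(cgCap ε U) ≤ 8 * κ ^ 3 := by
    apply Real.sqrt_le_iff.2 ⟨by positivity, ?_⟩
    rw [cgCap, ← hκdef, ← hτdef, div_le_iff₀ (by have := sub_pos.2 ht1; positivity)]
    -- From 1 - √τ ≥ (1 - τ)/2 and 1 - τ = 1/(√κ + 1) ≥ 1/(2κ); the cap is therefore at most 64κ⁶.
    have h1 : 1 ≤ (1 - √τ) * (4 * κ) := by
      have h2 : (1 - √τ) * 2 ≥ 1 - τ := by nlinarith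
      have h3 : (1 - τ) * (2 * κ) ≥ 1 := by
        rw [hτ, div_mul_eq_mul_div, one_mul, ge_iff_le, le_div_iff₀ (by positivity)]
        nlinarith
      nlinarith
    have h2 : 1 ≤ ((1 - √τ) * (4 * κ)) ^ 2 := one_le_pow₀ h1
    have h3 : κ ^ 4 * 1 ≤ κ ^ 4 * ((1 - √τ) * (4 * κ)) ^ 2 :=
      mul_le_mul_of_nonneg_left h2 (by positivity)
    nlinarith
  have hτi : 0 < τ ^ ((i : ℝ) / 2) := Real.rpow_pos_of_pos hτ0 _
  have h1 : ζ / 24 < κ ^ 4 * τ ^ ((i : ℝ) / 2) := by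
    have h2 : cgZetaHat ζ ε U < 8 * κ ^ 3 * τ ^ ((i : ℝ) / 2) :=
      h.trans_le (mul_le_mul_of_nonneg_right hcap hτi.le)
    rw [cgZetaHat, ← hκdef, div_lt_iff₀ (by positivity)] at h2
    linarith
  have h2 := Real.log_lt_log (by positivity) h1
  rw [Real.log_mul (by positivity) hτi.ne', Real.log_rpow hτ0, Real.log_pow,
    Real.log_div hζ.ne' (by norm_num)] at h2
  have h3 : Real.log (24 / ζ) = Real.log 24 - Real.log ζ := Real.log_div (by norm_num) hζ.ne'
  have h4 : Real.log τ ≤ -(1 / (√κ + 1)) := by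
    have := Real.log_le_sub_one_of_pos hτ0
    linarith
  have h5 : 1 / (2 * √κ) ≤ 1 / (√κ + 1) := by
    apply one_div_le_one_div_of_le <;> linarith
  have h6 : (i : ℝ) / 2 * (1 / (2 * √κ)) ≤ Real.log (24 / ζ) + 4 * Real.log κ := by
    have hi : (0 : ℝ) ≤ (i : ℝ) / 2 := by positivity
    have := mul_le_mul_of_nonneg_left (h4.trans (neg_le_neg h5)) hi
    push_cast at h2
    linarith
  have h7 : (i : ℝ) / 2 * (1 / (2 * √κ)) * (4 * √κ) = i := by field_simp; norm_num
  calc (i : ℝ) = (i : ℝ) / 2 * (1 / (2 * √κ)) * (4 * √κ) := h7.symm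
    _ ≤ (Real.log (24 / ζ) + 4 * Real.log κ) * (4 * √κ) :=
        mul_le_mul_of_nonneg_right h6 (by positivity)
    _ = _ := by ring

lemma cgKappa_mono (hε : 0 < ε) {U V : ℝ} (h : U ≤ V) : cgKappa ε U ≤ cgKappa ε V := by
  unfold cgKappa; gcongr

lemma CappedCG.count_le_cond (hε : 0 < ε) (hζ : 0 < ζ) (hζ1 : ζ < 1) {B : ℝ}
    (hB : ‖H‖ ≤ B) {ty : DirType} {d : Vec n} {m : ℕ} (h : CappedCG H ε ζ g ty d m) :
    (m : ℝ) ≤ 5 + 16 * √(cgKappa ε B) * (Real.log (24 / ζ) + 4 * Real.log (cgKappa ε B)) := by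
  have hB0 : 0 ≤ B := (norm_nonneg H).trans hB
  have hκ := cgKappa_ge_two hε hB0
  have hlog : 0 ≤ Real.log (24 / ζ) :=
    Real.log_nonneg (by rw [le_div_iff₀ hζ]; linarith)
  have hlogκ : 0 ≤ Real.log (cgKappa ε B) := Real.log_nonneg (by linarith)
  have hbound : ∃ i : ℕ, m ≤ 5 + 4 * i ∧
      (i : ℝ) ≤ 4 * √(cgKappa ε B) * (Real.log (24 / ζ) + 4 * Real.log (cgKappa ε B)) := by
    obtain ⟨j, hm, hj⟩ := h.count_le
    rcases Nat.lt_or_ge j 2 with h2 | h2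
    · exact ⟨0, by omega, by simp only [Nat.cast_zero]; positivity⟩
    rcases hj with rfl | hj
    · omega
    -- Only the pass before the last is known to have failed all tests, whence 1 + 4j = 5 + 4(j -
    -- 1).
    refine ⟨j - 1, by omega, ?_⟩
    obtain ⟨-, hns, -, hnslow⟩ := hj.2.2 (j - 1) (by omega) (by omega)
    have hU := cgIter_U_nonneg (H := H) (ε := ε) (g := g) (j - 1)
    have hUB := cgIter_U_le (ε := ε) (g := g) hB (j - 1)
    have hlt : cgZetaHat ζ ε (cgIter H ε g (j - 1)).U * ‖g‖ <
        √(cgCap ε (cgIter H ε g (j - 1)).U) *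
          cgTau ε (cgIter H ε g (j - 1)).U ^ (((j - 1 : ℕ) : ℝ) / 2) * ‖g‖ :=
      (not_le.1 hns).trans_le (not_lt.1 hnslow)
    refine (cg_pass_bound hε hζ hζ1 hU (lt_of_mul_lt_mul_right hlt (norm_nonneg g))).trans ?_
    have hκU := cgKappa_ge_two hε hU
    have hmono := cgKappa_mono hε hUB
    have h1 := Real.sqrt_le_sqrt hmono
    have h2 := Real.log_le_log (by linarith) hmono
    have h3 : 0 ≤ Real.log (cgKappa ε (cgIter H ε g (j - 1)).U) := Real.log_nonneg (by linarith)
    gcongr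
  obtain ⟨i, hm, hi⟩ := hbound
  have : (m : ℝ) ≤ 5 + 4 * i := by exact_mod_cast hm
  linarith

end

section

variable {n : ℕ} {f : Vec n → ℝ}

/-! ### Calculus along segments -/

lemma contDiff_gradient (hf : ContDiff ℝ 2 f) : ContDiff ℝ 1 (gradient f) := by
  have h : ContDiff ℝ 1 (fderiv ℝ f) := hf.fderiv_right (by norm_num)
  exact (InnerProductSpace.toDual ℝ (Vec n)).symm.toContinuousLinearEquiv.contDiff.comp h

lemma hasFDerivAt_gradient (hf : ContDiff ℝ 2 f) (x : Vec n) :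
    HasFDerivAt (gradient f) (hess f x) x :=
  ((contDiff_gradient hf).differentiable (by norm_num) x).hasFDerivAt

lemma continuous_hess (hf : ContDiff ℝ 2 f) : Continuous (hess f) :=
  (contDiff_gradient hf).continuous_fderiv (by norm_num)

lemma inner_gradient_eq (x v : Vec n) : inner ℝ (gradient f x) v = fderiv ℝ f x v := by
  simp [gradient]

lemma inner_hess_comm (hf : ContDiff ℝ 2 f) (x u v : Vec n) :
    inner ℝ (hess f x u) v = inner ℝ u (hess f x v) := by
  have key : ∀ u v, inner ℝ (hess f x u) v = fderiv ℝ (fderiv ℝ f) x u v := by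
    intro u v
    have h1 : HasFDerivAt (fun y => inner ℝ (gradient f y) v)
        ((innerSL ℝ).flip v ∘L hess f x) x :=
      ((innerSL ℝ).flip v).hasFDerivAt.comp x (hasFDerivAt_gradient hf x)
    have h2 : HasFDerivAt (fun y => fderiv ℝ f y v)
        ((ContinuousLinearMap.apply ℝ ℝ v) ∘L fderiv ℝ (fderiv ℝ f) x) x := by
      have : DifferentiableAt ℝ (fderiv ℝ f) x :=
        (hf.fderiv_right (m := 1) (by norm_num)).differentiable (by norm_num) x
      exact (ContinuousLinearMap.apply ℝ ℝ v).hasFDerivAt.comp x this.hasFDerivAt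
    simp only [inner_gradient_eq] at h1
    exact DFunLike.congr_fun (h1.unique h2) u
  rw [← real_inner_comm u, key, key]
  exact (hf.contDiffAt.isSymmSndFDerivAt (by simp)).eq u v

lemma hasDerivAt_line (x d : Vec n) (s : ℝ) : HasDerivAt (fun s : ℝ => x + s • d) d s := by
  simpa using ((hasDerivAt_id s).smul_const d).const_add x

lemma hasDerivAt_comp_line (hf : ContDiff ℝ 2 f) (x d : Vec n) (s : ℝ) :
    HasDerivAt (fun s : ℝ => f (x + s • d)) (inner ℝ (gradient f (x + s • d)) d) s := by
  rw [inner_gradient_eq]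
  exact ((hf.differentiable (by norm_num) _).hasFDerivAt).comp_hasDerivAt s (hasDerivAt_line x d s)

lemma hasDerivAt_gradient_line (hf : ContDiff ℝ 2 f) (x d : Vec n) (s : ℝ) :
    HasDerivAt (fun s : ℝ => gradient f (x + s • d)) (hess f (x + s • d) d) s :=
  (hasFDerivAt_gradient hf _).comp_hasDerivAt s (hasDerivAt_line x d s)

lemma norm_gradient_line_sub_le (hf : ContDiff ℝ 2 f) {x d : Vec n} {a b : ℝ}
    (hb : ∀ u ∈ Set.Icc 0 a, ‖hess f (x + u • d) - hess f x‖ ≤ b) {s : ℝ} (hs : s ∈ Set.Icc 0 a) :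
    ‖gradient f (x + s • d) - gradient f x - s • hess f x d‖ ≤ b * ‖d‖ * s := by
  have h := norm_image_sub_le_of_norm_deriv_le_segment' (a := 0) (b := a)
    (f := fun s : ℝ => gradient f (x + s • d) - s • hess f x d)
    (f' := fun s => hess f (x + s • d) d - hess f x d) (C := b * ‖d‖)
    (fun s _ => ((hasDerivAt_gradient_line hf x d s).sub
      (by simpa using (hasDerivAt_id s).smul_const (hess f x d))).hasDerivWithinAt)
    (fun u hu => by
      rw [← sub_apply]
      exact (ContinuousLinearMap.le_opNorm _ _).trans
        (mul_le_mul_of_nonneg_right (hb u ⟨hu.1, hu.2.le⟩) (norm_nonneg d))) s hs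
  simp only [zero_smul, add_zero, sub_zero] at h
  rwa [sub_right_comm] at h

lemma slope_line_le (hf : ContDiff ℝ 2 f) {x d : Vec n} {a b : ℝ}
    (hb : ∀ u ∈ Set.Icc 0 a, ‖hess f (x + u • d) - hess f x‖ ≤ b) {s : ℝ} (hs : s ∈ Set.Icc 0 a) :
    inner ℝ (gradient f (x + s • d)) d ≤
      inner ℝ (gradient f x) d + s * (inner ℝ d (hess f x d) + b * ‖d‖ ^ 2) := by
  have h1 := norm_gradient_line_sub_le hf hb hs
  have h2 := real_inner_le_norm (gradient f (x + s • d) - gradient f x - s • hess f x d) d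
  rw [inner_sub_left, inner_sub_left, real_inner_smul_left, real_inner_comm d (hess f x d)] at h2
  have h3 := mul_le_mul_of_nonneg_right h1 (norm_nonneg d)
  rw [real_inner_comm] at h2
  linarith [real_inner_comm (gradient f (x + s • d)) d]

lemma value_line_le (hf : ContDiff ℝ 2 f) {x d : Vec n} {a b : ℝ} (ha : 0 ≤ a)
    (hb : ∀ u ∈ Set.Icc 0 a, ‖hess f (x + u • d) - hess f x‖ ≤ b) :
    f (x + a • d) ≤ f x + a * inner ℝ (gradient f x) d +
      a ^ 2 / 2 * (inner ℝ d (hess f x d) + b * ‖d‖ ^ 2) := by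
  set q := inner ℝ d (hess f x d) + b * ‖d‖ ^ 2 with hq
  have hder : ∀ s : ℝ, HasDerivAt (fun s : ℝ => f (x + s • d) -
      (s * inner ℝ (gradient f x) d + s ^ 2 / 2 * q))
      (inner ℝ (gradient f (x + s • d)) d - (inner ℝ (gradient f x) d + s * q)) s := by
    intro s
    refine (hasDerivAt_comp_line hf x d s).sub ?_
    have h1 := (hasDerivAt_id s).mul_const (inner ℝ (gradient f x) d)
    have h2 := (((hasDerivAt_id s).pow 2).div_const 2).mul_const q
    refine (h1.add h2).congr_deriv ?_
    simp
  have hanti := antitoneOn_of_deriv_nonpos (convex_Icc (0 : ℝ) a)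
    (fun s _ => (hder s).continuousAt.continuousWithinAt)
    (fun s _ => (hder s).differentiableAt.differentiableWithinAt)
    (fun s hs => by
      rw [(hder s).deriv]
      rw [interior_Icc] at hs
      have := slope_line_le hf hb (Set.Ioo_subset_Icc_self hs)
      linarith)
  have := hanti (Set.left_mem_Icc.2 ha) (Set.right_mem_Icc.2 ha) ha
  simp only [zero_smul, add_zero, zero_mul, zero_pow two_ne_zero, zero_div, sub_zero] at this
  linarith

/-- A function that decreases as long as it has stayed below its initial value stays below it. -/
lemma le_initial_of_deriv_neg {φ φ' : ℝ → ℝ} {a : ℝ}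
    (hd : ∀ s, HasDerivAt φ (φ' s) s)
    (hneg : ∀ s, 0 < s → s ≤ a → (∀ u ∈ Set.Icc 0 s, φ u ≤ φ 0) → φ' s < 0)
    (hloc : ∃ δ > 0, ∀ s, 0 < s → s < δ → s ≤ a → φ' s < 0) :
    ∀ s ∈ Set.Icc 0 a, φ s ≤ φ 0 := by
  have hcont : Continuous φ := continuous_iff_continuousAt.2 fun s => (hd s).continuousAt
  have hanti : ∀ b, (∀ s ∈ Set.Ioo 0 b, φ' s < 0) → StrictAntiOn φ (Set.Icc 0 b) := by
    intro b hb
    refine strictAntiOn_of_deriv_neg (convex_Icc 0 b) hcont.continuousOn fun s hs => ?_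
    rw [interior_Icc] at hs
    rw [(hd s).deriv]
    exact hb s hs
  -- Continuous induction on s. At s = 0 there is no strict inequality to propagate, so `hloc`
  -- starts it; at s > 0 the decrease gives φ s < φ 0, which continuity extends beyond s.
  have hsub : Set.Icc 0 a ⊆ {s | ∀ u ∈ Set.Icc 0 s, φ u ≤ φ 0} := by
    apply IsClosed.Icc_subset_of_forall_exists_gt
    -- Writing the condition with `min s u` exhibits it as an intersection of closed sets.
    · have : {s | ∀ u ∈ Set.Icc 0 s, φ u ≤ φ 0} ∩ Set.Icc 0 a =
          (⋂ u : Set.Ici (0 : ℝ), {s | φ (min s u) ≤ φ 0}) ∩ Set.Icc 0 a := by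
        ext s
        simp only [Set.mem_inter_iff, Set.mem_ofPred_eq, Set.mem_iInter, Subtype.forall,
          Set.mem_Ici, and_congr_left_iff]
        intro hs
        constructor
        · intro h u hu
          exact h _ ⟨le_min hs.1 hu, min_le_left _ _⟩
        · intro h u hu
          have := h u hu.1
          rwa [min_eq_right hu.2] at this
      rw [this]
      refine IsClosed.inter (isClosed_iInter fun u => ?_) isClosed_Icc
      exact isClosed_le (hcont.comp (continuous_id.min continuous_const)) continuous_const
    · intro u hu
      rw [le_antisymm hu.2 hu.1]
    · rintro s ⟨hs, hs0, hsa⟩ y hy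
      rcases hs0.eq_or_lt with rfl | hs0
      · obtain ⟨δ, hδ, hl⟩ := hloc
        have hm : 0 < min (min y a) (δ / 2) := by
          have : (0 : ℝ) < y := hy
          positivity
        refine ⟨min (min y a) (δ / 2), ?_, hm, (min_le_left _ _).trans (min_le_left _ _)⟩
        intro u hu
        have := hanti (min (min y a) (δ / 2)) fun v hv =>
          hl v hv.1 (by have := min_le_right (min y a) (δ / 2); linarith [hv.2])
            (hv.2.le.trans ((min_le_left _ _).trans (min_le_right _ _)))
        exact this.antitoneOn (Set.left_mem_Icc.2 hm.le) hu hu.1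
      · have hlt : φ s < φ 0 := by
          refine hanti s (fun v hv => hneg v hv.1 (hv.2.le.trans hsa.le) fun u hu =>
            hs u ⟨hu.1, hu.2.trans hv.2.le⟩) (Set.left_mem_Icc.2 hs0.le)
            (Set.right_mem_Icc.2 hs0.le) hs0
        have hev := (hcont.tendsto s).eventually (gt_mem_nhds hlt)
        obtain ⟨δ, hδ, hball⟩ := Metric.eventually_nhds_iff.1 hev
        have hy' : s < y := hy
        refine ⟨min y (s + δ / 2), ?_, by simp [hy', hδ], min_le_left _ _⟩
        intro u hu
        rcases le_or_gt u s with h | h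
        · exact hs u ⟨hu.1, h⟩
        · refine (hball ?_).le
          have := hu.2.trans (min_le_right _ _)
          rw [Real.dist_eq, abs_lt]
          constructor <;> linarith
  intro s hs
  exact hsub hs s ⟨hs.1, le_rfl⟩

/-- The variation of the Hessian along segments from `x` that stay in the level set of `x`. -/
def HessVar (f : Vec n → ℝ) (x : Vec n) (e σ : ℝ) : Prop :=
  ∀ d : Vec n, (∀ u ∈ Set.Icc (0 : ℝ) 1, f (x + u • d) ≤ f x) →
    ‖hess f (x + d) - hess f x‖ ≤ max (e / 2) (σ * ‖d‖ / 4)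

lemma HessVar.along {x : Vec n} {e σ : ℝ} (h : HessVar f x e σ) {d : Vec n} {s : ℝ} (hs : 0 ≤ s)
    (hle : ∀ u ∈ Set.Icc (0 : ℝ) s, f (x + u • d) ≤ f x) :
    ‖hess f (x + s • d) - hess f x‖ ≤ max (e / 2) (σ * (s * ‖d‖) / 4) := by
  have := h (s • d) fun u hu => by
    rw [smul_smul]
    exact hle _ ⟨mul_nonneg hu.1 hs, mul_le_of_le_one_left hs hu.2⟩
  rwa [norm_smul, Real.norm_of_nonneg hs] at this

lemma HessVar.along_le {x : Vec n} {e σ : ℝ} (h : HessVar f x e σ) (hσ : 0 ≤ σ) {d : Vec n} {a : ℝ}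
    (hle : ∀ u ∈ Set.Icc (0 : ℝ) a, f (x + u • d) ≤ f x) :
    ∀ s ∈ Set.Icc 0 a, ‖hess f (x + s • d) - hess f x‖ ≤ max (e / 2) (σ * (a * ‖d‖) / 4) := by
  intro s hs
  refine (h.along hs.1 fun u hu => hle u ⟨hu.1, hu.2.trans hs.2⟩).trans ?_
  have := hs.2
  gcongr

/-- Along a direction of descent the segment stays in the level set. -/
lemma HessVar.segment_le (hf : ContDiff ℝ 2 f) {x d : Vec n} {e σ a : ℝ} (h : HessVar f x e σ)
    (he : 0 < e) (hσ : 0 ≤ σ)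
    (hdesc : ∀ s, 0 < s → s ≤ a → inner ℝ (gradient f x) d + s * (inner ℝ d (hess f x d) +
      max (e / 2) (σ * (s * ‖d‖) / 4) * ‖d‖ ^ 2) < 0) :
    ∀ s ∈ Set.Icc 0 a, f (x + s • d) ≤ f x := by
  have key := le_initial_of_deriv_neg (φ := fun s : ℝ => f (x + s • d))
    (a := a) (hasDerivAt_comp_line hf x d) ?_ ?_
  · simpa using key
  · intro s hs hsa hle
    simp only [zero_smul, add_zero] at hle
    exact (slope_line_le hf (h.along_le hσ hle) (Set.right_mem_Icc.2 hs.le)).trans_lt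
      (hdesc s hs hsa)
  -- Near 0 the segment is not yet known to stay in the level set, so `HessVar` is unavailable;
  -- continuity of the Hessian supplies the bound e/2.
  · have hc : Continuous fun s : ℝ => hess f (x + s • d) :=
      (continuous_hess hf).comp (by fun_prop)
    obtain ⟨δ, hδ, hball⟩ := Metric.continuousAt_iff.1 (hc.continuousAt (x := 0)) (e / 2)
      (by linarith)
    refine ⟨δ, hδ, fun s hs hsδ hsa => ?_⟩
    have hb : ∀ u ∈ Set.Icc 0 s, ‖hess f (x + u • d) - hess f x‖ ≤ e / 2 := by
      intro u hu
      have := hball (x := u) (by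
        rw [Real.dist_eq, sub_zero, abs_of_nonneg hu.1]; exact hu.2.trans_lt hsδ)
      rw [dist_eq_norm] at this
      simpa using this.le
    refine (slope_line_le hf hb (Set.right_mem_Icc.2 hs.le)).trans_lt
      (lt_of_le_of_lt ?_ (hdesc s hs hsa))
    have := le_max_left (e / 2) (σ * (s * ‖d‖) / 4)
    gcongr

end

section

variable {n : ℕ} {f : Vec n → ℝ} {P : Params}

/-! ### Acceptance of trial directions -/

/-- Failing steps are at least c, so some step succeeds; the step just before the first success
failed, which costs one factor θ. -/
lemma exists_isLeast_backtrack {Q : ℕ → Prop} {θ c : ℝ} (hθ0 : 0 < θ) (hθ1 : θ < 1) (hc : 0 < c)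
    (h : ∀ i, ¬ Q i → c ≤ θ ^ i) :
    ∃ j, IsLeast {i | Q i} j ∧ (j = 0 ∨ c * θ ≤ θ ^ j) := by
  classical
  have hex : ∃ i, Q i := by
    obtain ⟨i, hi⟩ := exists_pow_lt_of_lt_one hc hθ1
    by_contra! hcon
    exact absurd (h i (hcon i)) (not_le.2 hi)
  refine ⟨Nat.find hex, ⟨Nat.find_spec hex, fun i hi => Nat.find_min' hex hi⟩, ?_⟩
  rcases Nat.eq_zero_or_pos (Nat.find hex) with h0 | h0
  · exact .inl h0
  · right
    have := h _ (Nat.find_min hex (m := Nat.find hex - 1) (by omega))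
    calc c * θ ≤ θ ^ (Nat.find hex - 1) * θ := mul_le_mul_of_nonneg_right this hθ0.le
      _ = θ ^ (Nat.find hex) := by rw [← pow_succ, Nat.sub_add_cancel h0]

/-- The relations between `e = √(σε)` and `δ = √(ε/σ)`. -/
lemma sqrt_mul_sqrt_div {σ ε : ℝ} (hσ : 0 < σ) (hε : 0 < ε) :
    0 < √(σ * ε) ∧ 0 < √(ε / σ) ∧ σ * √(ε / σ) = √(σ * ε) ∧ √(σ * ε) * √(ε / σ) = ε := by
  refine ⟨by positivity, by positivity, ?_, ?_⟩
  · rw [← Real.sqrt_sq hσ.le, ← Real.sqrt_mul (by positivity), Real.sqrt_sq hσ.le]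
    congr 1; field_simp
  · rw [← Real.sqrt_mul (by positivity)]
    have : σ * ε * (ε / σ) = ε ^ 2 := by field_simp
    rw [this, Real.sqrt_sq hε.le]

lemma rpow_quarter {a : ℝ} (ha : 0 ≤ a) : a ^ (1 / 4 : ℝ) = √√a := by
  rw [Real.sqrt_eq_rpow, Real.sqrt_eq_rpow, ← Real.rpow_mul ha]; norm_num

/-! ### Approximate Newton directions -/

section Sol

variable {x d : Vec n} {σ ε e δ : ℝ}

/-- The slope identity and dᵀHd ≥ -e‖d‖² bound the derivative at s by (s·max(e/2, σs‖d‖/4) -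
(1+s)e)‖d‖². The branch e/2 is harmless; in the other, s²‖d‖ < 4δ gives σs²‖d‖/4 < e. -/
lemma newton_segment_le (hf : ContDiff ℝ 2 f) (he : 0 < e) (hσ : 0 < σ) (hδ : σ * δ = e)
    (hx : HessVar f x e σ) (hd : IsNewtonDir (hess f x) e (gradient f x) d) {a : ℝ}
    (ha1 : a ≤ 1) (ha : a ^ 2 * ‖d‖ < 4 * δ) : ∀ s ∈ Set.Icc 0 a, f (x + s • d) ≤ f x := by
  refine hx.segment_le hf he hσ.le fun s hs hsa => ?_
  have hN := norm_pos_iff.2 hd.ne_zero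
  rw [hd.slope]
  have hq := hd.curv
  set q := inner ℝ d (hess f x d)
  set N := ‖d‖
  have hs1 : s ≤ 1 := hsa.trans ha1
  have hmax : s * max (e / 2) (σ * (s * N) / 4) < (1 + s) * e := by
    rcases max_cases (e / 2) (σ * (s * N) / 4) with ⟨h, -⟩ | ⟨h, -⟩ <;> rw [h]
    · nlinarith
    · have h1 : s ^ 2 * N ≤ a ^ 2 * N := by gcongr
      have h2 : σ * (s ^ 2 * N) < σ * (4 * δ) := mul_lt_mul_of_pos_left (by linarith) hσ
      nlinarith
  have h3 := mul_lt_mul_of_pos_right hmax (by positivity : 0 < N ^ 2)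
  have h4 : (1 - s) * -(e * N ^ 2) ≤ (1 - s) * q := mul_le_mul_of_nonneg_left hq (by linarith)
  linarith

/-- Damping leaves a gain of ae‖d‖² at first order in a. The third-order term σa³‖d‖³/8 uses at most
the fraction 1 - η of it, which is what `ha'` says. -/
lemma newton_decrease (hf : ContDiff ℝ 2 f) (he : 0 < e) (hσ : 0 < σ) (hδ : σ * δ = e)
    (hx : HessVar f x e σ) (hd : IsNewtonDir (hess f x) e (gradient f x) d) {a η : ℝ} (ha0 : 0 ≤ a)
    (ha1 : a ≤ 1) (hη : 0 < η) (ha : a ^ 2 * ‖d‖ < 4 * δ)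
    (ha' : a ^ 2 * ‖d‖ ≤ 8 * (1 - η) * δ) :
    f (x + a • d) ≤ f x - η * e * a ^ 2 * ‖d‖ ^ 2 := by
  have hval := value_line_le hf ha0
    (hx.along_le hσ.le (newton_segment_le hf he hσ hδ hx hd ha1 ha))
  rw [hd.slope] at hval
  have hq := hd.curv
  set q := inner ℝ d (hess f x d)
  set N := ‖d‖ with hNdef
  have hN : 0 ≤ N := norm_nonneg d
  have hmax : max (e / 2) (σ * (a * N) / 4) ≤ e / 2 + σ * (a * N) / 4 :=
    max_le (by have : 0 ≤ σ * (a * N) / 4 := by positivity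
               linarith) (by linarith)
  have h1 : a ^ 2 / 2 * (q + max (e / 2) (σ * (a * N) / 4) * N ^ 2) ≤
      a ^ 2 / 2 * (q + (e / 2 + σ * (a * N) / 4) * N ^ 2) := by gcongr
  have h2 : a * (1 - a / 2) * -(e * N ^ 2) ≤ a * (1 - a / 2) * q :=
    mul_le_mul_of_nonneg_left hq (mul_nonneg ha0 (by linarith))
  have h3 : a * N ^ 2 * σ / 8 * (a ^ 2 * N) ≤ a * N ^ 2 * σ / 8 * (8 * (1 - η) * δ) :=
    mul_le_mul_of_nonneg_left ha' (by positivity)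
  have h4 : a * N ^ 2 * σ / 8 * (8 * (1 - η) * δ) = a * N ^ 2 * (1 - η) * e := by rw [← hδ]; ring
  have h5 : η * e * N ^ 2 * a ^ 2 ≤ η * e * N ^ 2 * a :=
    mul_le_mul_of_nonneg_left (by nlinarith) (by positivity)
  have h6 : 0 ≤ a ^ 2 * e * N ^ 2 := by positivity
  linarith

/-- The new gradient collects the Taylor error (e/2 + σ‖d‖/4)‖d‖, the CG residual e‖d‖/2 and the
damping 2e‖d‖: together less than 6e‖d‖ < eδ. Hence a refused full step is long enough for the line
search. -/
lemma newton_gradient_le (hf : ContDiff ℝ 2 f) (he : 0 < e) (hσ : 0 < σ) (hδ : σ * δ = e)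
    (hx : HessVar f x e σ) (hd : IsNewtonDir (hess f x) e (gradient f x) d) (hN : 6 * ‖d‖ < δ) :
    f (x + d) ≤ f x ∧ ‖gradient f (x + d)‖ ≤ e * δ := by
  have hN0 := norm_nonneg d
  have hseg := newton_segment_le hf he hσ hδ hx hd le_rfl (by linarith)
  have h1 := hseg 1 (by simp)
  have h2 := norm_gradient_line_sub_le hf (hx.along_le hσ.le hseg) (s := 1) (by simp)
  simp only [one_smul, mul_one, one_mul] at h1 h2
  refine ⟨h1, ?_⟩
  have hdec : gradient f (x + d) = (gradient f (x + d) - gradient f x - hess f x d) +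
      (damped (hess f x) e d + gradient f x) - (2 * e) • d := by
    rw [damped]; abel
  have h3 : ‖gradient f (x + d)‖ ≤ ‖gradient f (x + d) - gradient f x - hess f x d‖ +
      ‖damped (hess f x) e d + gradient f x‖ + ‖(2 * e) • d‖ := by
    conv_lhs => rw [hdec]
    exact (norm_sub_le _ _).trans (add_le_add_left (norm_add_le _ _) _)
  rw [norm_smul, Real.norm_of_nonneg (by positivity)] at h3
  have hmax : max (e / 2) (σ * ‖d‖ / 4) ≤ e / 2 + σ * ‖d‖ / 4 :=
    max_le (by have : 0 ≤ σ * ‖d‖ / 4 := by positivity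
               linarith) (by linarith)
  have h4 := mul_le_mul_of_nonneg_right hmax hN0
  have h5 : σ * ‖d‖ ≤ e / 6 := by rw [← hδ]; nlinarith
  have h6 := mul_le_mul_of_nonneg_right h5 hN0
  have h7 : e * (6 * ‖d‖) ≤ e * δ := mul_le_mul_of_nonneg_left hN.le he.le
  have := hd.residual
  have h8 : 0 ≤ e * ‖d‖ := by positivity
  linarith

end Sol

lemma exists_solAccept (hP : P.Valid) (hf : ContDiff ℝ 2 f) {x d : Vec n} {σ ε : ℝ} (hσ : 0 < σ)
    (hε : 0 < ε) (hx : HessVar f x √(σ * ε) σ)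
    (hd : IsNewtonDir (hess f x) √(σ * ε) (gradient f x) d) : ∃ j, SolAccept f ε P x σ d j := by
  obtain ⟨he, hδ0, hδ, hεδ⟩ := sqrt_mul_sqrt_div hσ hε
  by_cases hfull : f (x + d) ≤ f x ∧ ‖gradient f (x + d)‖ ≤ ε
  · exact ⟨0, .full hfull.1 hfull.2⟩
  have hlong : √(ε / σ) ≤ 6 * ‖d‖ := by
    by_contra! hcon
    have := newton_gradient_le hf he hσ hδ hx hd hcon
    rw [hεδ] at this
    exact hfull this
  have hη0 := hP.η_mem.1
  have hη1 := hP.η_mem.2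
  have hθ0 := hP.θ_mem.1
  have hθ1 := hP.θ_mem.2
  have hN : 0 < ‖d‖ := norm_pos_iff.2 hd.ne_zero
  have h4 : (ε / σ) ^ (1 / 4 : ℝ) = √√(ε / σ) := rpow_quarter (by positivity)
  set δ := √(ε / σ) with hδdef
  have hη : 0 < 1 - P.η := by linarith
  obtain ⟨j, hj, hjθ⟩ := exists_isLeast_backtrack (Q := SolDecrease f ε P x σ d)
    (c := 2 * (1 - P.η) * √δ / (3 * √‖d‖)) hθ0 hθ1 (by positivity) (by
      intro i hi
      have hpow0 : 0 < P.θ ^ i := by positivity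
      have hpow1 : P.θ ^ i ≤ 1 := pow_le_one₀ hθ0.le hθ1.le
      -- A failing step must violate a size condition of `newton_decrease`. The threshold
      -- (4/9)(1-η)²δ lies below both 4δ and 8(1-η)δ, and is the square of the acceptance floor,
      -- without θ, times ‖d‖.
      have hbig : 4 / 9 * (1 - P.η) ^ 2 * δ ≤ (P.θ ^ i) ^ 2 * ‖d‖ := by
        by_contra! hcon
        apply hi
        have hle : (1 - P.η) ^ 2 ≤ 1 - P.η := by nlinarith
        have hle2 := mul_le_mul_of_nonneg_right hle hδ0.le
        have := newton_decrease hf he hσ hδ hx hd hpow0.le hpow1 hη0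
          (by nlinarith) (by nlinarith)
        rw [SolDecrease, mul_comm 2 i, pow_mul]
        exact this
      rw [div_le_iff₀ (by positivity)]
      have hs : (2 * (1 - P.η) * √δ) ^ 2 ≤ (P.θ ^ i * (3 * √‖d‖)) ^ 2 := by
        rw [mul_pow, mul_pow (P.θ ^ i), mul_pow 3, Real.sq_sqrt hδ0.le, Real.sq_sqrt hN.le]
        linarith
      exact (sq_le_sq₀ (by positivity) (by positivity)).1 hs)
  refine ⟨j, .search j hfull hlong ⟨j, ?_, hj.1⟩ hj⟩
  rcases hjθ with rfl | h
  · simp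
  · refine (min_le_right _ _).trans (le_trans (le_of_eq ?_) h)
    rw [h4]; ring

/-- Either the step is full, and then ‖d‖ ≥ δ/6 suffices, or θ^{2j}‖d‖ ≥ K²δ, and multiplying by ‖d‖
≥ δ/6 gives order δ² again. Finally eδ² = εδ. -/
lemma SolAccept.le (hP : P.Valid) {x d : Vec n} {σ ε : ℝ} {j : ℕ} (hσ : 0 < σ) (hε : 0 < ε)
    (h : SolAccept f ε P x σ d j) :
    (f (x + P.θ ^ j • d) ≤ f x ∧ ‖gradient f (x + P.θ ^ j • d)‖ ≤ ε) ∨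
      f (x + P.θ ^ j • d) ≤ f x - cSolHat P * (ε * √(ε / σ)) := by
  obtain ⟨he, hδ0, hδ, hεδ⟩ := sqrt_mul_sqrt_div hσ hε
  have hη0 := hP.η_mem.1
  have hη1 := hP.η_mem.2
  have hθ0 := hP.θ_mem.1
  cases h with
  | full h1 h2 => left; simpa using ⟨h1, h2⟩
  | search _ hnot hlong hex hleast =>
    right
    obtain ⟨i, hi, hdec⟩ := hex
    -- The index meeting the floor need not be the chosen one, but minimality of j makes θ^j at
    -- least as large.
    have hji : j ≤ i := hleast.2 hdec
    have hθji : P.θ ^ i ≤ P.θ ^ j := pow_le_pow_of_le_one hθ0.le hP.θ_mem.2.le hji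
    have hj : SolDecrease f ε P x σ d j := hleast.1
    rw [SolDecrease, mul_comm 2 j, pow_mul] at hj
    refine hj.trans (sub_le_sub_left ?_ _)
    have hlow := hi.trans hθji
    rw [rpow_quarter (by positivity)] at hlow
    set δ := √(ε / σ)
    set α := P.θ ^ j
    set e := √(σ * ε)
    set N := ‖d‖
    have hα : 0 < α := by positivity
    have hN : 0 < N := by linarith
    set K := 2 * (1 - P.η) * P.θ / 3 with hK
    have hη : 0 < 1 - P.η := by linarith
    have hK0 : 0 < K := by positivity
    have hcase : min (1 / 6) (K ^ 2) * δ ^ 2 / 6 ≤ α ^ 2 * N ^ 2 := by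
      rcases min_le_iff.1 hlow with h1 | h1
      · have h2 : 1 ≤ α ^ 2 := one_le_pow₀ h1
        have h3 : N ^ 2 * 1 ≤ N ^ 2 * α ^ 2 := by gcongr
        have h4 : min (1 / 6) (K ^ 2) * δ ^ 2 ≤ 1 / 6 * δ ^ 2 := by
          gcongr; exact min_le_left _ _
        nlinarith
      · have h2 : K * √δ ≤ α * √N := by
          rw [div_le_iff₀ (by positivity)] at h1
          rw [hK]
          linarith
        have h3 : (K * √δ) ^ 2 ≤ (α * √N) ^ 2 := by gcongr
        rw [mul_pow, mul_pow, Real.sq_sqrt hδ0.le, Real.sq_sqrt hN.le] at h3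
        have h4 := mul_le_mul_of_nonneg_right h3 hN.le
        have h5 : K ^ 2 * δ * δ ≤ K ^ 2 * δ * (6 * N) := by gcongr
        have h6 : min (1 / 6) (K ^ 2) * δ ^ 2 ≤ K ^ 2 * δ ^ 2 := by
          gcongr; exact min_le_right _ _
        linarith
    calc cSolHat P * (ε * δ) = P.η * e * (min (1 / 6) (K ^ 2) * δ ^ 2 / 6) := by
          rw [cSolHat, ← hεδ]; ring
      _ ≤ P.η * e * (α ^ 2 * N ^ 2) := by gcongr
      _ = _ := by ring

/-! Negative curvature directions. -/

lemma sgn_mul_self (s : ℝ) : sgn s * s = |s| ∧ sgn s ^ 2 = 1 := by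
  unfold sgn
  split_ifs with h
  · simp [abs_of_nonneg h]
  · simp [abs_of_neg (not_le.1 h)]

lemma min_mul_max_inv {σ : ℝ} (hσ : 0 < σ) :
    min 1 σ * max 1 (1 / σ) = 1 ∧ σ * min 1 (1 / σ) = min 1 σ := by
  rcases le_total 1 σ with h | h
  · have : 1 / σ ≤ 1 := by rwa [div_le_one hσ]
    rw [min_eq_left h, max_eq_left this, min_eq_right this]
    constructor <;> field_simp
  · have : 1 ≤ 1 / σ := by rwa [le_div_iff₀ hσ, one_mul]
    rw [min_eq_right h, max_eq_right this, min_eq_left this]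
    constructor <;> field_simp

/-- Scaled directions of negative curvature. -/
structure IsNegCurvDir (H : Vec n →L[ℝ] Vec n) (e σ : ℝ) (g D : Vec n) : Prop where
  long : e < min 1 σ * ‖D‖
  slope : inner ℝ g D ≤ 0
  curv : inner ℝ D (H D) = -(min 1 σ * ‖D‖ ^ 3)

/-- The scaling makes min(1,σ)‖D‖ equal to the absolute Rayleigh quotient of d, because
min(1,σ)·max(1,1/σ) = 1. This gives the length bound, and makes the curvature along D cubic in ‖D‖.
-/
lemma isNegCurvDir_ncDir {H : Vec n →L[ℝ] Vec n} {e σ : ℝ} {g d : Vec n} (hσ : 0 < σ) (he : 0 < e)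
    (hd0 : d ≠ 0) (hd : inner ℝ d (H d) < -(e * ‖d‖ ^ 2)) :
    IsNegCurvDir H e σ g (ncDir H g σ d) := by
  obtain ⟨hmM, -⟩ := min_mul_max_inv hσ
  have hN := norm_pos_iff.2 hd0
  obtain ⟨hs1, hs2⟩ := sgn_mul_self (inner ℝ d g)
  have hq : |inner ℝ d (H d)| = -inner ℝ d (H d) :=
    abs_of_neg (hd.trans_le (by simp only [Left.neg_nonpos_iff]; positivity))
  set m := min 1 σ
  set M := max 1 (1 / σ) with hM
  have hM0 : 0 < M := lt_max_of_lt_left one_pos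
  set q := inner ℝ d (H d) with hqdef
  set s := sgn (inner ℝ d g)
  have hqpos : 0 < -q := by
    have : 0 < e * ‖d‖ ^ 2 := by positivity
    linarith
  have hsabs : |s| = 1 := by rwa [← sq_eq_sq₀ (abs_nonneg s) zero_le_one, sq_abs, one_pow]
  have hnorm : ‖ncDir H g σ d‖ = M * (-q / ‖d‖ ^ 2) := by
    rw [ncDir, norm_smul, Real.norm_eq_abs, abs_mul, abs_mul, abs_neg, hsabs, hq,
      abs_of_pos hM0, abs_of_nonneg (by positivity)]
    field_simp
  refine ⟨?_, ?_, ?_⟩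
  · rw [hnorm, ← mul_assoc, hmM, one_mul, lt_div_iff₀ (by positivity)]
    linarith
  · rw [ncDir, real_inner_smul_right, real_inner_comm d g]
    have : -s * M * (|q| / ‖d‖ ^ 3) * inner ℝ d g = -(|inner ℝ d g| * (M * (|q| / ‖d‖ ^ 3))) := by
      rw [← hs1]; ring
    rw [this, Left.neg_nonpos_iff]
    positivity
  · rw [hnorm, ncDir, map_smul, real_inner_smul_left, real_inner_smul_right, hq, ← hqdef]
    have h1 : -s * M * (-q / ‖d‖ ^ 3) * (-s * M * (-q / ‖d‖ ^ 3) * q) =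
        s ^ 2 * (M ^ 2 * (-q / ‖d‖ ^ 3) ^ 2 * q) := by ring
    have h2 : m * (M * (-q / ‖d‖ ^ 2)) ^ 3 = (m * M) * (M ^ 2 * (-q / ‖d‖ ^ 2) ^ 3) := by ring
    rw [h1, h2, hs2, hmM]
    field_simp

/-- For s ≤ a one has σs ≤ min(1,σ), so the Hessian variation eats at most half of the negative
curvature min(1,σ)‖D‖. -/
lemma negCurv_decrease (hf : ContDiff ℝ 2 f) {x D : Vec n} {e σ a η : ℝ} (he : 0 < e) (hσ : 0 < σ)
    (hx : HessVar f x e σ) (hD : IsNegCurvDir (hess f x) e σ (gradient f x) D) (ha0 : 0 ≤ a)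
    (ha : a < min 1 (1 / σ)) (hη1 : η < 1) :
    f (x + a • D) ≤ f x - η * min 1 σ * a ^ 2 * ‖D‖ ^ 3 / 4 := by
  obtain ⟨hmM, hq⟩ := min_mul_max_inv hσ
  have hlong := hD.long
  have hm : 0 < min 1 σ := lt_min one_pos hσ
  have hN : 0 < ‖D‖ := by
    by_contra! h
    have := le_antisymm h (norm_nonneg D)
    rw [this] at hlong; linarith
  have hmax : ∀ s, 0 ≤ s → s ≤ a →
      max (e / 2) (σ * (s * ‖D‖) / 4) ≤ min 1 σ * ‖D‖ / 2 := by
    intro s hs0 hs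
    apply max_le (by linarith)
    have h1 : σ * s ≤ min 1 σ := by
      rw [← hq]; exact mul_le_mul_of_nonneg_left (hs.trans ha.le) hσ.le
    have := mul_le_mul_of_nonneg_right h1 hN.le
    have := mul_pos hm hN
    linarith
  have hcurv : ∀ s, 0 ≤ s → s ≤ a → inner ℝ D (hess f x D) +
      max (e / 2) (σ * (s * ‖D‖) / 4) * ‖D‖ ^ 2 ≤ -(min 1 σ * ‖D‖ ^ 3 / 2) := by
    intro s hs0 hs
    have := mul_le_mul_of_nonneg_right (hmax s hs0 hs) (by positivity : 0 ≤ ‖D‖ ^ 2)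
    rw [hD.curv]
    linarith
  have hpos : 0 < min 1 σ * ‖D‖ ^ 3 / 2 := by positivity
  have hseg := hx.segment_le hf he hσ.le (d := D) (a := a) fun s hs hsa => by
    have h1 := mul_le_mul_of_nonneg_left (hcurv s hs.le hsa) hs.le
    have h2 := mul_pos hs hpos
    have := hD.slope
    linarith
  have hval := value_line_le hf ha0 (hx.along_le hσ.le hseg)
  have h1 := mul_le_mul_of_nonneg_left (hcurv a ha0 le_rfl) (by positivity : 0 ≤ a ^ 2 / 2)
  have h2 := mul_nonneg ha0 (neg_nonneg.2 hD.slope)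
  have h3 : 0 ≤ (1 - η) * (min 1 σ * a ^ 2 * ‖D‖ ^ 3) :=
    mul_nonneg (by linarith) (by positivity)
  linarith

lemma exists_ncAccept (hP : P.Valid) (hf : ContDiff ℝ 2 f) {x D : Vec n} {e σ : ℝ} (hσ : 0 < σ)
    (he : 0 < e) (hx : HessVar f x e σ) (hD : IsNegCurvDir (hess f x) e σ (gradient f x) D) :
    ∃ j, NcAccept f P x σ D j := by
  obtain ⟨j, hj, hjθ⟩ := exists_isLeast_backtrack (Q := NcDecrease f P x σ D)
    (c := min 1 (1 / σ)) hP.θ_mem.1 hP.θ_mem.2 (by positivity) (by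
      intro i hi
      by_contra! hcon
      apply hi
      rw [NcDecrease, mul_comm 2 i, pow_mul]
      exact negCurv_decrease hf he hσ hx hD (pow_nonneg hP.θ_mem.1.le i) hcon hP.η_mem.2)
  refine ⟨j, ⟨j, ?_, hj.1⟩, hj⟩
  have hθ0 := hP.θ_mem.1
  rw [zpow_sub₀ hθ0.ne', zpow_one, zpow_natCast, le_div_iff₀ hθ0]
  rcases hjθ with rfl | h
  · have := hP.θ_mem.2
    rw [pow_zero]
    exact mul_le_one₀ (min_le_left _ _) hθ0.le this.le
  · exact h

/-- With m = min(1,σ) = σq and σδ = e one has m²eδ² = q²e³. The floor θ^j ≥ qθ and m‖D‖ > e then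
bound the decrease after cancelling m². -/
lemma NcAccept.le (hP : P.Valid) {H : Vec n →L[ℝ] Vec n} {x g D : Vec n} {σ ε : ℝ} {j : ℕ}
    (hσ : 0 < σ) (hε : 0 < ε) (hD : IsNegCurvDir H √(σ * ε) σ g D) (h : NcAccept f P x σ D j) :
    f (x + P.θ ^ j • D) ≤ f x - cNc P * (ε * √(ε / σ)) := by
  obtain ⟨he, hδ0, hδ, hεδ⟩ := sqrt_mul_sqrt_div hσ hε
  obtain ⟨hmM, hq⟩ := min_mul_max_inv hσ
  obtain ⟨⟨i, hi, hdec⟩, hleast⟩ := h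
  have hθ0 := hP.θ_mem.1
  have hη0 := hP.η_mem.1
  have hθji : P.θ ^ i ≤ P.θ ^ j := pow_le_pow_of_le_one hθ0.le hP.θ_mem.2.le (hleast.2 hdec)
  rw [zpow_sub₀ hθ0.ne', zpow_one, zpow_natCast, le_div_iff₀ hθ0] at hi
  have hj : NcDecrease f P x σ D j := hleast.1
  rw [NcDecrease, mul_comm 2 j, pow_mul] at hj
  refine hj.trans (sub_le_sub_left ?_ _)
  have hα := hi.trans hθji
  have hm : 0 < min 1 σ := lt_min one_pos hσ
  have hq0 : 0 < min 1 (1 / σ) := by positivity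
  have hlong := hD.long
  set δ := √(ε / σ)
  set e := √(σ * ε)
  set m := min 1 σ
  set q := min 1 (1 / σ)
  set α := P.θ ^ j
  have h1 : (q * P.θ) ^ 2 ≤ α ^ 2 := by gcongr
  have h2 : e ^ 3 ≤ (m * ‖D‖) ^ 3 := by gcongr
  have h3 : (q * P.θ) ^ 2 * e ^ 3 ≤ α ^ 2 * (m * ‖D‖) ^ 3 := by gcongr
  have h4 : m ^ 2 * (P.θ ^ 2 * (e * δ ^ 2)) ≤ m ^ 2 * (m * α ^ 2 * ‖D‖ ^ 3) := by
    calc _ = (q * P.θ) ^ 2 * e ^ 3 := by rw [← hδ, ← hq]; ring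
      _ ≤ _ := h3
      _ = _ := by ring
  have h5 := le_of_mul_le_mul_left h4 (by positivity)
  calc cNc P * (ε * δ) = P.η / 4 * (P.θ ^ 2 * (e * δ ^ 2)) := by rw [cNc, ← hεδ]; ring
    _ ≤ P.η / 4 * (m * α ^ 2 * ‖D‖ ^ 3) := by gcongr
    _ = _ := by ring

/-! ### Hölder continuity of the Hessian along segments in the level set -/

/-- Hölder continuity of the Hessian along segments contained in the level set of `x0`. -/
structure SegHolder (f : Vec n → ℝ) (x0 : Vec n) (ν H : ℝ) : Prop where
  nonneg : 0 ≤ ν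
  le_one : ν ≤ 1
  pos : 0 < H
  bound : ∀ x d : Vec n, (∀ u ∈ Set.Icc (0 : ℝ) 1, f (x + u • d) ≤ f x0) →
    ‖hess f (x + d) - hess f x‖ ≤ H * ‖d‖ ^ ν

lemma HolderHessian.segHolder {x0 : Vec n} {Ω : Set (Vec n)} {ν H : ℝ}
    (h : HolderHessian f x0 Ω ν H) : SegHolder f x0 ν H := by
  refine ⟨h.ν_mem.1, h.ν_mem.2, h.H_pos, fun x d hd => ?_⟩
  have h0 := h.levelSet_subset (hd 0 (by simp))
  have h1 := h.levelSet_subset (hd 1 (by simp))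
  simp only [zero_smul, add_zero, one_smul] at h0 h1
  simpa using h.holder _ h1 _ h0

/-- This second instance, with exponent 0, makes the iteration bounds available in terms of U. -/
lemma segHolder_of_norm_hess_le {x0 : Vec n} {U : ℝ} (hU : 0 < U)
    (h : ∀ x ∈ levelSet f x0, ‖hess f x‖ ≤ U) : SegHolder f x0 0 (2 * U) := by
  refine ⟨le_rfl, zero_le_one, by positivity, fun x d hd => ?_⟩
  have h0 := h _ (hd 0 (by simp))
  have h1 := h _ (hd 1 (by simp))
  simp only [zero_smul, add_zero, one_smul] at h0 h1
  rw [Real.rpow_zero]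
  exact (norm_sub_le _ _).trans (by linarith)

/-- The two branches cross at t = 2√(ε/σ), where γ_ν(ε) ≤ σ says precisely H t^ν ≤ √(σε)/2. Below t
use monotonicity of s^ν; above it s^ν ≤ t^ν(s/t), since ν ≤ 1. -/
lemma holder_le_max {ν H σ ε s : ℝ} (hν0 : 0 ≤ ν) (hν1 : ν ≤ 1) (hH : 0 < H) (hε : 0 < ε)
    (hσ : gammaNu ν H ε ≤ σ) (hs : 0 ≤ s) : H * s ^ ν ≤ max (√(σ * ε) / 2) (σ * s / 4) := by
  have hγ : 0 < gammaNu ν H ε := by unfold gammaNu; positivity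
  have hσ0 : 0 < σ := hγ.trans_le hσ
  set t := (ε / (σ / 4)) ^ (1 / 2 : ℝ) with ht
  have ht0 : 0 < t := by positivity
  have hHle : H ≤ (σ / 4) ^ ((1 + ν) / 2) * ε ^ ((1 - ν) / 2) := by
    have h1 : (gammaNu ν H ε / 4) ^ ((1 + ν) / 2) ≤ (σ / 4) ^ ((1 + ν) / 2) := by
      apply Real.rpow_le_rpow (by positivity) (by linarith) (by linarith)
    have h2 : gammaNu ν H ε / 4 = H ^ (2 / (1 + ν)) * ε ^ (-(1 - ν) / (1 + ν)) := by
      unfold gammaNu; ring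
    rw [h2, Real.mul_rpow (by positivity) (by positivity), ← Real.rpow_mul hH.le,
      ← Real.rpow_mul hε.le] at h1
    have h3 : 2 / (1 + ν) * ((1 + ν) / 2) = 1 := by field_simp
    have h4 : -(1 - ν) / (1 + ν) * ((1 + ν) / 2) = -((1 - ν) / 2) := by field_simp
    rw [h3, h4, Real.rpow_one, Real.rpow_neg hε.le, ← div_eq_mul_inv,
      div_le_iff₀ (by positivity)] at h1
    exact h1
  have hst : √(σ * ε) / 2 = (σ / 4) ^ (1 / 2 : ℝ) * ε ^ (1 / 2 : ℝ) := by
    rw [← Real.sqrt_eq_rpow, ← Real.sqrt_eq_rpow, ← Real.sqrt_mul (by positivity)]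
    have : σ / 4 * ε = σ * ε / 2 ^ 2 := by ring
    rw [this, Real.sqrt_div (by positivity), Real.sqrt_sq (by norm_num)]
  have hkey : H * t ^ ν ≤ √(σ * ε) / 2 := by
    calc H * t ^ ν ≤ (σ / 4) ^ ((1 + ν) / 2) * ε ^ ((1 - ν) / 2) * t ^ ν := by gcongr
      _ = (σ / 4) ^ (1 / 2 : ℝ) * ε ^ (1 / 2 : ℝ) := by
        rw [ht, ← Real.rpow_mul (by positivity), Real.div_rpow hε.le (by positivity)]
        have h1 : (σ / 4) ^ ((1 + ν) / 2) =
            (σ / 4) ^ (1 / 2 : ℝ) * (σ / 4) ^ (1 / 2 * ν) := by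
          rw [← Real.rpow_add (by positivity)]; congr 1; ring
        have h2 : ε ^ (1 / 2 : ℝ) = ε ^ ((1 - ν) / 2) * ε ^ (1 / 2 * ν) := by
          rw [← Real.rpow_add (by positivity)]; congr 1; ring
        rw [h1, h2]
        field_simp
      _ = _ := hst.symm
  rcases le_total s t with h | h
  · refine le_max_of_le_left (le_trans ?_ hkey)
    gcongr
  · refine le_max_of_le_right ?_
    have h1 : s ^ ν ≤ t ^ ν * (s / t) := by
      have : s ^ ν = t ^ ν * (s / t) ^ ν := by
        rw [← Real.mul_rpow ht0.le (by positivity)]; congr 1; field_simp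
      rw [this]
      have h2 : (s / t) ^ ν ≤ (s / t) ^ (1 : ℝ) :=
        Real.rpow_le_rpow_of_exponent_le (by rwa [le_div_iff₀ ht0, one_mul]) hν1
      rw [Real.rpow_one] at h2
      gcongr
    have h3 : √(σ * ε) / 2 = σ / 4 * t := by
      rw [hst, ht, Real.div_rpow hε.le (by positivity)]
      have : σ / 4 = (σ / 4) ^ (1 / 2 : ℝ) * (σ / 4) ^ (1 / 2 : ℝ) := by
        rw [← Real.rpow_add (by positivity)]; norm_num
      field_simp
      rw [← Real.rpow_natCast, ← Real.rpow_mul (by positivity)]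
      norm_num
      ring
    calc H * s ^ ν ≤ H * (t ^ ν * (s / t)) := by gcongr
      _ = H * t ^ ν * (s / t) := by ring
      _ ≤ σ / 4 * t * (s / t) := by
        rw [← h3]; gcongr
      _ = σ * s / 4 := by field_simp

lemma SegHolder.hessVar {x0 x : Vec n} {ν H σ ε : ℝ} (h : SegHolder f x0 ν H)
    (hx : f x ≤ f x0) (hε : 0 < ε) (hσ : gammaNu ν H ε ≤ σ) : HessVar f x √(σ * ε) σ :=
  fun d hd => (h.bound x d fun u hu => (hd u hu).trans hx).trans
    (holder_le_max h.nonneg h.le_one h.pos hε hσ (norm_nonneg d))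

end

section

variable {n : ℕ} {f : Vec n → ℝ} {P : Params} {ε : ℝ} {x0 : Vec n} {s s' : NCGState n}

/-! ### Steps of the parameter-free Newton-CG method -/

/-- The guaranteed decrease factor. -/
noncomputable def decFactor (P : Params) : ℝ := min (cSolHat P) (cNc P)

lemma decFactor_pos (hP : P.Valid) : 0 < decFactor P := by
  have hη := hP.η_mem.1
  have hη1 : 0 < 1 - P.η := sub_pos.2 hP.η_mem.2
  have hθ := hP.θ_mem.1
  unfold decFactor cSolHat cNc
  positivity

lemma trialSigma_ge (hP : P.Valid) (s : NCGState n) : P.γinit ≤ trialSigma P s :=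
  (le_max_left _ _).trans (le_mul_of_one_le_left (hP.γinit_pos.le.trans (le_max_left _ _))
    (one_le_pow₀ hP.one_lt_r.le))

lemma trialSigma_pos (hP : P.Valid) (s : NCGState n) : 0 < trialSigma P s :=
  hP.γinit_pos.trans_le (trialSigma_ge hP s)

/-- What one inner iteration from `s` to `s'` achieves. -/
structure StepOutcome (f : Vec n → ℝ) (ε : ℝ) (P : Params) (x0 : Vec n) (s s' : NCGState n) :
    Prop where
  grad_large : ε < ‖gradient f s.x‖
  inner_eq : s'.inner = s.inner + 1
  call : ∃ ty d m, CappedCG (hess f s.x) √(trialSigma P s * ε) P.ζ (gradient f s.x) ty d m ∧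
    s'.grads + s'.hvps ≤ s.grads + s.hvps + (m + 3)
  result : (s'.γ = trialSigma P s ∧ s'.t = 0 ∧ s'.outer = s.outer + 1 ∧
      (f s'.x ≤ f s.x ∧ ‖gradient f s'.x‖ ≤ ε ∨
        f s'.x ≤ f s.x - decFactor P * (ε * √(ε / trialSigma P s)))) ∨
    (s'.x = s.x ∧ s'.γ = s.γ ∧ s'.t = s.t + 1 ∧ s'.outer = s.outer ∧
      ∀ ν H, SegHolder f x0 ν H → f s.x ≤ f x0 → trialSigma P s < gammaNu ν H ε)

lemma NCGStep.outcome (hP : P.Valid) (hf : ContDiff ℝ 2 f) (hε : 0 < ε)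
    (h : NCGStep f ε P s s') (x0 : Vec n) : StepOutcome f ε P x0 s s' := by
  have hσ := trialSigma_pos hP s
  have he : 0 < √(trialSigma P s * ε) := by positivity
  have hdec : 0 ≤ ε * √(ε / trialSigma P s) := by positivity
  have hζ := hP.ζ_mem
  have hne : ε < ‖gradient f s.x‖ → gradient f s.x ≠ 0 := fun hg =>
    norm_pos_iff.1 (hε.trans hg)
  have hH := inner_hess_comm hf s.x
  cases h with
  | sol_accept d m j hg hcg hacc =>
    refine ⟨hg, rfl, ⟨_, d, m, hcg, by simp only; omega⟩, .inl ⟨rfl, rfl, rfl, ?_⟩⟩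
    rcases hacc.le hP hσ hε with h | h
    · exact .inl h
    · refine .inr (h.trans (sub_le_sub_left ?_ _))
      exact mul_le_mul_of_nonneg_right (min_le_left _ _) hdec
  | sol_reject d m hg hcg hrej =>
    refine ⟨hg, rfl, ⟨_, d, m, hcg, by simp only; omega⟩, .inr ⟨rfl, rfl, rfl, rfl, ?_⟩⟩
    intro ν H hsh hx
    by_contra! hcon
    obtain ⟨j, hj⟩ := exists_solAccept hP hf hσ hε (hsh.hessVar hx hε hcon)
      (hcg.sol_spec hH he hζ.1 hζ.2 (hne hg))
    exact hrej j hj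
  | nc_accept d m j hg hcg hacc =>
    refine ⟨hg, rfl, ⟨_, d, m, hcg, by simp only; omega⟩, .inl ⟨rfl, rfl, rfl, .inr ?_⟩⟩
    obtain ⟨hd1, hd0⟩ := hcg.nc_spec
    refine (hacc.le hP hσ hε (isNegCurvDir_ncDir hσ he hd0 hd1)).trans (sub_le_sub_left ?_ _)
    exact mul_le_mul_of_nonneg_right (min_le_right _ _) hdec
  | nc_reject d m hg hcg hrej =>
    refine ⟨hg, rfl, ⟨_, d, m, hcg, by simp only; omega⟩, .inr ⟨rfl, rfl, rfl, rfl, ?_⟩⟩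
    intro ν H hsh hx
    by_contra! hcon
    obtain ⟨hd1, hd0⟩ := hcg.nc_spec
    obtain ⟨j, hj⟩ := exists_ncAccept hP hf hσ he (hsh.hessVar hx hε hcon)
      (isNegCurvDir_ncDir (g := gradient f s.x) hσ he hd0 hd1)
    exact hrej j hj

lemma exists_ncgStep (hP : P.Valid) (hf : ContDiff ℝ 2 f) (hε : 0 < ε)
    (hg : ε < ‖gradient f s.x‖) : ∃ s', NCGStep f ε P s s' := by
  have hσ := trialSigma_pos hP s
  obtain ⟨ty, d, m, hcg⟩ := exists_cappedCG (inner_hess_comm hf s.x)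
    (by positivity : 0 < √(trialSigma P s * ε)) hP.ζ_mem.1 (norm_pos_iff.1 (hε.trans hg))
  cases ty with
  | sol =>
    by_cases h : ∃ j, SolAccept f ε P s.x (trialSigma P s) d j
    · obtain ⟨j, hj⟩ := h
      exact ⟨_, .sol_accept s d m j hg hcg hj⟩
    · exact ⟨_, .sol_reject s d m hg hcg (not_exists.1 h)⟩
  | nc =>
    by_cases h : ∃ j, NcAccept f P s.x (trialSigma P s)
        (ncDir (hess f s.x) (gradient f s.x) (trialSigma P s) d) j
    · obtain ⟨j, hj⟩ := h
      exact ⟨_, .nc_accept s d m j hg hcg hj⟩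
    · exact ⟨_, .nc_reject s d m hg hcg (not_exists.1 h)⟩

/-! ### Invariants and iteration complexity -/

/-- The guaranteed decrease of an outer iteration. -/
noncomputable def outerDecrease (P : Params) (ν H ε : ℝ) : ℝ :=
  decFactor P * (ε * √(ε / sigmaMax P ν H ε))

lemma sigmaMax_pos (hP : P.Valid) (ν H ε : ℝ) : 0 < sigmaMax P ν H ε :=
  hP.γinit_pos.trans_le (le_max_left _ _)

lemma outerDecrease_pos (hP : P.Valid) (ν H : ℝ) (hε : 0 < ε) : 0 < outerDecrease P ν H ε := by
  have := sigmaMax_pos hP ν H ε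
  have := decFactor_pos hP
  unfold outerDecrease
  positivity

lemma outerDecrease_le (hP : P.Valid) {ν H σ : ℝ} (hε : 0 < ε) (hσ : 0 < σ)
    (h : σ ≤ sigmaMax P ν H ε) :
    outerDecrease P ν H ε ≤ decFactor P * (ε * √(ε / σ)) := by
  have := decFactor_pos hP
  unfold outerDecrease
  gcongr

/-- `pow_le` tracks powers of r: an inner iteration adds one on the left, and on the right a
rejection adds one through t. In `outer_le` the second alternative allows for a full Newton step
without guaranteed decrease; its gradient is small, so it is the last step. -/
structure NCGInv (f : Vec n → ℝ) (ε : ℝ) (P : Params) (x0 : Vec n) (ν H : ℝ) (s : NCGState n) :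
    Prop where
  level : f s.x ≤ f x0
  γ_ge : P.γinit ≤ s.γ
  sigma_le : trialSigma P s ≤ sigmaMax P ν H ε
  pow_le : P.γinit * P.r ^ s.inner ≤ s.γ * P.r ^ (s.t + 2 * s.outer)
  outer_le : s.outer * outerDecrease P ν H ε ≤ f x0 - f s.x ∨
    (‖gradient f s.x‖ ≤ ε ∧ (s.outer - 1) * outerDecrease P ν H ε ≤ f x0 - f s.x)

lemma ncgInv_init (hP : P.Valid) (f : Vec n → ℝ) (ε : ℝ) (x0 : Vec n) (ν H : ℝ) :
    NCGInv f ε P x0 ν H (ncgInit P x0) := by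
  refine ⟨le_rfl, le_rfl, ?_, by simp [ncgInit], .inl (by simp [ncgInit])⟩
  simp only [trialSigma, ncgInit, pow_zero, one_mul]
  have : P.γinit / P.r ≤ P.γinit := div_le_self hP.γinit_pos.le hP.one_lt_r.le
  exact max_le (le_max_left _ _) (this.trans (le_max_left _ _))

lemma NCGInv.step (hP : P.Valid) (hε : 0 < ε) {ν H : ℝ} (hsh : SegHolder f x0 ν H)
    (hs : NCGInv f ε P x0 ν H s) (h : StepOutcome f ε P x0 s s') : NCGInv f ε P x0 ν H s' := by
  have hr1 := hP.one_lt_r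
  have hr0 : 0 < P.r := by linarith
  have hσ := trialSigma_pos hP s
  have hD := outerDecrease_pos hP ν H hε
  have hOut : s.outer * outerDecrease P ν H ε ≤ f x0 - f s.x := by
    rcases hs.outer_le with h1 | h1
    · exact h1
    · exact absurd h.grad_large (not_lt.2 h1.1)
  rcases h.result with ⟨hγ, ht, ho, hf⟩ | ⟨hx, hγ, ht, ho, hlt⟩
  · have hdle := outerDecrease_le hP hε hσ hs.sigma_le
    have hfle : f s'.x ≤ f s.x := by
      rcases hf with h1 | h1
      · exact h1.1
      · linarith
    refine ⟨hfle.trans hs.level, hγ ▸ trialSigma_ge hP s, ?_, ?_, ?_⟩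
    · rw [trialSigma, ht, hγ, pow_zero, one_mul]
      exact max_le (le_max_left _ _) ((div_le_self hσ.le hr1.le).trans hs.sigma_le)
    · rw [h.inner_eq, ho, ht, hγ]
      -- The accepted σ can fall short of γ r^t by one factor r; with the factor for the call
      -- itself, this is the 2 charged per outer iteration.
      have h1 : s.γ * P.r ^ s.t ≤ trialSigma P s * P.r := by
        rw [trialSigma, mul_assoc, mul_comm s.γ]
        refine mul_le_mul_of_nonneg_left ?_ (by positivity)
        rw [← div_le_iff₀ hr0]
        exact le_max_right _ _
      calc P.γinit * P.r ^ (s.inner + 1) = P.γinit * P.r ^ s.inner * P.r := by ring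
        _ ≤ s.γ * P.r ^ (s.t + 2 * s.outer) * P.r :=
          mul_le_mul_of_nonneg_right hs.pow_le hr0.le
        _ = s.γ * P.r ^ s.t * P.r ^ (2 * s.outer + 1) := by ring
        _ ≤ trialSigma P s * P.r * P.r ^ (2 * s.outer + 1) := by gcongr
        _ = _ := by ring
    · rw [ho]; push_cast
      rcases hf with h1 | h1
      · right
        refine ⟨h1.2, ?_⟩
        rw [add_sub_cancel_right]
        linarith [h1.1]
      · left; linarith
  · refine ⟨hx ▸ hs.level, hγ ▸ hs.γ_ge, ?_, ?_, ?_⟩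
    · have h1 := hlt ν H hsh hs.level
      have h2 : trialSigma P s' = P.r * trialSigma P s := by
        rw [trialSigma, trialSigma, ht, hγ]; ring
      rw [h2]
      exact (mul_le_mul_of_nonneg_left h1.le hr0.le).trans (le_max_right _ _)
    · rw [h.inner_eq, ho, ht, hγ]
      calc P.γinit * P.r ^ (s.inner + 1) = P.γinit * P.r ^ s.inner * P.r := by ring
        _ ≤ s.γ * P.r ^ (s.t + 2 * s.outer) * P.r :=
          mul_le_mul_of_nonneg_right hs.pow_le hr0.le
        _ = _ := by ring
    · left; rw [ho, hx]; exact hOut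

lemma Reachable.inv (hP : P.Valid) (hf : ContDiff ℝ 2 f) (hε : 0 < ε) {ν H : ℝ}
    (hsh : SegHolder f x0 ν H) (h : Reachable f ε P x0 s) : NCGInv f ε P x0 ν H s := by
  induction h with
  | refl => exact ncgInv_init hP f ε x0 ν H
  | tail _ hstep ih => exact ih.step hP hε hsh (hstep.outcome hP hf hε x0)

lemma inv_mul_sqrt_div {σ : ℝ} (hσ : 0 < σ) (hε : 0 < ε) :
    √σ * ε ^ (-(3 / 2) : ℝ) * (ε * √(ε / σ)) = 1 := by
  have h1 : ε ^ (-(3 / 2) : ℝ) = (ε * √ε)⁻¹ := by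
    rw [Real.rpow_neg hε.le]
    congr 1
    rw [Real.sqrt_eq_rpow]
    nth_rewrite 2 [← Real.rpow_one ε]
    rw [← Real.rpow_add hε]; norm_num
  rw [h1, Real.sqrt_div hε.le]
  have := Real.sqrt_pos.2 hσ
  have := Real.sqrt_pos.2 hε
  field_simp

lemma NCGInv.outer_le_K1bar (hP : P.Valid) (hε : 0 < ε) {ν H flow : ℝ}
    (hflow : ∀ x ∈ levelSet f x0, flow ≤ f x) (hs : NCGInv f ε P x0 ν H s) :
    s.outer ≤ K1bar P ν H ε (f x0 - flow) := by
  have hD := outerDecrease_pos hP ν H hε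
  have hc := decFactor_pos hP
  have hlow := hflow s.x hs.level
  have h1 : ((s.outer : ℝ) - 1) * outerDecrease P ν H ε ≤ f x0 - flow := by
    rcases hs.outer_le with h | h <;> linarith [h]
  have h2 : (f x0 - flow) / min (cSolHat P) (cNc P) * √(sigmaMax P ν H ε) * ε ^ (-(3 / 2) : ℝ) =
      (f x0 - flow) / outerDecrease P ν H ε := by
    rw [eq_div_iff hD.ne', outerDecrease, decFactor]
    have := inv_mul_sqrt_div (sigmaMax_pos hP ν H ε) hε
    rw [decFactor] at hc
    calc _ = (f x0 - flow) / min (cSolHat P) (cNc P) * min (cSolHat P) (cNc P) *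
          (√(sigmaMax P ν H ε) * ε ^ (-(3 / 2) : ℝ) * (ε * √(ε / sigmaMax P ν H ε))) := by ring
      _ = _ := by rw [this, mul_one, div_mul_cancel₀ _ hc.ne']
  rw [K1bar, h2]
  have h3 : (s.outer : ℝ) - 1 ≤ (f x0 - flow) / outerDecrease P ν H ε := by
    rwa [le_div_iff₀ hD]
  have h4 := h3.trans (Nat.le_ceil _)
  have h5 : (s.outer : ℝ) ≤ ((⌈(f x0 - flow) / outerDecrease P ν H ε⌉₊ + 1 : ℕ) : ℝ) := by
    push_cast; linarith
  exact_mod_cast h5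

/-- Since γ r^t ≤ rσ ≤ rσ(ε), comparing exponents in `pow_le` gives the bound. -/
lemma NCGInv.inner_le (hP : P.Valid) {ν H : ℝ} (hs : NCGInv f ε P x0 ν H s) :
    s.inner ≤ innerT P ν H ε + 2 * s.outer := by
  have hr1 := hP.one_lt_r
  have hr0 : 0 < P.r := by linarith
  have hγ := hP.γinit_pos
  have hσm := sigmaMax_pos hP ν H ε
  set N := ⌈Real.log (sigmaMax P ν H ε / P.γinit) / Real.log P.r⌉₊ with hN
  have h1 : s.γ * P.r ^ s.t ≤ trialSigma P s * P.r := by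
    rw [trialSigma, mul_assoc, mul_comm s.γ]
    refine mul_le_mul_of_nonneg_left ?_ (by positivity)
    rw [← div_le_iff₀ hr0]
    exact le_max_right _ _
  have h2 : sigmaMax P ν H ε / P.γinit ≤ P.r ^ N := by
    rw [← Real.log_le_log_iff (by positivity) (by positivity), Real.log_pow,
      ← div_le_iff₀ (Real.log_pos hr1)]
    exact Nat.le_ceil _
  have h3 : P.r ^ s.inner ≤ P.r ^ (N + 1 + 2 * s.outer) := by
    rw [div_le_iff₀ hγ] at h2
    have : P.γinit * P.r ^ s.inner ≤ P.γinit * P.r ^ (N + 1 + 2 * s.outer) := by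
      calc _ ≤ s.γ * P.r ^ (s.t + 2 * s.outer) := hs.pow_le
        _ = s.γ * P.r ^ s.t * P.r ^ (2 * s.outer) := by ring
        _ ≤ P.r ^ N * P.γinit * P.r * P.r ^ (2 * s.outer) :=
          mul_le_mul_of_nonneg_right (h1.trans (mul_le_mul_of_nonneg_right
            (hs.sigma_le.trans h2) hr0.le)) (by positivity)
        _ = _ := by ring
    exact le_of_mul_le_mul_left this hγ
  have h4 := (pow_le_pow_iff_right₀ hr1).1 h3
  rw [innerT, ← hN]
  omega

lemma Reachable.inner_le (hP : P.Valid) (hf : ContDiff ℝ 2 f) (hε : 0 < ε) {ν H flow : ℝ}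
    (hsh : SegHolder f x0 ν H) (hflow : ∀ x ∈ levelSet f x0, flow ≤ f x)
    (h : Reachable f ε P x0 s) :
    s.inner ≤ innerT P ν H ε + 2 * K1bar P ν H ε (f x0 - flow) := by
  have hs := h.inv hP hf hε hsh
  have h1 := hs.inner_le hP
  have h2 := hs.outer_le_K1bar hP hε hflow
  omega

theorem iteration_complexity (hP : P.Valid) {Ω : Set (Vec n)} {ν H flow : ℝ}
    (hf : HolderHessian f x0 Ω ν H) (hflow : ∀ x ∈ levelSet f x0, flow ≤ f x) (hε : 0 < ε) :
    (∀ s : NCGState n, Reachable f ε P x0 s →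
      s.outer ≤ K1bar P ν H ε (f x0 - flow) ∧
      s.inner ≤ innerT P ν H ε + 2 * K1bar P ν H ε (f x0 - flow) ∧
      (‖gradient f s.x‖ ≤ ε ∨ ∃ s' : NCGState n, NCGStep f ε P s s')) ∧
    (¬ ∃ run : ℕ → NCGState n, run 0 = ncgInit P x0 ∧ ∀ i, NCGStep f ε P (run i) (run (i + 1))) ∧
    (∃ s : NCGState n, Reachable f ε P x0 s ∧ ‖gradient f s.x‖ ≤ ε) := by
  have hsh := hf.segHolder
  have hC := hf.contDiff
  have hprog : ∀ s : NCGState n, ‖gradient f s.x‖ ≤ ε ∨ ∃ s', NCGStep f ε P s s' := fun s =>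
    (le_or_gt _ _).imp_right (exists_ncgStep hP hC hε)
  have hfin : ¬ ∃ run : ℕ → NCGState n, run 0 = ncgInit P x0 ∧
      ∀ i, NCGStep f ε P (run i) (run (i + 1)) := by
    rintro ⟨run, h0, hrun⟩
    have hreach : ∀ i, Reachable f ε P x0 (run i) := by
      intro i
      induction i with
      | zero => rw [h0]; exact .refl
      | succ i ih => exact ih.tail (hrun i)
    have hinner : ∀ i, (run i).inner = i := by
      intro i
      induction i with
      | zero => rw [h0]; rfl
      | succ i ih => rw [((hrun i).outcome hP hC hε x0).inner_eq, ih]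
    have := (hreach (innerT P ν H ε + 2 * K1bar P ν H ε (f x0 - flow) + 1)).inner_le hP hC hε hsh
      hflow
    rw [hinner] at this
    omega
  refine ⟨fun s hs => ⟨(hs.inv hP hC hε hsh).outer_le_K1bar hP hε hflow,
    hs.inner_le hP hC hε hsh hflow, hprog s⟩, hfin, ?_⟩
  by_contra! hcon
  have hnext : ∀ s : {s : NCGState n // Reachable f ε P x0 s},
      ∃ s' : {s : NCGState n // Reachable f ε P x0 s}, NCGStep f ε P s.1 s'.1 := by
    rintro ⟨s, hs⟩
    obtain ⟨s', hs'⟩ := (hprog s).resolve_left (not_le.2 (hcon s hs))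
    exact ⟨⟨s', hs.tail hs'⟩, hs'⟩
  choose next hnext using hnext
  have h0 : Reachable f ε P x0 (ncgInit P x0) := .refl
  refine hfin ⟨fun i => (next^[i] ⟨ncgInit P x0, h0⟩).1, rfl, fun i => ?_⟩
  simp only [Function.iterate_succ_apply']
  exact hnext _

end

section

variable {P : Params} {ν H ε h : ℝ}

/-! ### Orders of the iteration bounds -/

lemma iterRate_pos (hH : 0 < H) (hε : 0 < ε) : 0 < iterRate ν H ε := by
  unfold iterRate; positivity

lemma rpow_three_halves (hε : 0 < ε) : ε ^ (3 / 2 : ℝ) = ε * √ε := by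
  rw [Real.sqrt_eq_rpow]
  nth_rewrite 2 [← Real.rpow_one ε]
  rw [← Real.rpow_add hε]; norm_num

/-- Holds because 1/(1+ν) ≤ 1 and (2+ν)/(1+ν) ≥ 3/2 for ν in [0,1]. It lets the rate absorb additive
constants and the term γ_{-1} in σ(ε). -/
lemma min_one_le_iterRate_mul (hν0 : 0 ≤ ν) (hν1 : ν ≤ 1) (hh : 0 < h) (hH : h ≤ H)
    (hε : 0 < ε) (hε1 : ε < 1) : min 1 h ≤ iterRate ν H ε * (ε * √ε) := by
  have hl0 : 0 < min 1 h := lt_min one_pos hh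
  have h1 : min 1 h ≤ H ^ (1 / (1 + ν)) := by
    calc min 1 h = (min 1 h) ^ (1 : ℝ) := (Real.rpow_one _).symm
      _ ≤ (min 1 h) ^ (1 / (1 + ν)) := by
        apply Real.rpow_le_rpow_of_exponent_ge hl0 (min_le_left _ _)
        rw [div_le_one (by linarith)]; linarith
      _ ≤ H ^ (1 / (1 + ν)) := by
        apply Real.rpow_le_rpow hl0.le ((min_le_right _ _).trans hH) (by positivity)
  have h2 : 1 ≤ ε ^ (-(2 + ν) / (1 + ν)) * (ε * √ε) := by
    rw [← rpow_three_halves hε, ← Real.rpow_add hε]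
    apply Real.one_le_rpow_of_pos_of_le_one_of_nonpos hε hε1.le
    rw [div_add_div _ _ (by positivity) (by norm_num)]
    apply div_nonpos_of_nonpos_of_nonneg <;> nlinarith
  calc min 1 h ≤ H ^ (1 / (1 + ν)) * 1 := by rwa [mul_one]
    _ ≤ H ^ (1 / (1 + ν)) * (ε ^ (-(2 + ν) / (1 + ν)) * (ε * √ε)) := by
      have : 0 ≤ H ^ (1 / (1 + ν)) := hl0.le.trans h1
      gcongr
    _ = _ := by unfold iterRate; ring

lemma mul_sqrt_le_one (hε1 : ε < 1) : ε * √ε ≤ 1 :=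
  mul_le_one₀ hε1.le (Real.sqrt_nonneg _) (Real.sqrt_le_one.2 hε1.le)

lemma gammaNu_eq (hν0 : 0 ≤ ν) (hH : 0 < H) (hε : 0 < ε) :
    gammaNu ν H ε = (2 * (iterRate ν H ε * (ε * √ε))) ^ 2 := by
  rw [← rpow_three_halves hε, iterRate, gammaNu, mul_assoc (H ^ _), ← Real.rpow_add hε, mul_pow,
    mul_pow, ← Real.rpow_natCast (H ^ _), ← Real.rpow_mul hH.le, ← Real.rpow_natCast (ε ^ _),
    ← Real.rpow_mul hε.le]
  have h1 : 1 / (1 + ν) * ((2 : ℕ) : ℝ) = 2 / (1 + ν) := by push_cast; ring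
  have h2 : (-(2 + ν) / (1 + ν) + 3 / 2) * ((2 : ℕ) : ℝ) = -(1 - ν) / (1 + ν) := by
    push_cast; field_simp; ring
  rw [h1, h2]; ring

/-- The constant in the bound of `√σ(ε)` by the iteration rate. -/
noncomputable def sigmaConst (P : Params) (h : ℝ) : ℝ := √P.γinit / min 1 h + 2 * √P.r

lemma sigmaConst_pos (hP : P.Valid) (hh : 0 < h) : 0 < sigmaConst P h := by
  have := hP.γinit_pos
  have := hP.one_lt_r
  unfold sigmaConst; positivity

lemma sqrt_sigmaMax_le (hP : P.Valid) (hν0 : 0 ≤ ν) (hν1 : ν ≤ 1) (hh : 0 < h) (hH : h ≤ H)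
    (hε : 0 < ε) (hε1 : ε < 1) :
    √(sigmaMax P ν H ε) ≤ sigmaConst P h * (iterRate ν H ε * (ε * √ε)) := by
  have hl := min_one_le_iterRate_mul hν0 hν1 hh hH hε hε1
  have hl0 : 0 < min 1 h := lt_min one_pos hh
  have hr := hP.one_lt_r
  have hH0 : 0 < H := hh.trans_le hH
  set B := iterRate ν H ε * (ε * √ε) with hB
  have hB0 : 0 < B := hl0.trans_le hl
  have h1 : √P.γinit ≤ √P.γinit / min 1 h * B := by
    rw [div_mul_eq_mul_div, le_div_iff₀ hl0]
    exact mul_le_mul_of_nonneg_left hl (Real.sqrt_nonneg _)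
  have h2 : √(P.r * gammaNu ν H ε) = 2 * √P.r * B := by
    rw [gammaNu_eq hν0 hH0 hε, Real.sqrt_mul (by linarith), Real.sqrt_sq (by positivity)]; ring
  have h3 : 0 ≤ √P.γinit / min 1 h * B := by positivity
  have h4 : 0 ≤ 2 * √P.r * B := by positivity
  unfold sigmaMax sigmaConst
  rcases max_cases P.γinit (P.r * gammaNu ν H ε) with ⟨h, -⟩ | ⟨h, -⟩ <;> rw [h]
  · linarith
  · rw [h2]; linarith

lemma exists_iteration_order (hP : P.Valid) {gap₀ : ℝ} (hh : 0 < h) :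
    ∃ C : ℝ, 0 < C ∧ ∀ ν H ε gap : ℝ,
      0 ≤ ν → ν ≤ 1 → h ≤ H → 0 < ε → ε < 1 → 0 ≤ gap → gap ≤ gap₀ →
      (K1bar P ν H ε gap : ℝ) ≤ C * iterRate ν H ε ∧
      (innerT P ν H ε : ℝ) + 2 * (K1bar P ν H ε gap : ℝ) ≤ C * iterRate ν H ε := by
  have hl0 : 0 < min 1 h := lt_min one_pos hh
  have hC1 := sigmaConst_pos hP hh
  have hc := decFactor_pos hP
  have hγ := hP.γinit_pos
  have hlr : 0 < Real.log P.r := Real.log_pos hP.one_lt_r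
  set C₁ := sigmaConst P h
  set CK := |gap₀| / decFactor P * C₁ + 2 / min 1 h with hCK
  set CT := 2 * C₁ / √P.γinit / Real.log P.r + 3 / min 1 h with hCT
  have hCK0 : 0 < CK := by positivity
  have hCT0 : 0 < CT := by positivity
  refine ⟨CT + 2 * CK, by positivity, ?_⟩
  intro ν H ε gap hν0 hν1 hH hε hε1 hgap hgap'
  have hH0 : 0 < H := hh.trans_le hH
  have hA := iterRate_pos (ν := ν) hH0 hε
  have hσ := sqrt_sigmaMax_le hP hν0 hν1 hh hH hε hε1
  have hl := min_one_le_iterRate_mul hν0 hν1 hh hH hε hε1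
  have hεε := mul_sqrt_le_one hε1
  have hσm := sigmaMax_pos hP ν H ε
  set A := iterRate ν H ε
  have hlA : min 1 h ≤ A := hl.trans (mul_le_of_le_one_right hA.le hεε)
  have h1A : 1 ≤ A / min 1 h := by rwa [le_div_iff₀ hl0, one_mul]
  have hK : (K1bar P ν H ε gap : ℝ) ≤ CK * A := by
    have h1 : √(sigmaMax P ν H ε) * ε ^ (-(3 / 2) : ℝ) ≤ C₁ * A := by
      rw [Real.rpow_neg hε.le, rpow_three_halves hε, ← div_eq_mul_inv,
        div_le_iff₀ (by positivity)]
      linarith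
    have h2 : gap / min (cSolHat P) (cNc P) * √(sigmaMax P ν H ε) * ε ^ (-(3 / 2) : ℝ) ≤
        |gap₀| / decFactor P * (C₁ * A) := by
      rw [mul_assoc]
      have : gap ≤ |gap₀| := hgap'.trans (le_abs_self _)
      unfold decFactor at hc ⊢
      gcongr
    have h0 : 0 ≤ gap / min (cSolHat P) (cNc P) * √(sigmaMax P ν H ε) * ε ^ (-(3 / 2) : ℝ) := by
      unfold decFactor at hc
      positivity
    have h3 := (Nat.ceil_lt_add_one h0).le
    rw [K1bar, Nat.cast_add, Nat.cast_one, hCK]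
    calc _ ≤ |gap₀| / decFactor P * (C₁ * A) + 2 * 1 := by linarith
      _ ≤ |gap₀| / decFactor P * (C₁ * A) + 2 * (A / min 1 h) := by gcongr
      _ = _ := by ring
  have hT : (innerT P ν H ε : ℝ) ≤ CT * A := by
    have hy1 : 1 ≤ sigmaMax P ν H ε / P.γinit := by
      rw [le_div_iff₀ hγ, one_mul]; exact le_max_left _ _
    have h1 : Real.log (sigmaMax P ν H ε / P.γinit) ≤ 2 * C₁ / √P.γinit * A := by
      -- Passing to the square root before using log y ≤ y produces √σ(ε), which is of the order of
      -- the rate.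
      have h2 : Real.log (√(sigmaMax P ν H ε / P.γinit)) ≤ √(sigmaMax P ν H ε / P.γinit) :=
        Real.log_le_self (Real.sqrt_nonneg _)
      rw [Real.log_sqrt (by positivity), Real.sqrt_div hσm.le] at h2
      have h3 : √(sigmaMax P ν H ε) / √P.γinit ≤ C₁ * A / √P.γinit := by
        gcongr
        refine hσ.trans ?_
        rw [← mul_assoc]
        exact mul_le_of_le_one_right (by positivity) hεε
      have h4 : C₁ * A / √P.γinit = C₁ / √P.γinit * A := by ring
      have h5 : 2 * C₁ / √P.γinit * A = 2 * (C₁ / √P.γinit * A) := by ring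
      linarith
    have h0 : 0 ≤ Real.log (sigmaMax P ν H ε / P.γinit) / Real.log P.r :=
      div_nonneg (Real.log_nonneg hy1) hlr.le
    have h3 := (Nat.ceil_lt_add_one h0).le
    have h4 : Real.log (sigmaMax P ν H ε / P.γinit) / Real.log P.r ≤
        2 * C₁ / √P.γinit * A / Real.log P.r := by gcongr
    rw [innerT, Nat.cast_add, hCT]
    push_cast
    calc _ ≤ 2 * C₁ / √P.γinit * A / Real.log P.r + 3 * 1 := by linarith
      _ ≤ 2 * C₁ / √P.γinit * A / Real.log P.r + 3 * (A / min 1 h) := by gcongr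
      _ = _ := by ring
  have hCKA := mul_pos hCK0 hA
  have hCTA := mul_pos hCT0 hA
  constructor <;> linarith

end

section

variable {n : ℕ} {f : Vec n → ℝ} {P : Params} {ε : ℝ} {x0 : Vec n} {s s' : NCGState n}

/-! ### Cost of a call of the capped CG method -/

/-- The weight `(σε)^{-1/4}` of an inner iteration. -/
noncomputable def cgWeight (σ ε : ℝ) : ℝ := 1 / √√(σ * ε)

lemma cgWeight_pos {σ : ℝ} (hσ : 0 < σ) (hε : 0 < ε) : 0 < cgWeight σ ε := by
  unfold cgWeight; positivity

lemma cgWeight_anti {σ σ' : ℝ} (hσ : 0 < σ) (hε : 0 < ε) (h : σ ≤ σ') :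
    cgWeight σ' ε ≤ cgWeight σ ε := by
  unfold cgWeight; gcongr

lemma cgWeight_mul {r σ : ℝ} (hr : 0 < r) : cgWeight (r * σ) ε = 1 / √√r * cgWeight σ ε := by
  unfold cgWeight
  rw [mul_assoc, Real.sqrt_mul hr.le, Real.sqrt_mul (Real.sqrt_nonneg r)]
  field_simp

lemma one_le_logTerm {U H : ℝ} (hU : 0 ≤ U) (hH : 0 ≤ H) (hε : 0 < ε) (hε1 : ε < 1) :
    1 ≤ logTerm U H ε := by
  have h1 : 0 ≤ Real.log (1 + U) := Real.log_nonneg (by linarith)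
  have h2 : 0 ≤ Real.log (1 + H) := Real.log_nonneg (by linarith)
  have h3 : 0 ≤ Real.log (1 / ε) := Real.log_nonneg (by rw [le_div_iff₀ hε]; linarith)
  unfold logTerm; linarith

lemma log_cgKappa_le {γ σ U H : ℝ} (hγ : 0 < γ) (hσ : γ ≤ σ) (hU : 0 ≤ U) (hH : 0 ≤ H)
    (hε : 0 < ε) (hε1 : ε < 1) :
    Real.log (cgKappa √(σ * ε) U) ≤ (Real.log (2 + 1 / √γ) + 1) * logTerm U H ε := by
  have hL := one_le_logTerm hU hH hε hε1
  have hσ0 : 0 < σ := hγ.trans_le hσ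
  have he : 0 < √(σ * ε) := by positivity
  have hse : ε ≤ √ε := by
    apply Real.le_sqrt_of_sq_le; nlinarith
  have h0 : cgKappa √(σ * ε) U = U / √(σ * ε) + 2 := by
    rw [cgKappa]; field_simp
  have h1 : U / √(σ * ε) ≤ U * (1 / √γ * (1 / ε)) := by
    rw [div_eq_mul_one_div, one_div_mul_one_div]
    have : √γ * ε ≤ √(σ * ε) := by
      rw [Real.sqrt_mul hσ0.le]
      gcongr
    gcongr
  have h2 : cgKappa √(σ * ε) U ≤ (1 + U) * ((2 + 1 / √γ) * (1 / ε)) := by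
    have h3 : 1 ≤ 1 / ε := by rw [le_div_iff₀ hε]; linarith
    have h4 : 0 ≤ U * (2 * (1 / ε)) := by positivity
    have h5 : 0 ≤ 1 / √γ * (1 / ε) := by positivity
    rw [h0]
    linarith
  have hκ := cgKappa_ge_two he hU
  have h3 := Real.log_le_log (by linarith) h2
  rw [Real.log_mul (by positivity) (by positivity), Real.log_mul (by positivity) (by positivity)]
    at h3
  have h4 : 0 ≤ Real.log (2 + 1 / √γ) := by
    apply Real.log_nonneg
    have : 0 ≤ 1 / √γ := by positivity
    linarith
  have h5 : 0 ≤ Real.log (1 + H) := Real.log_nonneg (by linarith)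
  have h6 : Real.log (2 + 1 / √γ) * 1 ≤ Real.log (2 + 1 / √γ) * logTerm U H ε := by gcongr
  have h7 : logTerm U H ε = 1 + Real.log (1 + U) + Real.log (1 + H) + Real.log (1 / ε) := rfl
  linarith

/-- The constant in the cost of a call of the capped CG method. -/
noncomputable def callConst (P : Params) : ℝ :=
  8 + 32 * (Real.log (24 / P.ζ) + 4 * (Real.log (2 + 1 / √P.γinit) + 1))

lemma log_const_nonneg (hP : P.Valid) :
    0 ≤ Real.log (24 / P.ζ) + 4 * (Real.log (2 + 1 / √P.γinit) + 1) := by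
  have h1 : 0 ≤ Real.log (24 / P.ζ) := Real.log_nonneg (by
    rw [le_div_iff₀ hP.ζ_mem.1]; linarith [hP.ζ_mem.2])
  have h2 : 0 ≤ Real.log (2 + 1 / √P.γinit) := by
    apply Real.log_nonneg
    have : 0 ≤ 1 / √P.γinit := by positivity
    linarith
  linarith

lemma callConst_pos (hP : P.Valid) : 0 < callConst P := by
  have := log_const_nonneg hP
  unfold callConst; linarith

/-- With y = √U (σε)^{-1/4} one has κ = y² + 2, so √κ is at most 2(1 + y); the remaining factor is
logarithmic. -/
lemma call_cost_le (hP : P.Valid) {A : Vec n →L[ℝ] Vec n} {g : Vec n} {σ U H : ℝ}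
    (hσ : P.γinit ≤ σ) (hε : 0 < ε) (hε1 : ε < 1) (hA : ‖A‖ ≤ U) (hH : 0 ≤ H)
    {ty : DirType} {d : Vec n} {m : ℕ} (h : CappedCG A √(σ * ε) P.ζ g ty d m) :
    (m : ℝ) + 3 ≤ callConst P * logTerm U H ε * (1 + √U * cgWeight σ ε) := by
  have hγ := hP.γinit_pos
  have hσ0 : 0 < σ := hγ.trans_le hσ
  have he : 0 < √(σ * ε) := by positivity
  have hU : 0 ≤ U := (norm_nonneg A).trans hA
  have hL := one_le_logTerm hU hH hε hε1
  have hm := h.count_le_cond he hP.ζ_mem.1 hP.ζ_mem.2 hA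
  have hlog := log_cgKappa_le hγ hσ hU hH hε hε1
  have hd : 0 ≤ Real.log (24 / P.ζ) := Real.log_nonneg (by
    rw [le_div_iff₀ hP.ζ_mem.1]; linarith [hP.ζ_mem.2])
  have hK := log_const_nonneg hP
  set K := Real.log (24 / P.ζ) + 4 * (Real.log (2 + 1 / √P.γinit) + 1) with hKdef
  set y := √U * cgWeight σ ε with hy
  have hy0 : 0 ≤ y := mul_nonneg (Real.sqrt_nonneg _) (cgWeight_pos hσ0 hε).le
  have hsqrt : √(cgKappa √(σ * ε) U) ≤ 2 * (1 + y) := by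
    have h0 : cgKappa √(σ * ε) U = y ^ 2 + 2 := by
      rw [hy, cgWeight, mul_pow, div_pow, Real.sq_sqrt hU, Real.sq_sqrt he.le, cgKappa]
      field_simp
    rw [h0]
    apply Real.sqrt_le_iff.2 ⟨by positivity, by nlinarith⟩
  have hlog2 : Real.log (24 / P.ζ) + 4 * Real.log (cgKappa √(σ * ε) U) ≤ K * logTerm U H ε := by
    have : Real.log (24 / P.ζ) * 1 ≤ Real.log (24 / P.ζ) * logTerm U H ε := by gcongr
    rw [hKdef]
    linarith
  have h1 : 16 * √(cgKappa √(σ * ε) U) *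
      (Real.log (24 / P.ζ) + 4 * Real.log (cgKappa √(σ * ε) U)) ≤
      16 * (2 * (1 + y)) * (K * logTerm U H ε) := by
    calc _ ≤ 16 * √(cgKappa √(σ * ε) U) * (K * logTerm U H ε) := by gcongr
      _ ≤ _ := by gcongr
  have h2 : 8 * 1 * 1 ≤ 8 * logTerm U H ε * (1 + y) := by
    gcongr; linarith
  have h3 : callConst P * logTerm U H ε * (1 + y) =
      8 * logTerm U H ε * (1 + y) + 16 * (2 * (1 + y)) * (K * logTerm U H ε) := by
    rw [callConst, ← hKdef]; ring
  rw [h3]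
  linarith

/-! ### Total cost -/

lemma Reachable.cost_le_dim (hP : P.Valid) (hf : ContDiff ℝ 2 f) (hε : 0 < ε) (hn : 0 < n)
    (h : Reachable f ε P x0 s) : s.grads + s.hvps ≤ 1 + 8 * n * s.inner := by
  induction h with
  | refl => simp [ncgInit]
  | @tail b c _ hstep ih =>
    have ho := hstep.outcome hP hf hε x0
    obtain ⟨ty, d, m, hcg, hcost⟩ := ho.call
    have hσ := trialSigma_pos hP b
    have := hcg.count_le_dim (inner_hess_comm hf _) (by positivity) hP.ζ_mem.1
      (norm_pos_iff.1 (hε.trans ho.grad_large))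
    rw [ho.inner_eq]
    have : 8 * n * (b.inner + 1) = 8 * n * b.inner + 8 * n := by ring
    omega

/-- The ratio of successive weights. -/
noncomputable def weightRatio (P : Params) : ℝ := 1 / √√P.r

lemma weightRatio_mem (hP : P.Valid) : 0 < weightRatio P ∧ weightRatio P < 1 := by
  have hr := hP.one_lt_r
  have h0 : 0 < P.r := by linarith
  have h1 : 1 < √√P.r := by
    rw [Real.lt_sqrt zero_le_one, one_pow, Real.lt_sqrt zero_le_one, one_pow]; exact hr
  unfold weightRatio
  refine ⟨by positivity, ?_⟩
  rw [div_lt_one (by linarith)]; exact h1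

/-- The accumulated weight of the inner iterations, up to the share of a final step. -/
noncomputable def weightBound (f : Vec n → ℝ) (ε : ℝ) (P : Params) (x0 : Vec n) (ν H : ℝ)
    (s : NCGState n) : ℝ :=
  (cgWeight P.γinit ε - cgWeight (trialSigma P s) ε) / (1 - weightRatio P) +
    (1 + 1 / weightRatio P) * (√√(sigmaMax P ν H ε * ε) / ε ^ 2 / decFactor P) * (f x0 - f s.x)

/-- In the identity (σε)^{-1/4} = (σε)^{1/4} ε^{-2}·ε√(ε/σ) only the first factor is enlarged to σm;
the last is the guaranteed decrease. -/
lemma cgWeight_le_decrease {σ σm : ℝ} (hσ : 0 < σ) (hσm : σ ≤ σm) (hε : 0 < ε) :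
    cgWeight σ ε ≤ √√(σm * ε) / ε ^ 2 * (ε * √(ε / σ)) := by
  obtain ⟨he, hδ0, hδ, hεδ⟩ := sqrt_mul_sqrt_div hσ hε
  have h1 : cgWeight σ ε = √√(σ * ε) / ε ^ 2 * (ε * √(ε / σ)) := by
    have hq : 0 < √√(σ * ε) := by positivity
    have hq2 : √√(σ * ε) ^ 2 = √(σ * ε) := Real.sq_sqrt he.le
    rw [cgWeight, div_eq_iff hq.ne']
    calc (1 : ℝ) = ε / ε := (div_self hε.ne').symm
      _ = √√(σ * ε) ^ 2 * √(ε / σ) / ε := by rw [hq2, hεδ]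
      _ = _ := by field_simp
  rw [h1]
  gcongr

/-- A rejection turns w into ρw, and (w - ρw)/(1 - ρ) pays exactly for w. An acceptance may raise
the next weight to w/ρ, costing w/ρ besides w itself: hence the factor 1 + 1/ρ, covered by the
decrease of f, or by the extra term when the run ends. -/
lemma cost_step (hP : P.Valid) (hε : 0 < ε) {ν H : ℝ}
    (hs : NCGInv f ε P x0 ν H s) (h : StepOutcome f ε P x0 s s') :
    weightBound f ε P x0 ν H s + cgWeight (trialSigma P s) ε ≤ weightBound f ε P x0 ν H s' ∨
    (‖gradient f s'.x‖ ≤ ε ∧ weightBound f ε P x0 ν H s + cgWeight (trialSigma P s) ε ≤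
      weightBound f ε P x0 ν H s' + (1 + 1 / weightRatio P) * cgWeight P.γinit ε) := by
  have hr0 : 0 < P.r := by linarith [hP.one_lt_r]
  have hσ := trialSigma_pos hP s
  have hγ := hP.γinit_pos
  obtain ⟨hρ0, hρ1⟩ := weightRatio_mem hP
  have hc := decFactor_pos hP
  have hw := cgWeight_pos hσ hε
  have hρ : 0 < 1 - weightRatio P := by linarith
  set Q := √√(sigmaMax P ν H ε * ε) / ε ^ 2 with hQ
  have hQ0 : 0 ≤ Q := by positivity
  set w := cgWeight (trialSigma P s) ε with hwdef
  set ρ := weightRatio P with hρdef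
  have hG : 0 < 1 + 1 / ρ := by positivity
  rcases h.result with ⟨hγ', ht, ho, hf⟩ | ⟨hx, hγ', ht, ho, hlt⟩
  · have hw' : cgWeight (trialSigma P s') ε ≤ w / ρ := by
      have h1 : trialSigma P s / P.r ≤ trialSigma P s' := by
        conv_rhs => rw [trialSigma, ht, hγ', pow_zero, one_mul]
        exact le_max_right _ _
      refine (cgWeight_anti (by positivity) hε h1).trans (le_of_eq ?_)
      have h2 := cgWeight_mul (ε := ε) (σ := trialSigma P s / P.r) hr0
      rw [mul_div_cancel₀ _ hr0.ne'] at h2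
      rw [hwdef, h2, hρdef, weightRatio]
      field_simp
    have hB : (cgWeight P.γinit ε - w) / (1 - ρ) + w ≤
        (cgWeight P.γinit ε - cgWeight (trialSigma P s') ε) / (1 - ρ) + (1 + 1 / ρ) * w := by
      have h1 : (cgWeight P.γinit ε - w / ρ) / (1 - ρ) ≤
          (cgWeight P.γinit ε - cgWeight (trialSigma P s') ε) / (1 - ρ) := by gcongr
      have h2 : (cgWeight P.γinit ε - w / ρ) / (1 - ρ) =
          (cgWeight P.γinit ε - w) / (1 - ρ) - w / ρ := by
        field_simp; ring
      have h3 : (1 + 1 / ρ) * w = w + w / ρ := by ring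
      linarith
    rcases hf with hf | hf
    · right
      refine ⟨hf.2, ?_⟩
      have h1 : (1 + 1 / ρ) * w ≤ (1 + 1 / ρ) * cgWeight P.γinit ε :=
        mul_le_mul_of_nonneg_left (cgWeight_anti hγ hε (trialSigma_ge hP s)) hG.le
      have h2 : (1 + 1 / ρ) * (Q / decFactor P) * (f x0 - f s.x) ≤
          (1 + 1 / ρ) * (Q / decFactor P) * (f x0 - f s'.x) := by
        have := hf.1
        gcongr
      unfold weightBound
      linarith
    · left
      have h1 : w ≤ Q / decFactor P * (f s.x - f s'.x) := by
        calc w ≤ Q * (ε * √(ε / trialSigma P s)) := cgWeight_le_decrease hσ hs.sigma_le hε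
          _ = Q / decFactor P * (decFactor P * (ε * √(ε / trialSigma P s))) := by field_simp
          _ ≤ _ := by gcongr; linarith
      have h2 := mul_le_mul_of_nonneg_left h1 hG.le
      unfold weightBound
      linarith
  · left
    have h2 : trialSigma P s' = P.r * trialSigma P s := by
      rw [trialSigma, trialSigma, ht, hγ']; ring
    have h3 : cgWeight (trialSigma P s') ε = ρ * w := by
      rw [h2, cgWeight_mul hr0]; rfl
    have h4 : (cgWeight P.γinit ε - w) / (1 - ρ) + w =
        (cgWeight P.γinit ε - ρ * w) / (1 - ρ) := by
      field_simp; ring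
    unfold weightBound
    rw [h3, hx, ← h4]
    linarith

lemma Reachable.cost_le_weight (hP : P.Valid) (hf : ContDiff ℝ 2 f) (hε : 0 < ε) (hε1 : ε < 1)
    {ν H U : ℝ} (hsh : SegHolder f x0 ν H) (hU : ∀ x ∈ levelSet f x0, ‖hess f x‖ ≤ U)
    (h : Reachable f ε P x0 s) :
    ((s.grads + s.hvps : ℕ) : ℝ) ≤ 1 + callConst P * logTerm U H ε *
        (s.inner + √U * weightBound f ε P x0 ν H s) ∨
    (‖gradient f s.x‖ ≤ ε ∧ ((s.grads + s.hvps : ℕ) : ℝ) ≤ 1 + callConst P * logTerm U H ε *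
        (s.inner + √U * (weightBound f ε P x0 ν H s +
          (1 + 1 / weightRatio P) * cgWeight P.γinit ε))) := by
  have hH := hsh.pos
  have hU0 : 0 ≤ U := (norm_nonneg _).trans (hU x0 (le_refl (f x0)))
  have hL := one_le_logTerm hU0 hH.le hε hε1
  have hC := callConst_pos hP
  have hγ := hP.γinit_pos
  induction h with
  | refl =>
    left
    have h1 : 0 ≤ weightBound f ε P x0 ν H (ncgInit P x0) := by
      have h2 : cgWeight (trialSigma P (ncgInit P x0)) ε ≤ cgWeight P.γinit ε :=
        cgWeight_anti hγ hε (trialSigma_ge hP _)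
      have h3 := weightRatio_mem hP
      unfold weightBound
      simp only [ncgInit, sub_self, mul_zero, add_zero] at h2 ⊢
      apply div_nonneg <;> linarith [h3.2]
    have h2 : 0 ≤ callConst P * logTerm U H ε *
      (((ncgInit P x0).inner : ℝ) + √U * weightBound f ε P x0 ν H (ncgInit P x0)) := by positivity
    have h3 : (ncgInit P x0).grads + (ncgInit P x0).hvps = 1 := rfl
    rw [h3]
    push_cast
    linarith
  | @tail b c hb hstep ih =>
    have hinv := Reachable.inv hP hf hε hsh hb
    have ho := hstep.outcome hP hf hε x0
    -- A step is taken only from a large gradient, so the allowance for a final step has not been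
    -- used before.
    have ih := ih.resolve_right fun hcon => absurd ho.grad_large (not_lt.2 hcon.1)
    obtain ⟨ty, d, m, hcg, hcost⟩ := ho.call
    have hm := call_cost_le hP (trialSigma_ge hP b) hε hε1 (hU b.x hinv.level) hH.le hcg
    have hcost' : ((c.grads + c.hvps : ℕ) : ℝ) ≤ ((b.grads + b.hvps : ℕ) : ℝ) + ((m : ℝ) + 3) := by
      exact_mod_cast hcost
    have hCL : 0 ≤ callConst P * logTerm U H ε := by positivity
    have hinner : (c.inner : ℝ) = b.inner + 1 := by rw [ho.inner_eq]; push_cast; ring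
    have hsum : ((c.grads + c.hvps : ℕ) : ℝ) ≤ 1 + callConst P * logTerm U H ε *
        (c.inner + √U * (weightBound f ε P x0 ν H b + cgWeight (trialSigma P b) ε)) := by
      rw [hinner]
      linarith
    rcases cost_step hP hε hinv ho with h1 | ⟨hg, h1⟩
    · left
      refine hsum.trans ?_
      gcongr
    · right
      refine ⟨hg, hsum.trans ?_⟩
      gcongr

end

section

variable {n : ℕ} {P : Params} {ε ν H : ℝ}

/-! ### Operation complexity -/

lemma iterRate_eq_sq (hν0 : 0 ≤ ν) (hH : 0 < H) (hε : 0 < ε) :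
    iterRate ν H ε = ((H * ε ^ ν) ^ (1 / (2 + 2 * ν)) / ε) ^ 2 := by
  have h2 : ε ^ 2 = ε ^ (2 : ℝ) := by norm_num
  rw [div_pow, ← Real.rpow_natCast (_ ^ _), ← Real.rpow_mul (by positivity),
    Real.mul_rpow hH.le (by positivity), ← Real.rpow_mul hε.le, h2, mul_div_assoc,
    ← Real.rpow_sub hε, iterRate]
  congr 2 <;> · push_cast; field_simp; try ring

lemma iterRate_zero {U : ℝ} : iterRate 0 U ε = U * ε ^ (-2 : ℝ) := by
  simp [iterRate]

/-- The weight of the first inner iteration in terms of the ratio bounding weight by decrease. -/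
lemma cgWeight_init_le (hP : P.Valid) (hε : 0 < ε) (hε1 : ε < 1) {σm Q : ℝ}
    (hσm : P.γinit ≤ σm) (hQ : Q = √√(σm * ε) / ε ^ 2) :
    cgWeight P.γinit ε ≤ 1 / √P.γinit * Q := by
  have hγ := hP.γinit_pos
  have hq : 0 < √√(P.γinit * ε) := by positivity
  have h1 : √√(P.γinit * ε) ≤ √√(σm * ε) := by gcongr
  have h2 : √√(P.γinit * ε) ^ 2 = √P.γinit * √ε := by
    rw [Real.sq_sqrt (Real.sqrt_nonneg _), Real.sqrt_mul hγ.le]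
  have h3 : ε ^ 2 ≤ √ε := by
    apply Real.le_sqrt_of_sq_le
    have := pow_le_pow_of_le_one hε.le hε1.le (by norm_num : 1 ≤ 4)
    calc (ε ^ 2) ^ 2 = ε ^ 4 := by ring
      _ ≤ ε := by simpa using this
  calc cgWeight P.γinit ε = √√(P.γinit * ε) / (√P.γinit * √ε) := by
        rw [cgWeight, ← h2]; field_simp
    _ ≤ √√(σm * ε) / (√P.γinit * ε ^ 2) := by gcongr
    _ = _ := by rw [hQ]; field_simp

lemma one_le_iterBound (P : Params) (ν H ε gap : ℝ) :
    (1 : ℝ) ≤ innerT P ν H ε + 2 * K1bar P ν H ε gap := by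
  have : 1 ≤ innerT P ν H ε + 2 * K1bar P ν H ε gap := by unfold innerT; omega
  exact_mod_cast this

lemma le_sqrt_mul_of_le {x a b : ℝ} (hx : 0 ≤ x) (ha : x ≤ a) (hb : x ≤ b) : x ≤ √(a * b) := by
  apply Real.le_sqrt_of_sq_le
  rw [sq]
  exact mul_le_mul ha hb hx (hx.trans ha)

set_option maxHeartbeats 1000000 in
theorem operation_complexity (hP : P.Valid) {h u : ℝ} (gap₀ : ℝ) (hh : 0 < h) (hu : 0 < u) :
    ∃ C : ℝ, ∀ (n : ℕ) (f : Vec n → ℝ) (x0 : Vec n) (Ω : Set (Vec n)) (ν H flow U ε : ℝ),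
      0 < n → HolderHessian f x0 Ω ν H → h ≤ H →
      (∀ x ∈ levelSet f x0, flow ≤ f x) → f x0 - flow ≤ gap₀ →
      (∀ x ∈ levelSet f x0, ‖hess f x‖ ≤ U) → u ≤ U → 0 < ε → ε < 1 →
      ∀ s : NCGState n, Reachable f ε P x0 s →
        ((s.grads + s.hvps : ℕ) : ℝ)
          ≤ C * (cgRate n U ν H ε * iterRate ν H ε) * logTerm U H ε ^ 2 := by
  obtain ⟨C₁, hC₁, hord₁⟩ := exists_iteration_order (gap₀ := gap₀) hP hh
  obtain ⟨C₂, hC₂, hord₂⟩ := exists_iteration_order (gap₀ := gap₀) (h := 2 * u) hP (by positivity)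
  obtain ⟨hρ0, hρ1⟩ := weightRatio_mem hP
  have hρ : 0 < 1 - weightRatio P := by linarith
  have hγ := hP.γinit_pos
  have hcd := decFactor_pos hP
  have hcc := callConst_pos hP
  have hsc := sigmaConst_pos hP hh
  set G := 1 + 1 / weightRatio P with hG
  have hG0 : 0 < G := by positivity
  set R := √(2 * C₁ * C₂) with hR
  have hR0 : 0 < R := by positivity
  set W := (1 / √P.γinit / (1 - weightRatio P) + G / decFactor P * |gap₀| + G * (1 / √P.γinit)) *
    √(sigmaConst P h) with hW
  have hW0 : 0 ≤ W := by positivity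
  -- 9 = 8 + 1, the 1 being the initial gradient; in the second entry the first R pays for it.
  refine ⟨max (9 * C₁) (R + callConst P * (R + W)), ?_⟩
  intro n f x0 Ω ν H flow U ε hn hf hH hflow hgap hU huU hε hε1 s hs
  have hsh := hf.segHolder
  have hC := hf.contDiff
  have hH0 := hsh.pos
  have hU0 : 0 < U := hu.trans_le huU
  have hgap0 : 0 ≤ f x0 - flow := sub_nonneg.2 (hflow x0 (le_refl (f x0)))
  have hL := one_le_logTerm hU0.le hH0.le hε hε1
  have hA0 := iterRate_pos (ν := ν) hH0 hε
  have hAeq := iterRate_eq_sq hsh.nonneg hH0 hε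
  have hord1 := (hord₁ ν H ε _ hsh.nonneg hsh.le_one hH hε hε1 hgap0 hgap).2
  have hord2 := (hord₂ 0 (2 * U) ε _ le_rfl zero_le_one (by linarith) hε hε1 hgap0 hgap).2
  have hin1 := hs.inner_le hP hC hε hsh hflow
  have hin2 := hs.inner_le hP hC hε (segHolder_of_norm_hess_le hU0 hU) hflow
  have hinv := hs.inv hP hC hε hsh
  set A := iterRate ν H ε with hA
  set a := (H * ε ^ ν) ^ (1 / (2 + 2 * ν)) with ha
  have ha0 : 0 < a := by positivity
  set L := logTerm U H ε with hLdef
  set X := √U / a * A with hX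
  have hX0 : 0 < X := by positivity
  have hXeq : X = √U * (a / ε ^ 2) := by
    rw [hX, hAeq]; field_simp
  -- the number of inner iterations is bounded by both rates
  have hone1 : (1 : ℝ) ≤ C₁ * A := (one_le_iterBound P ν H ε _).trans hord1
  have hone2 : (1 : ℝ) ≤ C₂ * iterRate 0 (2 * U) ε := (one_le_iterBound P 0 (2 * U) ε _).trans hord2
  have hN1 : (s.inner : ℝ) ≤ C₁ * A := le_trans (by exact_mod_cast hin1) hord1
  have hN2 : (s.inner : ℝ) ≤ C₂ * iterRate 0 (2 * U) ε := le_trans (by exact_mod_cast hin2) hord2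
  -- As A = (a/ε)², the product A·U/ε² is X²: the target rate is the geometric mean of the two
  -- bounds. The Hölder bound alone would not suffice when U is small compared with a².
  have hRX : √(C₁ * A * (C₂ * iterRate 0 (2 * U) ε)) = R * X := by
    have h1 : C₁ * A * (C₂ * iterRate 0 (2 * U) ε) = 2 * C₁ * C₂ * (U * (a / ε ^ 2) ^ 2) := by
      have h2 : ε ^ (-2 : ℝ) = (ε ^ 2)⁻¹ := by
        rw [Real.rpow_neg hε.le]; norm_num
      rw [iterRate_zero, hAeq, h2]; field_simp
    rw [h1, Real.sqrt_mul (by positivity), Real.sqrt_mul hU0.le, Real.sqrt_sq (by positivity), hXeq]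
  have honeX : 1 ≤ R * X := hRX ▸ le_sqrt_mul_of_le zero_le_one hone1 hone2
  have hNX : (s.inner : ℝ) ≤ R * X := hRX ▸ le_sqrt_mul_of_le (Nat.cast_nonneg _) hN1 hN2
  -- bound by the dimension
  have hdim : ((s.grads + s.hvps : ℕ) : ℝ) ≤ 9 * C₁ * (n * A) := by
    have h1 := hs.cost_le_dim hP hC hε hn
    have h2 : ((s.grads + s.hvps : ℕ) : ℝ) ≤ 1 + 8 * n * s.inner := by exact_mod_cast h1
    have h3 : (1 : ℝ) ≤ n := by exact_mod_cast hn
    have h4 : (8 * n * s.inner : ℝ) ≤ 8 * n * (C₁ * A) := by gcongr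
    have h5 : (1 : ℝ) * 1 ≤ n * (C₁ * A) := by gcongr
    linarith
  -- bound by the condition number
  set Q := √√(sigmaMax P ν H ε * ε) / ε ^ 2 with hQ
  have hQ0 : 0 ≤ Q := by positivity
  -- √(σ(ε)ε) is at most a constant times a², so its square root matches the factor a in X =
  -- √U·a/ε².
  have hUQ : √U * Q ≤ √(sigmaConst P h) * X := by
    have h1 := sqrt_sigmaMax_le hP hsh.nonneg hsh.le_one hh hH hε hε1
    have h2 : √(sigmaMax P ν H ε * ε) ≤ sigmaConst P h * a ^ 2 := by
      rw [Real.sqrt_mul (sigmaMax_pos hP ν H ε).le]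
      calc _ ≤ sigmaConst P h * (A * (ε * √ε)) * √ε := by gcongr
        _ = sigmaConst P h * (A * (ε * (√ε * √ε))) := by ring
        _ = sigmaConst P h * a ^ 2 := by
          rw [Real.mul_self_sqrt hε.le, hAeq]; field_simp
    have h3 : √√(sigmaMax P ν H ε * ε) ≤ √(sigmaConst P h) * a := by
      calc _ ≤ √(sigmaConst P h * a ^ 2) := Real.sqrt_le_sqrt h2
        _ = _ := by rw [Real.sqrt_mul hsc.le, Real.sqrt_sq ha0.le]
    calc √U * Q ≤ √U * (√(sigmaConst P h) * a / ε ^ 2) := by rw [hQ]; gcongr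
      _ = _ := by rw [hXeq]; ring
  have hw0 := cgWeight_init_le hP hε hε1 (le_max_left P.γinit (P.r * gammaNu ν H ε)) (Q := Q) rfl
  have hw00 := cgWeight_pos hγ hε
  have hweight : √U * (weightBound f ε P x0 ν H s + G * cgWeight P.γinit ε) ≤ W * X := by
    have hlow := hflow s.x hinv.level
    have h1 : f x0 - f s.x ≤ |gap₀| := by
      have := le_abs_self gap₀; linarith
    have h2 : weightBound f ε P x0 ν H s + G * cgWeight P.γinit ε ≤
        (1 / √P.γinit / (1 - weightRatio P) + G / decFactor P * |gap₀| +
          G * (1 / √P.γinit)) * Q := by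
      have h3 : (cgWeight P.γinit ε - cgWeight (trialSigma P s) ε) / (1 - weightRatio P) ≤
          1 / √P.γinit * Q / (1 - weightRatio P) := by
        have := cgWeight_pos (trialSigma_pos hP s) hε
        gcongr
        linarith
      have h4 : G * (Q / decFactor P) * (f x0 - f s.x) ≤ G * (Q / decFactor P) * |gap₀| := by
        gcongr
      have h5 : G * cgWeight P.γinit ε ≤ G * (1 / √P.γinit * Q) := by gcongr
      unfold weightBound
      calc _ ≤ 1 / √P.γinit * Q / (1 - weightRatio P) + G * (Q / decFactor P) * |gap₀| +
            G * (1 / √P.γinit * Q) := by linarith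
        _ = _ := by ring
    calc _ ≤ √U * ((1 / √P.γinit / (1 - weightRatio P) + G / decFactor P * |gap₀| +
          G * (1 / √P.γinit)) * Q) := by gcongr
      _ = (1 / √P.γinit / (1 - weightRatio P) + G / decFactor P * |gap₀| +
          G * (1 / √P.γinit)) * (√U * Q) := by ring
      _ ≤ (1 / √P.γinit / (1 - weightRatio P) + G / decFactor P * |gap₀| +
          G * (1 / √P.γinit)) * (√(sigmaConst P h) * X) := by gcongr
      _ = _ := by rw [hW]; ring
  have hcond : ((s.grads + s.hvps : ℕ) : ℝ) ≤ (R + callConst P * (R + W)) * X * L := by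
    have h1 : ((s.grads + s.hvps : ℕ) : ℝ) ≤ 1 + callConst P * L *
        (s.inner + √U * (weightBound f ε P x0 ν H s + G * cgWeight P.γinit ε)) := by
      rcases hs.cost_le_weight hP hC hε hε1 hsh hU with h2 | h2
      · refine h2.trans ?_
        gcongr
        exact le_add_of_nonneg_right (by positivity)
      · exact h2.2
    have h2 : (1 : ℝ) ≤ R * X * L := by
      calc (1 : ℝ) = 1 * 1 := (one_mul 1).symm
        _ ≤ R * X * L := by gcongr
    calc _ ≤ R * X * L + callConst P * L * (R * X + W * X) := by
          refine h1.trans (add_le_add h2 ?_)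
          gcongr
      _ = _ := by ring
  have hLL : L ≤ L ^ 2 := le_self_pow₀ hL two_ne_zero
  have hrate : cgRate n U ν H ε * A = min (n * A) X := by
    rw [cgRate, min_mul_of_nonneg _ _ hA0.le]
  rw [hrate]
  set C := max (9 * C₁) (R + callConst P * (R + W)) with hCdef
  have hC0 : 0 < C := lt_max_of_lt_left (by positivity)
  rcases min_cases (n * A) X with ⟨h1, -⟩ | ⟨h1, -⟩ <;> rw [h1]
  · calc _ ≤ 9 * C₁ * (n * A) := hdim
      _ ≤ C * (n * A) * 1 := by rw [mul_one]; gcongr; exact le_max_left _ _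
      _ ≤ C * (n * A) * L ^ 2 := by gcongr; exact one_le_pow₀ hL
  · calc _ ≤ (R + callConst P * (R + W)) * X * L := hcond
      _ ≤ C * X * L ^ 2 := by gcongr; exact le_max_right _ _

end

end ParamFreeNCG

theorem mainTheorem1 (P : Params) (hP : P.Valid) :
    -- iteration complexity: every execution is finite, never gets stuck, respects the bounds on
    -- the outer and inner iterations, and ends at a point with `‖∇f‖ ≤ ε`
    (∀ (n : ℕ) (f : Vec n → ℝ) (x0 : Vec n) (Ω : Set (Vec n)) (ν H flow ε : ℝ),
      HolderHessian f x0 Ω ν H →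
      (∀ x ∈ levelSet f x0, flow ≤ f x) →
      0 < ε → ε < 1 →
      (∀ s : NCGState n, Reachable f ε P x0 s →
        s.outer ≤ K1bar P ν H ε (f x0 - flow) ∧
        s.inner ≤ innerT P ν H ε + 2 * K1bar P ν H ε (f x0 - flow) ∧
        (‖gradient f s.x‖ ≤ ε ∨ ∃ s' : NCGState n, NCGStep f ε P s s')) ∧
      (¬ ∃ run : ℕ → NCGState n, run 0 = ncgInit P x0 ∧ ∀ i, NCGStep f ε P (run i) (run (i + 1))) ∧
      (∃ s : NCGState n, Reachable f ε P x0 s ∧ ‖gradient f s.x‖ ≤ ε)) ∧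
    -- orders of the two iteration bounds
    (∀ h gap₀ : ℝ, 0 < h → ∃ C : ℝ, ∀ ν H ε gap : ℝ,
      0 ≤ ν → ν ≤ 1 → h ≤ H → 0 < ε → ε < 1 → 0 ≤ gap → gap ≤ gap₀ →
      (K1bar P ν H ε gap : ℝ) ≤ C * iterRate ν H ε ∧
      (innerT P ν H ε : ℝ) + 2 * (K1bar P ν H ε gap : ℝ) ≤ C * iterRate ν H ε) ∧
    -- operation complexity; the logarithmic factor hidden in `Õ` is at most quadratic
    (∀ h u gap₀ : ℝ, 0 < h → 0 < u → ∃ C : ℝ,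
      ∀ (n : ℕ) (f : Vec n → ℝ) (x0 : Vec n) (Ω : Set (Vec n)) (ν H flow U ε : ℝ),
      0 < n →
      HolderHessian f x0 Ω ν H → h ≤ H →
      (∀ x ∈ levelSet f x0, flow ≤ f x) → f x0 - flow ≤ gap₀ →
      (∀ x ∈ levelSet f x0, ‖hess f x‖ ≤ U) → u ≤ U →
      0 < ε → ε < 1 →
      ∀ s : NCGState n, Reachable f ε P x0 s →
        ((s.grads + s.hvps : ℕ) : ℝ)
          ≤ C * (cgRate n U ν H ε * iterRate ν H ε) * logTerm U H ε ^ 2) := by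
  refine ⟨fun n f x0 Ω ν H flow ε hf hflow hε _ => iteration_complexity hP hf hflow hε, ?_, ?_⟩
  · intro h gap₀ hh
    obtain ⟨C, -, hC⟩ := exists_iteration_order (gap₀ := gap₀) hP hh
    exact ⟨C, hC⟩
  · intro h u gap₀ hh hu
    exact operation_complexity hP gap₀ hh hu
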